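/- Let $b\in(0,1)$ and let $u_0:[0,1]\to\mathbb{C}$ be piecewise Lipschitz, i.e. there are $0=x_0<x_1<\dots<x_{k+1}=1$ such that $u_0$ is Lipschitz on each open interval $(x_j,x_{j+1})$. Consider $$ u_t-iu_{xx}=0\ \ (0<x<b),\qquad u_t+iu_{xx}=0\ \ (b<x<1),\qquad t\in\mathbb{R}, $$ $$ u(0,t)=u(1,t)=0,\quad u(b^+,t)=u(b^-,t),\quad u_x(b^+,t)=-u_x(b^-,t),\qquad u(x,0)=u_0(x). $$ A solution is a function $u\in C(\mathbb{R};L^2(0,1))$ with $u(\cdot,0)=u_0$ such that $\frac{d}{dt}\langle u(\cdot,t),\varphi\rangle=-i\langle u(\cdot,t),D\varphi\rangle$ for all $t\in\mathbb R$ and all $\varphi\in\operatorname{Dom}(D)$. Here $D\varphi=(\operatorname{sgn}(\cdot-b)\varphi')'$, and $\operatorname{Dom}(D)$ consists of the absolutely continuous $\varphi$ on $[0,1]$ with $\varphi(0)=\varphi(1)=0$ and $\operatorname{sgn}(\cdot-b)\varphi'$ absolutely continuous with derivative in $L^2(0,1)$. **Theorem 2.2.** This problem has a unique solution $u$, and for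 all $t\in\mathbb{R}$ and almost all $x\in(0,b)$ $$u(x,t)=U_{\mathcal R}(x,t)+U_{\mathcal C}(x,t),$$ where $U_{\mathcal C}(\cdot,t)$ is continuous on $(0,b)$ and $$ U_{\mathcal R}(x,t)=\sum_{n=1}^\infty\widetilde{u_0}(n)\,e^{-i\left(\frac{\pi}{b}(n+\frac14)\right)^2t}\sin\Big(\frac{\pi}{b}\Big(n+\frac14\Big)x\Big), $$ $$ \widetilde{u_0}(n)=2\int_0^1\Big[u_0(by)\sin\Big(\pi\Big(n+\frac14\Big)y\Big)+u_0(b^+)\cos\Big(\pi\Big(n+\frac14\Big)y\Big)\Big]dy . $$ The series converges in $L^2(0,b)$ for each $t$, and $U_{\mathcal R}(x,t)$ equals its pointwise sum wherever the series converges. Let $G=G^b_{u_0}$ be the $2$-periodic extension from $[0,2)$ of $$ G(x)=e^{-i\frac{\pi x}{4}}\begin{cases}u_0(b^+)+iu_0(bx), & 0\le x\le 1,\\ iu_0(b^+)+u_0(b(2-x)), & 1< x\le 2,\end{cases} $$ let $\widehat{G}(n)=\frac12\int_0^2G(y)e^{-i\pi ny}dy$, and let $$\mathcal{H}G(x)=i\sum_{n=1}^\infty\big[\widehat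 G(-n)e^{-i\pi nx}-\widehat G(n)e^{i\pi nx}\big]$$ be its $2$-periodic Hilbert transform. Let $p,q\in\mathbb{N}$, $q\ge1$, be coprime, and put $$d_k^{p,q}=\frac1{2q}\sum_{m=0}^{2q-1}e^{-i(m+\frac14)^2\frac{2\pi p}{q}}e^{i\pi\frac{mk}{q}},$$ which is independent of $u_0$. Then for all $x\in(0,b)$ outside the set of those $x$ for which $G$ is discontinuous at one of the points $\pm\frac xb-\frac kq$, $0\le k<2q$ (this exceptional set is finite), the series defining $U_{\mathcal R}\big(x,\frac{2b^2}{\pi}\frac pq\big)$ and $\mathcal{H}G\big(\pm\frac xb-\frac kq\big)$ converge, and $$U_{\mathcal R}\Big(x,\frac{2b^2}{\pi}\frac pq\Big)=L_1(x)+L_2(x)+L_3(x),$$ where $$L_1(x)=\frac12\sum_{k=0}^{2q-1}d_k^{p,q}\Big[ie^{-i\frac{\pi}{4b}x}G\Big(-\frac xb-\frac kq\Big)-ie^{i\frac{\pi}{4b}x}G\Big(\frac xb-\frac kq\Big)\Big],$$ $$L_2(x)=\frac12\sum_{k=0}^{2q-1}d_k^{p,q}\Big[e^{i\frac{\pi}{4b}x}[\mathcal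 HG]\Big(\frac xb-\frac kq\Big)-e^{-i\frac{\pi}{4b}x}[\mathcal HG]\Big(-\frac xb-\frac kq\Big)\Big],$$ $$L_3(x)=-\Big[\frac12\int_0^2G(y)\,dy\Big]\sin\Big(\frac{\pi x}{4b}\Big)e^{-i\frac{\pi p}{8q}},$$ and $L_3$ is continuous. -/

import Mathlib

open MeasureTheory Filter Topology Set
open scoped ENNReal NNReal ComplexConjugate

namespace DislocatedSchrodinger

noncomputable section

/-- `f` is piecewise Lipschitz on `[0,1]`: there are nodes `0 = x₀ < x₁ < ⋯ < x_{k+1} = 1` such that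
`f` is Lipschitz on each open interval `(x_j, x_{j+1})`. The values at the nodes are arbitrary. -/
def PiecewiseLipschitz (f : ℝ → ℂ) : Prop :=
  ∃ (k : ℕ) (x : Fin (k + 2) → ℝ), StrictMono x ∧ x 0 = 0 ∧ x (Fin.last (k + 1)) = 1 ∧
    ∀ j : Fin (k + 1), ∃ K : ℝ≥0, LipschitzOnWith K f (Ioo (x j.castSucc) (x j.succ))

/-! ### The dislocated Dirichlet Laplacian and its Schroedinger evolution -/

/-- Lebesgue measure on the interval `(0,1)`. -/
abbrev unitMeasure : Measure ℝ := volume.restrict (Ioo 0 1)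

/-- `φ` lies in the domain of `D = ∂ₓ (sgn(x - b) ∂ₓ)` with Dirichlet conditions, and `w` is its
quasi-derivative: `φ` and `w = sgn(x - b) φ'` are absolutely continuous on `[0,1]`,
`φ(0) = φ(1) = 0`, and `w' ∈ L²(0,1)`, so that `D φ = w'` is in `L²(0,1)`.
Continuity of `w` at `b` is the interface condition `φ'(b⁺) = -φ'(b⁻)`. -/
structure IsInDomain (b : ℝ) (φ w : ℝ → ℂ) : Prop where
  ac : AbsolutelyContinuousOnInterval φ 0 1
  ac_quasi : AbsolutelyContinuousOnInterval w 0 1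
  quasi_eq : ∀ᵐ x ∂unitMeasure, w x = (SignType.sign (x - b) : ℝ) * deriv φ x
  left : φ 0 = 0
  right : φ 1 = 0
  memLp : MemLp (deriv w) 2 unitMeasure

/-- `u ∈ C(ℝ; L²(0,1))` is the (weak) solution of `∂ₜ u = -i D u`, `u(0) = u₀`, that is, of
`∂ₜ u = i u_xx` on `(0,b)` and `∂ₜ u = -i u_xx` on `(b,1)` with Dirichlet conditions at `0`, `1`
and the interface conditions `u(b⁺) = u(b⁻)`, `u_x(b⁺) = -u_x(b⁻)`:
for each `φ` in the domain of the self-adjoint operator `D`,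
`d/dt ⟨φ, u(t)⟩ = -i ⟨D φ, u(t)⟩` for all real `t`. -/
structure IsSolution (b : ℝ) (u₀ : ℝ → ℂ) (u : ℝ → Lp ℂ 2 unitMeasure) : Prop where
  continuous : Continuous u
  initial : ∀ᵐ x ∂unitMeasure, (u 0 : ℝ → ℂ) x = u₀ x
  evolution : ∀ φ w : ℝ → ℂ, IsInDomain b φ w → ∀ t : ℝ,
    HasDerivAt (fun s : ℝ => ∫ x, conj (φ x) * (u s : ℝ → ℂ) x ∂unitMeasure)
      (-Complex.I * ∫ x, conj (deriv w x) * (u t : ℝ → ℂ) x ∂unitMeasure) t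

/-! ### The revival series -/

/-- The coefficient
`2 ∫₀¹ [u₀(by) sin(π(n+1/4)y) + u₀(b⁺) cos(π(n+1/4)y)] dy`. -/
def coeff (b : ℝ) (u₀ : ℝ → ℂ) (n : ℕ) : ℂ :=
  2 * ∫ y in (0 : ℝ)..1,
    (u₀ (b * y) * (Real.sin (Real.pi * ((n : ℝ) + 1 / 4) * y) : ℂ)
      + Function.rightLim u₀ b * (Real.cos (Real.pi * ((n : ℝ) + 1 / 4) * y) : ℂ))

/-- The `N`-th partial sum (over `1 ≤ n ≤ N`) of the revival series
`∑ coeff(n) exp(-i (π/b (n+1/4))² t) sin(π/b (n+1/4) x)`. -/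
def revivalPartialSum (b : ℝ) (u₀ : ℝ → ℂ) (N : ℕ) (x t : ℝ) : ℂ :=
  ∑ n ∈ Finset.Icc 1 N, coeff b u₀ n *
    Complex.exp (-Complex.I * ((Real.pi / b * ((n : ℝ) + 1 / 4) : ℝ) : ℂ) ^ 2 * (t : ℂ)) *
    (Real.sin (Real.pi / b * ((n : ℝ) + 1 / 4) * x) : ℂ)

/-! ### The periodic Hilbert transform -/

/-- The Fourier coefficient `(1/l) ∫₀ˡ f(y) exp(-2πi n y / l) dy`. -/
def fourierCoefficient (l : ℝ) (f : ℝ → ℂ) (n : ℤ) : ℂ :=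
  1 / (l : ℂ) * ∫ y in (0 : ℝ)..l,
    f y * Complex.exp (-Complex.I * ((2 * Real.pi / l * (n : ℝ) * y : ℝ) : ℂ))

/-- Partial sums of the series of the `l`-periodic Hilbert transform,
`i ∑_{n=1}^N [f̂(-n) exp(-2πi n x / l) - f̂(n) exp(2πi n x / l)]`. -/
def hilbertPartialSum (l : ℝ) (f : ℝ → ℂ) (N : ℕ) (x : ℝ) : ℂ :=
  Complex.I * ∑ n ∈ Finset.Icc 1 N,
    (fourierCoefficient l f (-(n : ℤ)) *
        Complex.exp (-Complex.I * ((2 * Real.pi / l * (n : ℝ) * x : ℝ) : ℂ))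
      - fourierCoefficient l f (n : ℤ) *
        Complex.exp (Complex.I * ((2 * Real.pi / l * (n : ℝ) * x : ℝ) : ℂ)))

/-- The `l`-periodic Hilbert transform of `f` at `x`: the sum of its series. (Meaningful at the
points where the series converges; convergence is always claimed where this is used.) -/
def hilbertTransform (l : ℝ) (f : ℝ → ℂ) (x : ℝ) : ℂ :=
  limUnder atTop (fun N : ℕ => hilbertPartialSum l f N x)

/-! ### The function `G` and the finite sums at rational times -/

/-- The function `G` on the double interval `[0,2]`. -/
def profileCore (b : ℝ) (u₀ : ℝ → ℂ) (y : ℝ) : ℂ :=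
  Complex.exp (-Complex.I * ((Real.pi * y / 4 : ℝ) : ℂ)) *
    if y ≤ 1 then Function.rightLim u₀ b + Complex.I * u₀ (b * y)
    else Complex.I * Function.rightLim u₀ b + u₀ (b * (2 - y))

/-- The `2`-periodic extension of `G` from `[0,2)` to the real line. -/
def profile (b : ℝ) (u₀ : ℝ → ℂ) (y : ℝ) : ℂ :=
  profileCore b u₀ (2 * Int.fract (y / 2))

/-- The coefficients `d_k^{p,q} = (1/2q) ∑_{m=0}^{2q-1} exp(-i (m+1/4)² 2πp/q) exp(iπmk/q)`. -/
def dCoeff (p q k : ℕ) : ℂ :=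
  1 / (2 * (q : ℂ)) * ∑ m ∈ Finset.range (2 * q),
    Complex.exp (-Complex.I *
        ((((m : ℝ) + 1 / 4) ^ 2 * (2 * Real.pi * (p : ℝ) / (q : ℝ)) : ℝ) : ℂ)) *
      Complex.exp (Complex.I * ((Real.pi * (m : ℝ) * (k : ℝ) / (q : ℝ) : ℝ) : ℂ))

/-- The phase `exp(iπx/(4b))`. -/
def phase (b x : ℝ) : ℂ := Complex.exp (Complex.I * ((Real.pi / (4 * b) * x : ℝ) : ℂ))

/-- Translates and reflections of `G`. -/
def L₁ (b : ℝ) (u₀ : ℝ → ℂ) (p q : ℕ) (x : ℝ) : ℂ :=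
  1 / 2 * ∑ k ∈ Finset.range (2 * q), dCoeff p q k *
    (Complex.I * phase b (-x) * profile b u₀ (-(x / b) - (k : ℝ) / (q : ℝ))
      - Complex.I * phase b x * profile b u₀ (x / b - (k : ℝ) / (q : ℝ)))

/-- Translates and reflections of the `2`-periodic Hilbert transform of `G`. -/
def L₂ (b : ℝ) (u₀ : ℝ → ℂ) (p q : ℕ) (x : ℝ) : ℂ :=
  1 / 2 * ∑ k ∈ Finset.range (2 * q), dCoeff p q k *
    (phase b x * hilbertTransform 2 (profile b u₀) (x / b - (k : ℝ) / (q : ℝ))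
      - phase b (-x) * hilbertTransform 2 (profile b u₀) (-(x / b) - (k : ℝ) / (q : ℝ)))

/-- The continuous term `-(1/2) [∫₀² G] sin(πx/(4b)) exp(-iπp/(8q))`. -/
def L₃ (b : ℝ) (u₀ : ℝ → ℂ) (p q : ℕ) (x : ℝ) : ℂ :=
  -(1 / 2 * ∫ y in (0 : ℝ)..2, profile b u₀ y) *
    (Real.sin (Real.pi * x / (4 * b)) : ℂ) *
    Complex.exp (-Complex.I * ((Real.pi * (p : ℝ) / (8 * (q : ℝ)) : ℝ) : ℂ))

/-- The points `x ∈ (0,b)` for which one of the arguments `± x/b - k/q`, `0 ≤ k < 2q`, hits a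
discontinuity of the periodic function `G`. -/
def exceptionalSet (b : ℝ) (u₀ : ℝ → ℂ) (q : ℕ) : Set ℝ :=
  {x | x ∈ Ioo 0 b ∧ ∃ k < 2 * q,
    ¬ ContinuousAt (profile b u₀) (x / b - (k : ℝ) / (q : ℝ)) ∨
    ¬ ContinuousAt (profile b u₀) (-(x / b) - (k : ℝ) / (q : ℝ))}

end

end DislocatedSchrodinger

open DislocatedSchrodinger

open scoped BoundedContinuousFunction

namespace DislocatedSchrodinger

section

/-! ### Complex-valued absolutely continuous functions -/

namespace AC

variable {f g : ℝ → ℂ} {c d : ℝ}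

/-! The operator `D` is self-adjoint with compact resolvent, so it has an orthonormal eigenbasis in
which the evolution multiplies each coordinate by `exp(-ilt)`. At a real number that is not an
eigenvalue (`exists_greenData`) variation of constants gives the resolvent explicitly; it maps
`L²`-bounded sets to bounded, uniformly Lipschitz sets, so Arzelà–Ascoli makes it compact, and the
spectral theorem yields completeness (`span_eigunit_orthogonal`). Testing the weak equation with an
eigenfunction gives a scalar linear ODE for each coordinate, hence uniqueness; termwise
differentiation gives existence (`hasDerivAt_inner_diagEvolution`).

An eigenfunction for the eigenvalue `m²` is a multiple of `sin(mx)` on `(0,b)` and of `sinh(m(1-x))`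
on `(b,1)`; for `-m²` the two intervals exchange roles. Matching at `b` means `tan(mb) =
tanh(m(1-b))`. Since `tanh` tends to `1` exponentially fast, `m` is exponentially close to some
`(π/b)(n+1/4)` (`isFreq_iff`, `modelFreq_sub_freq_le`), and convexity of a phase function shows that
two explicit sequences miss only finitely many eigenvalues (`finite_rest`). On `(b,1)` the mode is
an exponential tail, which acts on `u₀` like `u₀(b⁺) sin(mb)/m`; this is the origin of the cosine
term in `coeff`, and the true coefficients differ from `coeff` by `O(n⁻²)`
(`exists_genCoeff_bound`). Hence the positive part of the expansion differs from the revival series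
by a uniformly convergent series of continuous functions. The negative modes decay away from `b`, so
their series converges locally uniformly on `(0,b)`. These two continuous sums and the finitely many
remaining terms make up `U_C` (`exists_decomposition`).

For rational times, folding `[0,2]` onto `[0,1]` identifies `coeff` with twice the Fourier
coefficient of `G` (`coeff_eq`), so the series is built from the positive-frequency half of the
Fourier series of `G` at `±x/b`. At time `(2b²/π)(p/q)` the time factor is `2q`-periodic in `n`, and
finite Fourier inversion turns it into translations by `k/q` with weights `d_k`
(`sum_dCoeff_mul_char`). Under Dini's condition, which a piecewise Lipschitz function satisfies
wherever it is continuous, the half series sums to `(G - Ĝ(0) + i𝓗G)/2` (`tendsto_half_series`). The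
three summands produce `L₁`, `L₃` and `L₂`. -/

theorem of_dist_le {X Y : Type*} [PseudoMetricSpace X] [PseudoMetricSpace Y] {f : ℝ → X} {g : ℝ → Y}
    {c d : ℝ} (hf : AbsolutelyContinuousOnInterval f c d)
    (h : ∀ x y, dist (g x) (g y) ≤ dist (f x) (f y)) : AbsolutelyContinuousOnInterval g c d :=
  squeeze_zero (fun _ => Finset.sum_nonneg fun _ _ => dist_nonneg)
    (fun _ => Finset.sum_le_sum fun _ _ => h _ _) hf

theorem _root_.IntervalIntegrable.complex_ofReal {f : ℝ → ℝ} {c d : ℝ}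
    (h : IntervalIntegrable f volume c d) :
    IntervalIntegrable (fun x => (f x : ℂ)) volume c d :=
  ⟨Integrable.ofReal h.1, Integrable.ofReal h.2⟩

theorem re (hf : AbsolutelyContinuousOnInterval f c d) :
    AbsolutelyContinuousOnInterval (fun x => (f x).re) c d :=
  of_dist_le hf fun x y => by
    rw [Real.dist_eq, ← Complex.sub_re, dist_eq_norm]; exact Complex.abs_re_le_norm _

theorem im (hf : AbsolutelyContinuousOnInterval f c d) :
    AbsolutelyContinuousOnInterval (fun x => (f x).im) c d :=
  of_dist_le hf fun x y => by
    rw [Real.dist_eq, ← Complex.sub_im, dist_eq_norm]; exact Complex.abs_im_le_norm _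

theorem ofReal {f : ℝ → ℝ} (hf : AbsolutelyContinuousOnInterval f c d) :
    AbsolutelyContinuousOnInterval (fun x => (f x : ℂ)) c d :=
  of_dist_le hf fun x y => by rw [Complex.dist_eq, ← Complex.ofReal_sub, Complex.norm_real]; rfl

theorem star (hf : AbsolutelyContinuousOnInterval f c d) :
    AbsolutelyContinuousOnInterval (fun x => (starRingEnd ℂ) (f x)) c d :=
  of_dist_le hf fun x y => by rw [Complex.dist_conj_conj]

theorem mul (hf : AbsolutelyContinuousOnInterval f c d)
    (hg : AbsolutelyContinuousOnInterval g c d) :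
    AbsolutelyContinuousOnInterval (fun x => f x * g x) c d :=
  hf.fun_smul hg

theorem const_mul (z : ℂ) (hf : AbsolutelyContinuousOnInterval f c d) :
    AbsolutelyContinuousOnInterval (fun x => z * f x) c d :=
  hf.const_smul z

theorem hasDerivAt_re_im {f' : ℂ} {x : ℝ} (h1 : HasDerivAt (fun x => (f x).re) f'.re x)
    (h2 : HasDerivAt (fun x => (f x).im) f'.im x) : HasDerivAt f f' x := by
  have := (h1.ofReal_comp).add ((h2.ofReal_comp).mul_const Complex.I)
  convert! this using 1
  · ext y; simp [Complex.re_add_im]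
  · simp [Complex.re_add_im]

theorem hasDerivAt_re {f' : ℂ} {x : ℝ} (h : HasDerivAt f f' x) :
    HasDerivAt (fun x => (f x).re) f'.re x :=
  (Complex.reCLM.hasFDerivAt.comp_hasDerivAt x h)

theorem hasDerivAt_im {f' : ℂ} {x : ℝ} (h : HasDerivAt f f' x) :
    HasDerivAt (fun x => (f x).im) f'.im x :=
  (Complex.imCLM.hasFDerivAt.comp_hasDerivAt x h)

theorem ae_differentiableAt (hf : AbsolutelyContinuousOnInterval f c d) :
    ∀ᵐ x, x ∈ uIcc c d → DifferentiableAt ℝ f x := by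
  filter_upwards [(re hf).ae_differentiableAt, (im hf).ae_differentiableAt] with x h1 h2 hx
  exact (hasDerivAt_re_im (f' := ⟨_, _⟩) (h1 hx).hasDerivAt (h2 hx).hasDerivAt).differentiableAt

theorem ae_deriv_eq (hf : AbsolutelyContinuousOnInterval f c d) :
    ∀ᵐ x, x ∈ uIcc c d → deriv f x =
      ((deriv (fun x => (f x).re) x : ℝ) : ℂ) + ((deriv (fun x => (f x).im) x : ℝ) : ℂ) * Complex.I := by
  filter_upwards [ae_differentiableAt hf] with x h hx
  rw [(hasDerivAt_re (h hx).hasDerivAt).deriv, (hasDerivAt_im (h hx).hasDerivAt).deriv,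
    Complex.re_add_im]

theorem intervalIntegrable_deriv (hf : AbsolutelyContinuousOnInterval f c d) :
    IntervalIntegrable (deriv f) volume c d := by
  have h1 : IntervalIntegrable (fun x => ((deriv (fun x => (f x).re) x : ℝ) : ℂ)
      + ((deriv (fun x => (f x).im) x : ℝ) : ℂ) * Complex.I) volume c d :=
    ((re hf).intervalIntegrable_deriv.complex_ofReal).add
      ((im hf).intervalIntegrable_deriv.complex_ofReal.mul_const _)
  refine h1.congr_ae ?_
  rw [EventuallyEq, ae_restrict_iff' measurableSet_uIoc]
  filter_upwards [ae_deriv_eq hf] with x hx hx'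
  exact (hx (uIoc_subset_uIcc hx')).symm

theorem integral_deriv_eq_sub (hf : AbsolutelyContinuousOnInterval f c d) :
    ∫ x in c..d, deriv f x = f d - f c := by
  have h : ∫ x in c..d, deriv f x = ∫ x in c..d, (((deriv (fun x => (f x).re) x : ℝ) : ℂ)
      + ((deriv (fun x => (f x).im) x : ℝ) : ℂ) * Complex.I) := by
    apply intervalIntegral.integral_congr_ae
    filter_upwards [ae_deriv_eq hf] with x hx hx'
    exact hx (uIoc_subset_uIcc hx')
  rw [h, intervalIntegral.integral_add ((re hf).intervalIntegrable_deriv.complex_ofReal)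
      ((im hf).intervalIntegrable_deriv.complex_ofReal.mul_const _), intervalIntegral.integral_mul_const,
    intervalIntegral.integral_ofReal, intervalIntegral.integral_ofReal,
    (re hf).integral_deriv_eq_sub, (im hf).integral_deriv_eq_sub]
  apply Complex.ext <;> simp

theorem of_integral {c d e : ℝ} (h : IntervalIntegrable f volume c d) (he : e ∈ uIcc c d) :
    AbsolutelyContinuousOnInterval (fun x => ∫ v in e..x, f v) c d := by
  have h1 : IntervalIntegrable (fun x => (f x).re) volume c d :=
    ⟨h.1.re, h.2.re⟩
  have h2 : IntervalIntegrable (fun x => (f x).im) volume c d :=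
    ⟨h.1.im, h.2.im⟩
  have key := (ofReal (h1.absolutelyContinuousOnInterval_intervalIntegral he)).fun_add
    (const_mul Complex.I (ofReal (h2.absolutelyContinuousOnInterval_intervalIntegral he)))
  have hx : ∀ x ∈ uIcc c d, (∫ v in e..x, f v) =
      ((∫ v in e..x, (f v).re : ℝ) : ℂ) + Complex.I * ((∫ v in e..x, (f v).im : ℝ) : ℂ) := by
    intro x hx
    have hs := uIcc_subset_uIcc he hx
    rw [← intervalIntegral.integral_ofReal, ← intervalIntegral.integral_ofReal,
      ← intervalIntegral.integral_const_mul,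
      ← intervalIntegral.integral_add ((h1.mono_set hs).complex_ofReal)
        ((h2.mono_set hs).complex_ofReal.const_mul _)]
    refine intervalIntegral.integral_congr fun v _ => ?_
    rw [mul_comm, Complex.re_add_im]
  -- The splitting into real and imaginary primitives is known only on `uIcc c d`, where the
  -- integrals exist, so it is transferred through the ε-δ form, which looks at no other points.
  rw [absolutelyContinuousOnInterval_iff] at key ⊢
  intro ε hε
  obtain ⟨δ, hδ, H⟩ := key ε hε
  refine ⟨δ, hδ, fun E hE hE' => ?_⟩
  convert! H E hE hE' using 1
  refine Finset.sum_congr rfl fun i hi => ?_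
  rw [hx _ (hE.1 i hi).1, hx _ (hE.1 i hi).2]

theorem integral_deriv_mul_add (hf : AbsolutelyContinuousOnInterval f c d)
    (hg : AbsolutelyContinuousOnInterval g c d) :
    ∫ x in c..d, (deriv f x * g x + f x * deriv g x) = f d * g d - f c * g c := by
  rw [← integral_deriv_eq_sub (mul hf hg)]
  apply intervalIntegral.integral_congr_ae
  filter_upwards [ae_differentiableAt hf, ae_differentiableAt hg] with x h1 h2 hx
  exact (((h1 (uIoc_subset_uIcc hx)).hasDerivAt.mul (h2 (uIoc_subset_uIcc hx)).hasDerivAt).deriv).symm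

theorem integral_mul_deriv (hf : AbsolutelyContinuousOnInterval f c d)
    (hg : AbsolutelyContinuousOnInterval g c d) :
    ∫ x in c..d, f x * deriv g x = f d * g d - f c * g c - ∫ x in c..d, deriv f x * g x := by
  rw [← integral_deriv_mul_add hf hg, ← intervalIntegral.integral_sub]
  · exact intervalIntegral.integral_congr fun x _ => by ring
  · exact ((intervalIntegrable_deriv hf).mul_continuousOn hg.continuousOn).add
      ((intervalIntegrable_deriv hg).continuousOn_mul hf.continuousOn)
  · exact (intervalIntegrable_deriv hf).mul_continuousOn hg.continuousOn

end AC

end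

section

/-! ### Integrals over the unit interval and symmetry of the dislocated Laplacian -/

theorem integral_unitMeasure (f : ℝ → ℂ) : ∫ x, f x ∂unitMeasure = ∫ x in (0 : ℝ)..1, f x := by
  rw [intervalIntegral.integral_of_le zero_le_one, ← integral_Ioc_eq_integral_Ioo]

theorem ae_unitMeasure {P : ℝ → Prop} :
    (∀ᵐ x ∂unitMeasure, P x) ↔ ∀ᵐ x, x ∈ Ioo (0 : ℝ) 1 → P x :=
  ae_restrict_iff' measurableSet_Ioo

theorem ae_ne (c : ℝ) : ∀ᵐ x : ℝ, x ≠ c := by simp [ae_iff, measure_singleton]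

theorem integral_congr_unitMeasure {f g : ℝ → ℂ} (h : ∀ᵐ x ∂unitMeasure, f x = g x) :
    ∫ x in (0 : ℝ)..1, f x = ∫ x in (0 : ℝ)..1, g x := by
  rw [← integral_unitMeasure, ← integral_unitMeasure]
  exact integral_congr_ae h

/-- Two integrations by parts. Both middle integrands are `sgn(x - b)` times `conj φ' ψ'`; there is
no interface term because the quasi-derivatives are absolutely continuous across `b`, and the
end-point terms vanish by the Dirichlet conditions. -/
theorem IsInDomain.symmetric {b : ℝ} {φ w ψ z : ℝ → ℂ} (h : IsInDomain b φ w)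
    (h' : IsInDomain b ψ z) :
    ∫ x, conj (φ x) * deriv z x ∂unitMeasure = ∫ x, conj (deriv w x) * ψ x ∂unitMeasure := by
  rw [integral_unitMeasure, integral_unitMeasure, AC.integral_mul_deriv (AC.star h.ac) h'.ac_quasi]
  have h2 := AC.integral_mul_deriv (AC.star h.ac_quasi) h'.ac
  have e : ∫ x in (0 : ℝ)..1, deriv (fun x => conj (φ x)) x * z x
      = ∫ x in (0 : ℝ)..1, conj (w x) * deriv ψ x := by
    apply integral_congr_unitMeasure
    filter_upwards [h.quasi_eq, h'.quasi_eq] with x h1 h2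
    have : deriv (fun x => conj (φ x)) x = conj (deriv φ x) := deriv.star
    rw [this, h1, h2, map_mul, Complex.conj_ofReal]
    ring
  have e2 : ∫ x in (0 : ℝ)..1, deriv (fun x => conj (w x)) x * ψ x
      = ∫ x in (0 : ℝ)..1, conj (deriv w x) * ψ x :=
    intervalIntegral.integral_congr fun x _ => by
      have : deriv (fun x => conj (w x)) x = conj (deriv w x) := deriv.star
      simp only [this]
  rw [e, h2, e2]
  simp [h.left, h.right, h'.left, h'.right]

/-! ### Gluing at the interface -/

/-- The function equal to `f` up to `b` and to `g` beyond. -/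
noncomputable def glue (b : ℝ) (f g : ℝ → ℝ) (x : ℝ) : ℝ := if x ≤ b then f x else g x

theorem glue_of_le {b x : ℝ} (f g : ℝ → ℝ) (h : x ≤ b) : glue b f g x = f x := if_pos h

theorem glue_of_lt {b x : ℝ} (f g : ℝ → ℝ) (h : b < x) : glue b f g x = g x := if_neg h.not_ge

theorem glue_of_ge {b x : ℝ} {f g : ℝ → ℝ} (hb : f b = g b) (h : b ≤ x) : glue b f g x = g x := by
  rcases h.eq_or_lt with rfl | h
  · rw [glue_of_le _ _ le_rfl, hb]
  · exact glue_of_lt f g h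

theorem glue_continuous {b : ℝ} {f g : ℝ → ℝ} (hf : Continuous f) (hg : Continuous g)
    (h : f b = g b) : Continuous (glue b f g) :=
  Continuous.if_le hf hg continuous_id continuous_const (by rintro x rfl; exact h)

theorem glue_hasDerivAt_lt {b x f' : ℝ} {f g : ℝ → ℝ} (hx : x < b) (hf : HasDerivAt f f' x) :
    HasDerivAt (glue b f g) f' x :=
  hf.congr_of_eventuallyEq <| by
    filter_upwards [Iio_mem_nhds hx] with y hy using glue_of_le f g (le_of_lt hy)

theorem glue_hasDerivAt_gt {b x g' : ℝ} {f g : ℝ → ℝ} (hx : b < x) (hg : HasDerivAt g g' x) :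
    HasDerivAt (glue b f g) g' x :=
  hg.congr_of_eventuallyEq <| by
    filter_upwards [Ioi_mem_nhds hx] with y hy using glue_of_lt f g hy

/-- `(φ, ω)` solves `sgn(x - b) φ' = ω`, `ω' = l φ` away from the interface, and both are
continuous. -/
structure QuasiSol (b l : ℝ) (φ ω : ℝ → ℝ) : Prop where
  cont : Continuous φ
  cont_quasi : Continuous ω
  deriv_fun : ∀ x, x ≠ b → HasDerivAt φ ((SignType.sign (x - b) : ℝ) * ω x) x
  deriv_quasi : ∀ x, x ≠ b → HasDerivAt ω (l * φ x) x

/-- The minus sign on the left piece is the value of `sgn(x - b)` there; matching both components at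
`b` is all that the interface demands. -/
theorem QuasiSol.of_glue {b l : ℝ} {f₁ f₂ g₁ g₂ : ℝ → ℝ}
    (hf₁ : ∀ x, HasDerivAt f₁ (-g₁ x) x) (hg₁ : ∀ x, HasDerivAt g₁ (l * f₁ x) x)
    (hf₂ : ∀ x, HasDerivAt f₂ (g₂ x) x) (hg₂ : ∀ x, HasDerivAt g₂ (l * f₂ x) x)
    (hf : f₁ b = f₂ b) (hg : g₁ b = g₂ b) : QuasiSol b l (glue b f₁ f₂) (glue b g₁ g₂) where
  cont := glue_continuous (continuous_iff_continuousAt.2 fun x => (hf₁ x).continuousAt)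
    (continuous_iff_continuousAt.2 fun x => (hf₂ x).continuousAt) hf
  cont_quasi := glue_continuous (continuous_iff_continuousAt.2 fun x => (hg₁ x).continuousAt)
    (continuous_iff_continuousAt.2 fun x => (hg₂ x).continuousAt) hg
  deriv_fun x hx := by
    rcases lt_or_gt_of_ne hx with h | h
    · rw [sign_neg (sub_neg.2 h), glue_of_le _ _ h.le]
      simpa using glue_hasDerivAt_lt h (hf₁ x)
    · rw [sign_pos (sub_pos.2 h), glue_of_lt _ _ h]
      simpa using glue_hasDerivAt_gt h (hf₂ x)
  deriv_quasi x hx := by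
    rcases lt_or_gt_of_ne hx with h | h
    · rw [glue_of_le _ _ h.le]
      exact glue_hasDerivAt_lt h (hg₁ x)
    · rw [glue_of_lt _ _ h]
      exact glue_hasDerivAt_gt h (hg₂ x)

/-- The fundamental theorem of calculus tolerates one exceptional point of a continuous function, so
`f` has the increments of `∫ f'`. The continuous majorant `g` supplies integrability, since `f'` may
jump at `b`. -/
theorem AC.of_hasDerivAt_off {f f' g : ℝ → ℝ} {b c d : ℝ} (hf : Continuous f)
    (hd : ∀ x, x ≠ b → HasDerivAt f (f' x) x) (hg : Continuous g) (hi : ∀ x, |f' x| ≤ |g x|) :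
    AbsolutelyContinuousOnInterval f c d := by
  have hint : ∀ x y, IntervalIntegrable f' volume x y := fun x y => by
    refine (hg.intervalIntegrable x y).mono_fun ?_ (Eventually.of_forall hi)
    refine ((measurable_deriv f).aestronglyMeasurable).congr (ae_restrict_of_ae ?_)
    filter_upwards [ae_ne b] with x hx using (hd x hx).deriv
  have key : ∀ x y, f y - f x = (∫ t in c..y, f' t) - ∫ t in c..x, f' t := fun x y => by
    rw [intervalIntegral.integral_interval_sub_left (hint _ _) (hint _ _)]
    refine (integral_eq_of_hasDerivAt_off_countable f f'
      (s := {b}) (countable_singleton b) hf.continuousOn (fun t ht => hd t ht.2) (hint _ _)).symm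
  refine AC.of_dist_le
    ((hint c d).absolutelyContinuousOnInterval_intervalIntegral (c := c) left_mem_uIcc) ?_
  intro x y
  rw [dist_comm, Real.dist_eq, key, dist_comm, Real.dist_eq]

namespace QuasiSol

variable {b l : ℝ} {φ ω : ℝ → ℝ}

theorem ac (h : QuasiSol b l φ ω) (c d : ℝ) : AbsolutelyContinuousOnInterval φ c d :=
  AC.of_hasDerivAt_off h.cont h.deriv_fun h.cont_quasi fun x => by
    rw [abs_mul]
    refine mul_le_of_le_one_left (abs_nonneg _) ?_
    rcases SignType.sign (x - b) with _ | _ | _ <;> simp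

theorem ac_quasi (h : QuasiSol b l φ ω) (c d : ℝ) : AbsolutelyContinuousOnInterval ω c d :=
  AC.of_hasDerivAt_off h.cont_quasi h.deriv_quasi (continuous_const.mul h.cont) fun _ => le_rfl

theorem sign_mul_sign_mul {x : ℝ} (hx : x ≠ b) (z : ℂ) :
    ((SignType.sign (x - b) : ℝ) : ℂ) * (((SignType.sign (x - b) : ℝ) : ℂ) * z) = z := by
  rcases lt_or_gt_of_ne hx with h | h
  · simp [sign_neg (sub_neg.2 h)]
  · simp [sign_pos (sub_pos.2 h)]

theorem quasi_eq (h : QuasiSol b l φ ω) {x : ℝ} (hx : x ≠ b) :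
    (ω x : ℂ) = (SignType.sign (x - b) : ℝ) * deriv (fun x => (φ x : ℂ)) x := by
  have h1 := (h.deriv_fun x hx).ofReal_comp.deriv
  rw [h1]
  push_cast
  exact (sign_mul_sign_mul hx _).symm

theorem deriv_quasi_ofReal (h : QuasiSol b l φ ω) {x : ℝ} (hx : x ≠ b) :
    deriv (fun x => (ω x : ℂ)) x = l * φ x := by
  rw [(h.deriv_quasi x hx).ofReal_comp.deriv]
  push_cast; rfl

theorem isInDomain (h : QuasiSol b l φ ω) (h0 : φ 0 = 0) (h1 : φ 1 = 0) :
    IsInDomain b (fun x => (φ x : ℂ)) (fun x => (ω x : ℂ)) where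
  ac := AC.ofReal (h.ac 0 1)
  ac_quasi := AC.ofReal (h.ac_quasi 0 1)
  quasi_eq := ae_restrict_of_ae (by filter_upwards [ae_ne b] with x hx using h.quasi_eq hx)
  left := by simp [h0]
  right := by simp [h1]
  memLp := by
    have hc : Continuous fun x => (l : ℂ) * (φ x : ℂ) :=
      continuous_const.mul (Complex.continuous_ofReal.comp h.cont)
    obtain ⟨M, hM⟩ := isCompact_Icc (a := (0 : ℝ)) (b := 1) |>.exists_bound_of_continuousOn
      hc.continuousOn
    have : MemLp (fun x => (l : ℂ) * (φ x : ℂ)) 2 unitMeasure :=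
      MemLp.of_bound hc.aestronglyMeasurable M (by
        rw [ae_unitMeasure]
        exact Eventually.of_forall fun x hx => hM x (Ioo_subset_Icc_self hx))
    refine this.ae_eq (ae_restrict_of_ae ?_)
    filter_upwards [ae_ne b] with x hx using (h.deriv_quasi_ofReal hx).symm

end QuasiSol

/-! ### The fundamental system of `y'' = -l y` -/

/-- The solution of `y'' = -l y`, `y(0) = 0`, `y'(0) = 1`. -/
noncomputable def sinGen (l x : ℝ) : ℝ :=
  if 0 < l then Real.sin (√l * x) / √l else if l < 0 then Real.sinh (√(-l) * x) / √(-l) else x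

/-- The solution of `y'' = -l y`, `y(0) = 1`, `y'(0) = 0`. -/
noncomputable def cosGen (l x : ℝ) : ℝ :=
  if 0 < l then Real.cos (√l * x) else if l < 0 then Real.cosh (√(-l) * x) else 1

theorem sinGen_pos {l : ℝ} (h : 0 < l) (x : ℝ) : sinGen l x = Real.sin (√l * x) / √l := if_pos h

theorem cosGen_pos {l : ℝ} (h : 0 < l) (x : ℝ) : cosGen l x = Real.cos (√l * x) := if_pos h

theorem sinGen_neg {l : ℝ} (h : l < 0) (x : ℝ) : sinGen l x = Real.sinh (√(-l) * x) / √(-l) := by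
  rw [sinGen, if_neg h.not_gt, if_pos h]

theorem cosGen_neg {l : ℝ} (h : l < 0) (x : ℝ) : cosGen l x = Real.cosh (√(-l) * x) := by
  rw [cosGen, if_neg h.not_gt, if_pos h]

theorem sinGen_zero_left (x : ℝ) : sinGen 0 x = x := by simp [sinGen]

theorem cosGen_zero_left (x : ℝ) : cosGen 0 x = 1 := by simp [cosGen]

theorem sinGen_zero (l : ℝ) : sinGen l 0 = 0 := by unfold sinGen; split_ifs <;> simp

theorem cosGen_zero (l : ℝ) : cosGen l 0 = 1 := by unfold cosGen; split_ifs <;> simp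

theorem hasDerivAt_sinGen (l x : ℝ) : HasDerivAt (sinGen l) (cosGen l x) x := by
  rcases lt_trichotomy l 0 with h | rfl | h
  · have hs : √(-l) ≠ 0 := (Real.sqrt_pos.2 (neg_pos.2 h)).ne'
    have := (((hasDerivAt_id x).const_mul √(-l)).sinh).div_const √(-l)
    rw [funext (sinGen_neg h), cosGen_neg h]
    convert! this using 1
    simp only [id]; field_simp
  · rw [funext sinGen_zero_left, cosGen_zero_left]; exact hasDerivAt_id x
  · have hs : √l ≠ 0 := (Real.sqrt_pos.2 h).ne'
    have := (((hasDerivAt_id x).const_mul √l).sin).div_const √l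
    rw [funext (sinGen_pos h), cosGen_pos h]
    convert! this using 1
    simp only [id]; field_simp

theorem hasDerivAt_cosGen (l x : ℝ) : HasDerivAt (cosGen l) (-l * sinGen l x) x := by
  rcases lt_trichotomy l 0 with h | rfl | h
  · have hs : √(-l) ≠ 0 := (Real.sqrt_pos.2 (neg_pos.2 h)).ne'
    have := (((hasDerivAt_id x).const_mul √(-l)).cosh)
    rw [funext (cosGen_neg h), sinGen_neg h]
    convert! this using 1
    simp only [id]; field_simp
    rw [Real.sq_sqrt (neg_pos.2 h).le]; ring
  · rw [funext cosGen_zero_left]; simpa using hasDerivAt_const x (1 : ℝ)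
  · have hs : √l ≠ 0 := (Real.sqrt_pos.2 h).ne'
    have := (((hasDerivAt_id x).const_mul √l).cos)
    rw [funext (cosGen_pos h), sinGen_pos h]
    convert! this using 1
    simp only [id]; field_simp
    rw [Real.sq_sqrt h.le]

/-- This is the Wronskian of the fundamental system; it is the identity used to solve for the
unknowns in `left_solution` and `right_solution`. -/
theorem cosGen_sq_add (l x : ℝ) : cosGen l x ^ 2 + l * sinGen l x ^ 2 = 1 := by
  rcases lt_trichotomy l 0 with h | rfl | h
  · rw [cosGen_neg h, sinGen_neg h, div_pow, Real.sq_sqrt (neg_pos.2 h).le, Real.cosh_sq]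
    field_simp [h.ne]; ring
  · simp [cosGen_zero_left]
  · rw [cosGen_pos h, sinGen_pos h, div_pow, Real.sq_sqrt h.le, mul_div_cancel₀ _ h.ne',
      Real.cos_sq_add_sin_sq]

theorem sinGen_pos_of_nonpos {l x : ℝ} (hl : l ≤ 0) (hx : 0 < x) : 0 < sinGen l x := by
  rcases hl.eq_or_lt with rfl | h
  · rwa [sinGen_zero_left]
  · have hs : 0 < √(-l) := Real.sqrt_pos.2 (neg_pos.2 h)
    rw [sinGen_neg h]
    exact div_pos (Real.sinh_pos_iff.2 (mul_pos hs hx)) hs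

theorem continuous_sinGen (l : ℝ) : Continuous (sinGen l) :=
  continuous_iff_continuousAt.2 fun x => (hasDerivAt_sinGen l x).continuousAt

/-! ### Eigenfunctions -/

/-- The solution of the eigenvalue equation that vanishes at `0` and `1`; it is an eigenfunction
when `IsEigen b l` holds. -/
noncomputable def eigfun (b l : ℝ) : ℝ → ℝ :=
  glue b (fun x => sinGen (-l) (1 - b) * sinGen l x) (fun x => sinGen l b * sinGen (-l) (1 - x))

/-- The quasi-derivative of `eigfun`. -/
noncomputable def eigquasi (b l : ℝ) : ℝ → ℝ :=
  glue b (fun x => -(sinGen (-l) (1 - b) * cosGen l x))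
    (fun x => -(sinGen l b * cosGen (-l) (1 - x)))

/-- The characteristic equation. -/
def IsEigen (b l : ℝ) : Prop := sinGen (-l) (1 - b) * cosGen l b = sinGen l b * cosGen (-l) (1 - b)

theorem hasDerivAt_sinGen_one_sub (l x : ℝ) :
    HasDerivAt (fun x => sinGen l (1 - x)) (-cosGen l (1 - x)) x := by
  simpa [Function.comp_def] using (hasDerivAt_sinGen l (1 - x)).comp x ((hasDerivAt_id x).const_sub 1)

theorem hasDerivAt_cosGen_one_sub (l x : ℝ) :
    HasDerivAt (fun x => cosGen l (1 - x)) (l * sinGen l (1 - x)) x := by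
  simpa [Function.comp_def] using (hasDerivAt_cosGen l (1 - x)).comp x ((hasDerivAt_id x).const_sub 1)

/-- `eigfun` matches at `b` by construction, so the characteristic equation is precisely the
matching of the quasi-derivatives. -/
theorem IsEigen.quasiSol {b l : ℝ} (h : IsEigen b l) : QuasiSol b l (eigfun b l) (eigquasi b l) := by
  refine QuasiSol.of_glue ?_ ?_ ?_ ?_ ?_ ?_
  · intro x; simpa using (hasDerivAt_sinGen l x).const_mul (sinGen (-l) (1 - b))
  · intro x
    convert! ((hasDerivAt_cosGen l x).const_mul (sinGen (-l) (1 - b))).neg using 1; ring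
  · intro x; simpa using (hasDerivAt_sinGen_one_sub (-l) x).const_mul (sinGen l b)
  · intro x
    convert! ((hasDerivAt_cosGen_one_sub (-l) x).const_mul (sinGen l b)).neg using 1; ring
  · ring
  · rw [h]

theorem eigfun_zero {b : ℝ} (l : ℝ) (hb : b ∈ Ioo (0 : ℝ) 1) : eigfun b l 0 = 0 := by
  rw [eigfun, glue_of_le _ _ hb.1.le, sinGen_zero, mul_zero]

theorem eigfun_one {b : ℝ} (l : ℝ) (hb : b ∈ Ioo (0 : ℝ) 1) : eigfun b l 1 = 0 := by
  rw [eigfun, glue_of_lt _ _ hb.2, sub_self, sinGen_zero, mul_zero]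

/-- For `l ≤ 0` the left solution has no zero to the right of `0`. For `l > 0` the right one has
none, so a zero of the sine would force, through the characteristic equation, a zero of the cosine,
against `cosGen_sq_add`. -/
theorem IsEigen.left_ne_zero {b l : ℝ} (h : IsEigen b l) (hb : b ∈ Ioo (0 : ℝ) 1) :
    sinGen l b ≠ 0 := by
  intro h0
  rcases le_or_gt l 0 with hl | hl
  · exact (sinGen_pos_of_nonpos hl hb.1).ne' h0
  · have h1 := sinGen_pos_of_nonpos (neg_nonpos.2 hl.le) (sub_pos.2 hb.2)
    have h2 : cosGen l b = 0 := by
      have := h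
      rw [IsEigen, h0, zero_mul] at this
      exact (mul_eq_zero.1 this).resolve_left h1.ne'
    simpa [h0, h2] using cosGen_sq_add l b

/-- The reflection `x ↦ 1 - x` exchanges `l` and `-l`, reducing this to the left end. -/
theorem IsEigen.right_ne_zero {b l : ℝ} (h : IsEigen b l) (hb : b ∈ Ioo (0 : ℝ) 1) :
    sinGen (-l) (1 - b) ≠ 0 := by
  have h' : IsEigen (1 - b) (-l) := by
    unfold IsEigen at *; rw [neg_neg, sub_sub_cancel, ← h]
  exact h'.left_ne_zero ⟨by linarith [hb.2], by linarith [hb.1]⟩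

theorem IsEigen.eigfun_ne_zero {b l : ℝ} (h : IsEigen b l) (hb : b ∈ Ioo (0 : ℝ) 1) :
    eigfun b l b ≠ 0 := by
  rw [eigfun, glue_of_le _ _ le_rfl]
  exact mul_ne_zero (h.right_ne_zero hb) (h.left_ne_zero hb)

theorem IsEigen.isInDomain {b l : ℝ} (h : IsEigen b l) (hb : b ∈ Ioo (0 : ℝ) 1) :
    IsInDomain b (fun x => (eigfun b l x : ℂ)) (fun x => (eigquasi b l x : ℂ)) :=
  h.quasiSol.isInDomain (eigfun_zero l hb) (eigfun_one l hb)

/-- A function whose derivative vanishes almost everywhere is constant, if it is absolutely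
continuous. -/
theorem AC.eq_of_ae_deriv_zero {f : ℝ → ℂ} {c d : ℝ} (hcd : c ≤ d)
    (hf : AbsolutelyContinuousOnInterval f c d)
    (h : ∀ᵐ x, x ∈ Ioo c d → HasDerivAt f 0 x) {x y : ℝ} (hx : x ∈ Icc c d) (hy : y ∈ Icc c d) :
    f x = f y := by
  obtain ⟨C, hC⟩ := hf.const_of_ae_hasDerivAt_zero (by
    filter_upwards [h, ae_ne c, ae_ne d] with x hx h1 h2 hx'
    rw [uIcc_of_le hcd] at hx'
    exact hx ⟨lt_of_le_of_ne hx'.1 h1.symm, lt_of_le_of_ne hx'.2 h2⟩)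
  rw [uIcc_of_le hcd] at hC
  rw [hC x hx, hC y hy]

theorem AC.of_hasDerivAt {f f' : ℝ → ℝ} {c d : ℝ} (hd : ∀ x, HasDerivAt f (f' x) x)
    (hf' : Continuous f') : AbsolutelyContinuousOnInterval (fun x => (f x : ℂ)) c d :=
  AC.ofReal <| AC.of_hasDerivAt_off (b := 0)
    (continuous_iff_continuousAt.2 fun x => (hd x).continuousAt) (fun x _ => hd x) hf' fun _ => le_rfl

theorem continuous_cosGen (l : ℝ) : Continuous (cosGen l) :=
  continuous_iff_continuousAt.2 fun x => (hasDerivAt_cosGen l x).continuousAt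

theorem cosGen_sq_add_ofReal (l x : ℝ) :
    (cosGen l x : ℂ) ^ 2 + (l : ℂ) * (sinGen l x : ℂ) ^ 2 = 1 := by
  exact_mod_cast cosGen_sq_add l x

/-- Solutions of the first order system `φ' = -w`, `w' = l φ` with `φ(0) = 0`. -/
theorem left_solution {φ w : ℝ → ℂ} {b l : ℝ} (hb : 0 ≤ b)
    (hφ : AbsolutelyContinuousOnInterval φ 0 b) (hw : AbsolutelyContinuousOnInterval w 0 b)
    (h1 : ∀ᵐ x, x ∈ Ioo 0 b → HasDerivAt φ (-w x) x)
    (h2 : ∀ᵐ x, x ∈ Ioo 0 b → HasDerivAt w (l * φ x) x) (h0 : φ 0 = 0) :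
    ∃ α : ℂ, ∀ x ∈ Icc 0 b, φ x = α * sinGen l x ∧ w x = -(α * cosGen l x) := by
  have hS : AbsolutelyContinuousOnInterval (fun x => (sinGen l x : ℂ)) 0 b :=
    AC.of_hasDerivAt (hasDerivAt_sinGen l) (continuous_cosGen l)
  have hC : AbsolutelyContinuousOnInterval (fun x => (cosGen l x : ℂ)) 0 b :=
    AC.of_hasDerivAt (hasDerivAt_cosGen l) (continuous_const.mul (continuous_sinGen l))
  have hS' := fun x => (hasDerivAt_sinGen l x).ofReal_comp
  have hC' := fun x => (hasDerivAt_cosGen l x).ofReal_comp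
  -- `W1` and `W2` are the Wronskians of `(φ, w)` with the two fundamental solutions. They are
  -- constant, and `φ` and `w` are recovered from them by linear algebra.
  have W1 : ∀ x ∈ Icc 0 b, φ x * cosGen l x + w x * sinGen l x = 0 := fun x hx => by
    rw [AC.eq_of_ae_deriv_zero (f := fun x => φ x * cosGen l x + w x * sinGen l x) hb
      ((AC.mul hφ hC).fun_add (AC.mul hw hS)) ?_ hx (left_mem_Icc.2 hb)]
    · simp [h0, sinGen_zero]
    · filter_upwards [h1, h2] with x h1 h2 hx
      convert! ((h1 hx).mul (hC' x)).add ((h2 hx).mul (hS' x)) using 1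
      push_cast; ring
  have W2 : ∀ x ∈ Icc 0 b, l * (φ x * sinGen l x) - w x * cosGen l x = -w 0 := fun x hx => by
    rw [AC.eq_of_ae_deriv_zero (f := fun x => l * (φ x * sinGen l x) - w x * cosGen l x) hb
      ((AC.const_mul _ (AC.mul hφ hS)).fun_sub (AC.mul hw hC)) ?_ hx (left_mem_Icc.2 hb)]
    · simp [h0, cosGen_zero]
    · filter_upwards [h1, h2] with x h1 h2 hx
      convert! (((h1 hx).mul (hS' x)).const_mul (l : ℂ)).sub ((h2 hx).mul (hC' x)) using 1
      push_cast; ring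
  refine ⟨-w 0, fun x hx => ?_⟩
  rw [← W2 x hx]
  have e1 := W1 x hx
  have e2 := cosGen_sq_add_ofReal l x
  constructor
  · linear_combination (φ x) * (-e2) + cosGen l x * e1
  · linear_combination (w x) * (-e2) + l * sinGen l x * e1

/-- Solutions of the first order system `φ' = w`, `w' = l φ` with `φ(1) = 0`. -/
theorem right_solution {φ w : ℝ → ℂ} {b l : ℝ} (hb : b ≤ 1)
    (hφ : AbsolutelyContinuousOnInterval φ b 1) (hw : AbsolutelyContinuousOnInterval w b 1)
    (h1 : ∀ᵐ x, x ∈ Ioo b 1 → HasDerivAt φ (w x) x)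
    (h2 : ∀ᵐ x, x ∈ Ioo b 1 → HasDerivAt w (l * φ x) x) (h0 : φ 1 = 0) :
    ∃ β : ℂ, ∀ x ∈ Icc b 1, φ x = β * sinGen (-l) (1 - x) ∧ w x = -(β * cosGen (-l) (1 - x)) := by
  have hS : AbsolutelyContinuousOnInterval (fun x => (sinGen (-l) (1 - x) : ℂ)) b 1 :=
    AC.of_hasDerivAt (hasDerivAt_sinGen_one_sub (-l))
      (((continuous_cosGen (-l)).comp (continuous_const.sub continuous_id)).neg)
  have hC : AbsolutelyContinuousOnInterval (fun x => (cosGen (-l) (1 - x) : ℂ)) b 1 :=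
    AC.of_hasDerivAt (hasDerivAt_cosGen_one_sub (-l))
      (continuous_const.mul ((continuous_sinGen (-l)).comp (continuous_const.sub continuous_id)))
  have hS' := fun x => (hasDerivAt_sinGen_one_sub (-l) x).ofReal_comp
  have hC' := fun x => (hasDerivAt_cosGen_one_sub (-l) x).ofReal_comp
  have W1 : ∀ x ∈ Icc b 1, φ x * cosGen (-l) (1 - x) + w x * sinGen (-l) (1 - x) = 0 :=
    fun x hx => by
    rw [AC.eq_of_ae_deriv_zero
      (f := fun x => φ x * cosGen (-l) (1 - x) + w x * sinGen (-l) (1 - x)) hb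
      ((AC.mul hφ hC).fun_add (AC.mul hw hS)) ?_ hx (right_mem_Icc.2 hb)]
    · simp [h0, sinGen_zero]
    · filter_upwards [h1, h2] with x h1 h2 hx
      convert! ((h1 hx).mul (hC' x)).add ((h2 hx).mul (hS' x)) using 1
      push_cast; ring
  have W2 : ∀ x ∈ Icc b 1, l * (φ x * sinGen (-l) (1 - x)) + w x * cosGen (-l) (1 - x) = w 1 :=
    fun x hx => by
    rw [AC.eq_of_ae_deriv_zero
      (f := fun x => l * (φ x * sinGen (-l) (1 - x)) + w x * cosGen (-l) (1 - x)) hb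
      ((AC.const_mul _ (AC.mul hφ hS)).fun_add (AC.mul hw hC)) ?_ hx (right_mem_Icc.2 hb)]
    · simp [h0, cosGen_zero]
    · filter_upwards [h1, h2] with x h1 h2 hx
      convert! (((h1 hx).mul (hS' x)).const_mul (l : ℂ)).add ((h2 hx).mul (hC' x)) using 1
      push_cast; ring
  refine ⟨-w 1, fun x hx => ?_⟩
  rw [← W2 x hx]
  have e1 := W1 x hx
  have e2 := cosGen_sq_add_ofReal (-l) (1 - x)
  push_cast at e2
  constructor
  · linear_combination (φ x) * (-e2) + cosGen (-l) (1 - x) * e1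
  · linear_combination (w x) * (-e2) - l * sinGen (-l) (1 - x) * e1

/-- The eigenvalue equation forces a multiple of `eigfun`. -/
theorem IsInDomain.eq_eigfun {b l : ℝ} (hb : b ∈ Ioo (0 : ℝ) 1) {φ w : ℝ → ℂ}
    (h : IsInDomain b φ w) (hl : ∀ᵐ x ∂unitMeasure, deriv w x = l * φ x) :
    (∃ γ : ℂ, ∀ x ∈ Icc (0 : ℝ) 1, φ x = γ * eigfun b l x) ∧
      ((∃ x ∈ Icc (0 : ℝ) 1, φ x ≠ 0) → IsEigen b l) := by
  have hsub1 : uIcc 0 b ⊆ uIcc (0 : ℝ) 1 := by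
    rw [uIcc_of_le hb.1.le, uIcc_of_le zero_le_one]; exact Icc_subset_Icc_right hb.2.le
  have hsub2 : uIcc b 1 ⊆ uIcc (0 : ℝ) 1 := by
    rw [uIcc_of_le hb.2.le, uIcc_of_le zero_le_one]; exact Icc_subset_Icc_left hb.1.le
  have hI : ∀ {x : ℝ}, x ∈ Ioo (0 : ℝ) 1 → x ∈ uIcc (0 : ℝ) 1 := fun hx => by
    rw [uIcc_of_le zero_le_one]; exact Ioo_subset_Icc_self hx
  have hdφ : ∀ᵐ x, x ∈ Ioo (0 : ℝ) 1 → x ≠ b →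
      HasDerivAt φ ((SignType.sign (x - b) : ℝ) * w x) x := by
    filter_upwards [AC.ae_differentiableAt h.ac, ae_unitMeasure.1 h.quasi_eq] with x h1 h2 hx hxb
    convert! (h1 (hI hx)).hasDerivAt using 1
    rw [h2 hx, QuasiSol.sign_mul_sign_mul hxb]
  have hdw : ∀ᵐ x, x ∈ Ioo (0 : ℝ) 1 → HasDerivAt w (l * φ x) x := by
    filter_upwards [AC.ae_differentiableAt h.ac_quasi, ae_unitMeasure.1 hl] with x h1 h2 hx
    rw [← h2 hx]; exact (h1 (hI hx)).hasDerivAt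
  obtain ⟨α, hα⟩ := left_solution hb.1.le (h.ac.mono hsub1) (h.ac_quasi.mono hsub1)
    (by filter_upwards [hdφ] with x h1 hx
        simpa [sign_neg (sub_neg.2 hx.2)] using h1 ⟨hx.1, hx.2.trans hb.2⟩ hx.2.ne)
    (by filter_upwards [hdw] with x h1 hx using h1 ⟨hx.1, hx.2.trans hb.2⟩) h.left
  obtain ⟨β, hβ⟩ := right_solution hb.2.le (h.ac.mono hsub2) (h.ac_quasi.mono hsub2)
    (by filter_upwards [hdφ] with x h1 hx
        simpa [sign_pos (sub_pos.2 hx.1)] using h1 ⟨hb.1.trans hx.1, hx.2⟩ hx.1.ne')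
    (by filter_upwards [hdw] with x h1 hx using h1 ⟨hb.1.trans hx.1, hx.2⟩) h.right
  obtain ⟨a1, a2⟩ := hα b (right_mem_Icc.2 hb.1.le)
  obtain ⟨b1, b2⟩ := hβ b (left_mem_Icc.2 hb.2.le)
  have m1 : α * sinGen l b = β * sinGen (-l) (1 - b) := a1.symm.trans b1
  have m2 : α * cosGen l b = β * cosGen (-l) (1 - b) := neg_inj.1 (a2.symm.trans b2)
  constructor
  -- According to the sign of `l`, one of the two end-point solutions is nonzero at `b` and can be
  -- divided by.
  · obtain ⟨γ, g1, g2⟩ : ∃ γ : ℂ, α = γ * sinGen (-l) (1 - b) ∧ β = γ * sinGen l b := by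
      rcases le_or_gt l 0 with h0 | h0
      · have : (sinGen l b : ℂ) ≠ 0 := by exact_mod_cast (sinGen_pos_of_nonpos h0 hb.1).ne'
        refine ⟨β / sinGen l b, ?_, by field_simp⟩
        field_simp; exact m1
      · have : (sinGen (-l) (1 - b) : ℂ) ≠ 0 := by
          exact_mod_cast (sinGen_pos_of_nonpos (neg_nonpos.2 h0.le) (sub_pos.2 hb.2)).ne'
        refine ⟨α / sinGen (-l) (1 - b), by field_simp, ?_⟩
        field_simp; exact m1.symm
    refine ⟨γ, fun x hx => ?_⟩
    rcases le_or_gt x b with hxb | hxb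
    · rw [(hα x ⟨hx.1, hxb⟩).1, eigfun, glue_of_le _ _ hxb, g1]; push_cast; ring
    · rw [(hβ x ⟨hxb.le, hx.2⟩).1, eigfun, glue_of_lt _ _ hxb, g2]; push_cast; ring
  · rintro ⟨x, hx, hne⟩
    by_contra hE
    -- Matching at `b` is a homogeneous linear system for `α` and `β`, and this is its determinant.
    have hD : (sinGen (-l) (1 - b) : ℂ) * cosGen l b - sinGen l b * cosGen (-l) (1 - b) ≠ 0 :=
      sub_ne_zero.2 fun h => hE (by unfold IsEigen; exact_mod_cast h)
    have hα0 : α = 0 := by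
      refine (mul_eq_zero.1 (?_ : α * _ = 0)).resolve_right hD
      linear_combination (sinGen (-l) (1 - b) : ℂ) * m2 - (cosGen (-l) (1 - b) : ℂ) * m1
    have hβ0 : β = 0 := by
      refine (mul_eq_zero.1 (?_ : β * _ = 0)).resolve_right hD
      linear_combination (sinGen l b : ℂ) * m2 - (cosGen l b : ℂ) * m1
    rcases le_or_gt x b with hxb | hxb
    · exact hne (by rw [(hα x ⟨hx.1, hxb⟩).1, hα0, zero_mul])
    · exact hne (by rw [(hβ x ⟨hxb.le, hx.2⟩).1, hβ0, zero_mul])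

end

section

/-! ### The Hilbert space `L²(0,1)` -/

/-- The Hilbert space `L²(0,1)`. -/
noncomputable abbrev UnitL2 := Lp ℂ 2 unitMeasure

theorem inner_eq_integral (f g : UnitL2) :
    inner ℂ f g = ∫ x, conj ((f : ℝ → ℂ) x) * (g : ℝ → ℂ) x ∂unitMeasure := by
  rw [L2.inner_def]
  exact integral_congr_ae (Eventually.of_forall fun x => by
    simp only [RCLike.inner_apply]; ring)

theorem integrable_conj_mul {f g : ℝ → ℂ} (hf : MemLp f 2 unitMeasure)
    (hg : MemLp g 2 unitMeasure) : Integrable (fun x => conj (f x) * g x) unitMeasure :=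
  MemLp.integrable_mul (p := 2) (q := 2) hf.star hg

theorem inner_toLp {f g : ℝ → ℂ} (hf : MemLp f 2 unitMeasure) (hg : MemLp g 2 unitMeasure) :
    inner ℂ (hf.toLp f) (hg.toLp g) = ∫ x, conj (f x) * g x ∂unitMeasure := by
  rw [inner_eq_integral]
  refine integral_congr_ae ?_
  filter_upwards [hf.coeFn_toLp, hg.coeFn_toLp] with x h1 h2
  rw [h1, h2]

theorem inner_toLp_left {f : ℝ → ℂ} (hf : MemLp f 2 unitMeasure) (g : UnitL2) :
    inner ℂ (hf.toLp f) g = ∫ x, conj (f x) * (g : ℝ → ℂ) x ∂unitMeasure := by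
  rw [inner_eq_integral]
  refine integral_congr_ae ?_
  filter_upwards [hf.coeFn_toLp] with x h1
  rw [h1]

theorem memLp_of_continuousOn {f : ℝ → ℂ} (hf : ContinuousOn f (Icc 0 1)) :
    MemLp f 2 unitMeasure := by
  obtain ⟨M, hM⟩ := isCompact_Icc (a := (0 : ℝ)) (b := 1) |>.exists_bound_of_continuousOn hf
  refine MemLp.of_bound ((hf.mono Ioo_subset_Icc_self).aestronglyMeasurable measurableSet_Ioo) M ?_
  rw [ae_unitMeasure]
  exact Eventually.of_forall fun x hx => hM x (Ioo_subset_Icc_self hx)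

theorem IsInDomain.continuousOn {b : ℝ} {φ w : ℝ → ℂ} (h : IsInDomain b φ w) :
    ContinuousOn φ (Icc 0 1) := by
  simpa [uIcc_of_le zero_le_one] using h.ac.continuousOn

theorem IsInDomain.memLp_fun {b : ℝ} {φ w : ℝ → ℂ} (h : IsInDomain b φ w) :
    MemLp φ 2 unitMeasure := memLp_of_continuousOn h.continuousOn

theorem intervalIntegrable_of_memLp {f : ℝ → ℂ} (hf : MemLp f 2 unitMeasure) :
    IntervalIntegrable f volume 0 1 := by
  rw [intervalIntegrable_iff_integrableOn_Ioo_of_le zero_le_one]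
  exact hf.integrable (by norm_num)

theorem integral_norm_le_norm (f : UnitL2) : ∫ x in (0 : ℝ)..1, ‖(f : ℝ → ℂ) x‖ ≤ ‖f‖ := by
  rw [intervalIntegral.integral_of_le zero_le_one, integral_Ioc_eq_integral_Ioo,
    integral_norm_eq_lintegral_enorm (Lp.memLp f).1, ← eLpNorm_one_eq_lintegral_enorm, Lp.norm_def]
  refine ENNReal.toReal_mono (Lp.eLpNorm_ne_top f) ?_
  have := eLpNorm_le_eLpNorm_mul_rpow_measure_univ (μ := unitMeasure) (p := 1) (q := 2)
    (f := (f : ℝ → ℂ)) (by norm_num) (Lp.memLp f).1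
  simpa using this

theorem eqOn_of_ae_eq {f g : ℝ → ℂ} (hf : ContinuousOn f (Icc 0 1)) (hg : ContinuousOn g (Icc 0 1))
    (h : ∀ᵐ x ∂unitMeasure, f x = g x) : EqOn f g (Icc 0 1) := by
  have h1 : EqOn f g (Ioo 0 1) :=
    Measure.eqOn_open_of_ae_eq h isOpen_Ioo (hf.mono Ioo_subset_Icc_self)
      (hg.mono Ioo_subset_Icc_self)
  have := h1.of_subset_closure hf hg Ioo_subset_Icc_self
    (by rw [closure_Ioo zero_ne_one])
  exact this

/-! ### The resolvent -/

/-- Two solutions of the eigenvalue equation at `l`, one for each end point, with nonzero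
Wronskian. -/
structure GreenData (b l : ℝ) (u ωu v ωv : ℝ → ℝ) (W : ℝ) : Prop where
  left : QuasiSol b l u ωu
  right : QuasiSol b l v ωv
  left_zero : u 0 = 0
  right_zero : v 1 = 0
  wronskian : ∀ x, u x * ωv x - ωu x * v x = W
  ne_zero : W ≠ 0

/-- With `m b = π/2` the sine and cosine are `1` and `0` at the interface, so both solutions can be
continued across `b` explicitly. The Wronskian is `-m cosh(m(1-b))`, which is nonzero, so `m²` is a
legitimate point for the resolvent. -/
theorem exists_greenData {b : ℝ} (hb : b ∈ Ioo (0 : ℝ) 1) :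
    ∃ l u ωu v ωv W, GreenData b l u ωu v ωv W := by
  obtain ⟨m, hm, hmb⟩ : ∃ m : ℝ, 0 < m ∧ m * b = Real.pi / 2 :=
    ⟨Real.pi / 2 / b, div_pos Real.pi_div_two_pos hb.1, div_mul_cancel₀ _ hb.1.ne'⟩
  have hs1 : ∀ x, HasDerivAt (fun x => Real.sin (m * x)) (m * Real.cos (m * x)) x := fun x => by
    simpa [mul_comm] using ((hasDerivAt_id x).const_mul m).sin
  have hc1 : ∀ x, HasDerivAt (fun x => Real.cos (m * x)) (-(m * Real.sin (m * x))) x := fun x => by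
    simpa [mul_comm] using ((hasDerivAt_id x).const_mul m).cos
  have hs2 : ∀ x, HasDerivAt (fun x => Real.sinh (m * (x - b))) (m * Real.cosh (m * (x - b))) x :=
    fun x => by simpa [mul_comm] using (((hasDerivAt_id x).sub_const b).const_mul m).sinh
  have hc2 : ∀ x, HasDerivAt (fun x => Real.cosh (m * (x - b))) (m * Real.sinh (m * (x - b))) x :=
    fun x => by simpa [mul_comm] using (((hasDerivAt_id x).sub_const b).const_mul m).cosh
  have hs3 : ∀ x, HasDerivAt (fun x => Real.sinh (m * (1 - x))) (-(m * Real.cosh (m * (1 - x)))) x :=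
    fun x => by simpa [mul_comm] using (((hasDerivAt_id x).const_sub 1).const_mul m).sinh
  have hc3 : ∀ x, HasDerivAt (fun x => Real.cosh (m * (1 - x))) (-(m * Real.sinh (m * (1 - x)))) x :=
    fun x => by simpa [mul_comm] using (((hasDerivAt_id x).const_sub 1).const_mul m).cosh
  set S := Real.sinh (m * (1 - b)) with hS
  set C := Real.cosh (m * (1 - b)) with hC
  refine ⟨m ^ 2, glue b (fun x => Real.sin (m * x)) (fun x => Real.cosh (m * (x - b))),
    glue b (fun x => -(m * Real.cos (m * x))) (fun x => m * Real.sinh (m * (x - b))),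
    glue b (fun x => S * Real.sin (m * x) - C * Real.cos (m * x)) (fun x => Real.sinh (m * (1 - x))),
    glue b (fun x => -(m * (S * Real.cos (m * x) + C * Real.sin (m * x))))
      (fun x => -(m * Real.cosh (m * (1 - x)))), -(m * C), ?_, ?_, ?_, ?_, ?_, ?_⟩
  · refine QuasiSol.of_glue (fun x => ?_) (fun x => ?_) (fun x => ?_) (fun x => ?_) ?_ ?_
    · simpa using hs1 x
    · convert! ((hc1 x).const_mul m).neg using 1; ring
    · exact hc2 x
    · convert! (hs2 x).const_mul m using 1; ring
    · simp [hmb]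
    · simp [hmb]
  · refine QuasiSol.of_glue (fun x => ?_) (fun x => ?_) (fun x => ?_) (fun x => ?_) ?_ ?_
    · convert! ((hs1 x).const_mul S).sub ((hc1 x).const_mul C) using 1; ring
    · convert! ((((hc1 x).const_mul S).add ((hs1 x).const_mul C)).const_mul m).neg using 1; ring
    · exact hs3 x
    · convert! ((hc3 x).const_mul m).neg using 1; ring
    · simp [hmb, hS]
    · simp [hmb, hC]
  · rw [glue_of_le _ _ hb.1.le]; simp
  · rw [glue_of_lt _ _ hb.2]; simp
  · intro x
    rcases le_or_gt x b with h | h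
    · simp only [glue_of_le _ _ h]
      linear_combination (-(m * C)) * Real.sin_sq_add_cos_sq (m * x)
    · simp only [glue_of_lt _ _ h]
      have : C = Real.cosh (m * (x - b) + m * (1 - x)) := by rw [hC]; congr 1; ring
      rw [this, Real.cosh_add]; ring
  · exact neg_ne_zero.2 (mul_ne_zero hm.ne' (Real.cosh_pos _).ne')

/-- Variation of constants: the combination `W⁻¹ (p ∫₀ˣ u f - r ∫₁ˣ v f)`. -/
noncomputable def greenFun (u v : ℝ → ℝ) (W : ℝ) (p r : ℝ → ℝ) (f : ℝ → ℂ) (x : ℝ) : ℂ :=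
  (W : ℂ)⁻¹ * (p x * (∫ y in (0 : ℝ)..x, (u y : ℂ) * f y) - r x * ∫ y in (1 : ℝ)..x, (v y : ℂ) * f y)

namespace GreenData

variable {b l : ℝ} {u ωu v ωv : ℝ → ℝ} {W : ℝ}

theorem intervalIntegrable_mul {p : ℝ → ℝ} (hp : Continuous p) {f : ℝ → ℂ}
    (hf : MemLp f 2 unitMeasure) : IntervalIntegrable (fun y => (p y : ℂ) * f y) volume 0 1 :=
  (intervalIntegrable_of_memLp hf).continuousOn_mul
    (Complex.continuous_ofReal.comp hp).continuousOn

/-- When the integrals are differentiated, the two terms in `f` cancel in the function and add up to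
`f` times the Wronskian in the quasi-derivative: `greenFun` is the resolvent `(D - l)⁻¹`. The base
points `0` and `1` of the integrals, with `u 0 = 0` and `v 1 = 0`, give the Dirichlet conditions. -/
theorem isInDomain (h : GreenData b l u ωu v ωv W) {f : ℝ → ℂ} (hf : MemLp f 2 unitMeasure) :
    IsInDomain b (greenFun u v W v u f) (greenFun u v W ωv ωu f) ∧
      ∀ᵐ x ∂unitMeasure, deriv (greenFun u v W ωv ωu f) x = l * greenFun u v W v u f x + f x := by
  have hW : (W : ℂ) ≠ 0 := by exact_mod_cast h.ne_zero
  have hA := intervalIntegrable_mul h.left.cont hf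
  have hB := intervalIntegrable_mul h.right.cont hf
  have acA := AC.of_integral hA (left_mem_uIcc)
  have acB := AC.of_integral hB (right_mem_uIcc)
  have ac : ∀ {p r : ℝ → ℝ}, AbsolutelyContinuousOnInterval p 0 1 →
      AbsolutelyContinuousOnInterval r 0 1 →
      AbsolutelyContinuousOnInterval (greenFun u v W p r f) 0 1 := fun hp hr =>
    AC.const_mul _ ((AC.mul (AC.ofReal hp) acA).fun_sub (AC.mul (AC.ofReal hr) acB))
  have hI : ∀ {x : ℝ}, x ∈ Ioo (0 : ℝ) 1 → x ∈ uIcc (0 : ℝ) 1 := fun hx => by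
    rw [uIcc_of_le zero_le_one]; exact Ioo_subset_Icc_self hx
  have key : ∀ᵐ x ∂unitMeasure, deriv (greenFun u v W ωv ωu f) x
      = l * greenFun u v W v u f x + f x := by
    rw [ae_unitMeasure]
    filter_upwards [hA.ae_hasDerivAt_integral, hB.ae_hasDerivAt_integral, ae_ne b] with x h1 h2 h3 hx
    have d1 := h1 (hI hx) 0 left_mem_uIcc
    have d2 := h2 (hI hx) 1 right_mem_uIcc
    have d3 := (h.left.deriv_quasi x h3).ofReal_comp
    have d4 := (h.right.deriv_quasi x h3).ofReal_comp
    have hw : (u x : ℂ) * ωv x - ωu x * v x = W := by exact_mod_cast h.wronskian x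
    refine (((d4.mul d1).sub (d3.mul d2)).const_mul (W : ℂ)⁻¹).deriv.trans ?_
    simp only [greenFun]
    push_cast
    field_simp
    linear_combination f x * hw
  refine ⟨⟨ac (h.right.ac 0 1) (h.left.ac 0 1), ac (h.right.ac_quasi 0 1) (h.left.ac_quasi 0 1),
    ?_, ?_, ?_, ?_⟩, key⟩
  · rw [ae_unitMeasure]
    filter_upwards [hA.ae_hasDerivAt_integral, hB.ae_hasDerivAt_integral, ae_ne b] with x h1 h2 h3 hx
    have d1 := h1 (hI hx) 0 left_mem_uIcc
    have d2 := h2 (hI hx) 1 right_mem_uIcc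
    have d3 := (h.left.deriv_fun x h3).ofReal_comp
    have d4 := (h.right.deriv_fun x h3).ofReal_comp
    have e : deriv (greenFun u v W v u f) x
        = (SignType.sign (x - b) : ℝ) * greenFun u v W ωv ωu f x := by
      refine (((d4.mul d1).sub (d3.mul d2)).const_mul (W : ℂ)⁻¹).deriv.trans ?_
      simp only [greenFun]
      push_cast
      ring
    rw [e, QuasiSol.sign_mul_sign_mul h3]
  · simp [greenFun, h.left_zero]
  · simp [greenFun, h.right_zero]
  · refine MemLp.ae_eq (f := fun x => l * greenFun u v W v u f x + f x)
      (by filter_upwards [key] with x hx using hx.symm) ?_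
    refine MemLp.add (MemLp.const_mul (memLp_of_continuousOn ?_) _) hf
    simpa [uIcc_of_le zero_le_one] using (ac (h.right.ac 0 1) (h.left.ac 0 1)).continuousOn

theorem norm_integral_le {p : ℝ → ℝ} {M : ℝ} (hp : Continuous p) (hM : ∀ x ∈ Icc (0 : ℝ) 1, |p x| ≤ M)
    (f : UnitL2) {c d : ℝ} (hc : c ∈ Icc (0 : ℝ) 1) (hd : d ∈ Icc (0 : ℝ) 1) :
    ‖∫ y in c..d, (p y : ℂ) * (f : ℝ → ℂ) y‖ ≤ M * ‖f‖ := by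
  have hM0 : 0 ≤ M := (abs_nonneg _).trans (hM 0 (by simp))
  have hsub : uIoc c d ⊆ Ioc 0 1 := by
    intro x hx
    rw [uIoc, mem_Ioc] at hx
    exact ⟨lt_of_le_of_lt (le_min hc.1 hd.1) hx.1, hx.2.trans (max_le hc.2 hd.2)⟩
  have hi := (intervalIntegrable_of_memLp (Lp.memLp f)).norm.const_mul M
  have hi' := intervalIntegrable_mul hp (Lp.memLp f)
  refine (intervalIntegral.norm_integral_le_integral_norm_uIoc).trans ?_
  refine le_trans ?_ (mul_le_mul_of_nonneg_left (integral_norm_le_norm f) hM0)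
  rw [← intervalIntegral.integral_const_mul, intervalIntegral.integral_of_le zero_le_one]
  refine (setIntegral_mono_on (IntegrableOn.mono_set hi'.1.norm hsub) (hi.1.mono_set hsub) measurableSet_uIoc
    fun x hx => ?_).trans (setIntegral_mono_set hi.1 ?_ (Eventually.of_forall fun _ hx => hsub hx))
  · rw [norm_mul, Complex.norm_real]
    exact mul_le_mul_of_nonneg_right (hM x (Ioc_subset_Icc_self (hsub hx))) (norm_nonneg _)
  · exact Eventually.of_forall fun x => mul_nonneg hM0 (norm_nonneg _)

/-- The derivative has the same modulus as the quasi-derivative, which is again a `greenFun` and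
obeys the same estimate. Thus one `L²` bound controls both the size and the Lipschitz constant. -/
theorem exists_bound (h : GreenData b l u ωu v ωv W) : ∃ M : ℝ≥0, ∀ f : UnitL2,
    (∀ x ∈ Icc (0 : ℝ) 1, ‖greenFun u v W v u f x‖ ≤ M * ‖f‖) ∧
    LipschitzOnWith (M * ‖f‖₊) (greenFun u v W v u f) (Icc 0 1) := by
  have hbd : ∀ {p : ℝ → ℝ}, Continuous p → ∃ M : ℝ, ∀ x ∈ Icc (0 : ℝ) 1, |p x| ≤ M := fun hp =>
    isCompact_Icc.exists_bound_of_continuousOn hp.continuousOn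
  obtain ⟨M1, h1⟩ := hbd h.left.cont
  obtain ⟨M2, h2⟩ := hbd h.left.cont_quasi
  obtain ⟨M3, h3⟩ := hbd h.right.cont
  obtain ⟨M4, h4⟩ := hbd h.right.cont_quasi
  set M := max (max M1 M2) (max M3 M4)
  have hM : ∀ x ∈ Icc (0 : ℝ) 1, |u x| ≤ M ∧ |ωu x| ≤ M ∧ |v x| ≤ M ∧ |ωv x| ≤ M := fun x hx =>
    ⟨(h1 x hx).trans (by simp [M]), (h2 x hx).trans (by simp [M]), (h3 x hx).trans (by simp [M]),
      (h4 x hx).trans (by simp [M])⟩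
  have hM0 : 0 ≤ M := (abs_nonneg _).trans (hM 0 (by simp)).1
  have gen : ∀ (p r : ℝ → ℝ), (∀ x ∈ Icc (0 : ℝ) 1, |p x| ≤ M ∧ |r x| ≤ M) → ∀ f : UnitL2,
      ∀ x ∈ Icc (0 : ℝ) 1, ‖greenFun u v W p r f x‖ ≤ |W|⁻¹ * (M * M + M * M) * ‖f‖ := by
    intro p r hpr f x hx
    have a1 := norm_integral_le h.left.cont (fun x hx => (hM x hx).1) f (c := 0) (by simp) hx
    have a2 := norm_integral_le h.right.cont (fun x hx => (hM x hx).2.2.1) f (c := 1) (by simp) hx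
    rw [greenFun, norm_mul, norm_inv, Complex.norm_real, Real.norm_eq_abs, mul_assoc]
    refine mul_le_mul_of_nonneg_left ?_ (by positivity)
    refine (norm_sub_le _ _).trans ?_
    rw [norm_mul, norm_mul, Complex.norm_real, Complex.norm_real, add_mul, mul_assoc]
    exact add_le_add (mul_le_mul (hpr x hx).1 a1 (norm_nonneg _) hM0)
      (mul_le_mul (hpr x hx).2 a2 (norm_nonneg _) hM0)
  refine ⟨⟨|W|⁻¹ * (M * M + M * M), by positivity⟩, fun f => ⟨gen v u
    (fun x hx => ⟨(hM x hx).2.2.1, (hM x hx).1⟩) f, ?_⟩⟩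
  have hdom := (h.isInDomain (Lp.memLp f)).1
  refine LipschitzOnWith.of_dist_le_mul fun x hx y hy => ?_
  have hsub : uIcc y x ⊆ uIcc (0 : ℝ) 1 := by
    rw [uIcc_of_le (zero_le_one' ℝ)]; exact uIcc_subset_Icc hy hx
  rw [dist_eq_norm, ← AC.integral_deriv_eq_sub (hdom.ac.mono hsub), Real.dist_eq]
  refine intervalIntegral.norm_integral_le_of_norm_le_const_ae ?_
  filter_upwards [AC.ae_differentiableAt hdom.ac, ae_unitMeasure.1 hdom.quasi_eq, ae_ne b, ae_ne 0,
    ae_ne 1] with z d1 d2 d3 d4 d5 hz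
  have hz' : z ∈ Icc (0 : ℝ) 1 := by
    rw [← uIcc_of_le (zero_le_one' ℝ)]; exact hsub (uIoc_subset_uIcc hz)
  have hz'' : z ∈ Ioo (0 : ℝ) 1 := ⟨lt_of_le_of_ne hz'.1 d4.symm, lt_of_le_of_ne hz'.2 d5⟩
  have e : ‖deriv (greenFun u v W v u f) z‖ = ‖greenFun u v W ωv ωu f z‖ := by
    rw [d2 hz'', norm_mul, Complex.norm_real]
    rcases lt_or_gt_of_ne d3 with h | h
    · simp [sign_neg (sub_neg.2 h)]
    · simp [sign_pos (sub_pos.2 h)]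
  rw [e]
  exact gen ωv ωu (fun x hx => ⟨(hM x hx).2.2.2, (hM x hx).2.1⟩) f z hz'

end GreenData

end

section

/-! ### Compactness of the resolvent and completeness of the eigenfunctions -/

instance : IsProbabilityMeasure unitMeasure := ⟨by simp⟩

theorem memLp_IccExtend (g : Icc (0 : ℝ) 1 →ᵇ ℂ) :
    MemLp (IccExtend zero_le_one g) 2 unitMeasure :=
  memLp_of_continuousOn (g.continuous.Icc_extend').continuousOn

/-- The inclusion of `C([0,1])` into `L²(0,1)`. -/
noncomputable def continuousToL2 : (Icc (0 : ℝ) 1 →ᵇ ℂ) →L[ℂ] UnitL2 :=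
  LinearMap.mkContinuous
    { toFun := fun g => (memLp_IccExtend g).toLp _
      map_add' := fun g h => by
        rw [← MemLp.toLp_add]; rfl
      map_smul' := fun c g => by
        rw [RingHom.id_apply, ← MemLp.toLp_const_smul]; rfl } 1 (by
    intro g
    rw [one_mul]
    refine (Lp.norm_le_of_ae_bound (norm_nonneg g) (C := ‖g‖) ?_).trans
      (by simp [measureUnivNNReal])
    filter_upwards [(memLp_IccExtend g).coeFn_toLp] with x hx
    simp only [LinearMap.coe_mk, AddHom.coe_mk]
    rw [hx]
    exact g.norm_coe_le_norm _)

theorem continuousToL2_coeFn (g : Icc (0 : ℝ) 1 →ᵇ ℂ) :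
    (continuousToL2 g : ℝ → ℂ) =ᵐ[unitMeasure] IccExtend zero_le_one g :=
  (memLp_IccExtend g).coeFn_toLp

theorem integral_mul_congr {p : ℝ → ℝ} {f g : ℝ → ℂ} (hfg : f =ᵐ[unitMeasure] g) {c d : ℝ}
    (hc : c ∈ Icc (0 : ℝ) 1) (hd : d ∈ Icc (0 : ℝ) 1) :
    ∫ y in c..d, (p y : ℂ) * f y = ∫ y in c..d, (p y : ℂ) * g y := by
  refine intervalIntegral.integral_congr_ae ?_
  filter_upwards [ae_unitMeasure.1 hfg, ae_ne 1] with x h1 h2 hx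
  rw [uIoc, mem_Ioc] at hx
  rw [h1 ⟨lt_of_le_of_lt (le_min hc.1 hd.1) hx.1,
    lt_of_le_of_ne (hx.2.trans (max_le hc.2 hd.2)) h2⟩]

/-- This makes `greenFun` well defined, hence linear, on classes in `L²(0,1)`. -/
theorem greenFun_congr {u v p r : ℝ → ℝ} {W : ℝ} {f g : ℝ → ℂ} (hfg : f =ᵐ[unitMeasure] g) {x : ℝ}
    (hx : x ∈ Icc (0 : ℝ) 1) : greenFun u v W p r f x = greenFun u v W p r g x := by
  rw [greenFun, greenFun, integral_mul_congr hfg (by simp) hx, integral_mul_congr hfg (by simp) hx]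

/-- Arzelà–Ascoli: the image of the unit ball is bounded and uniformly Lipschitz, hence
equicontinuous. -/
theorem LinearMap_isCompactOperator_of_lipschitz {E : Type*} [NormedAddCommGroup E]
    [NormedSpace ℂ E] (T : E →L[ℂ] (Icc (0 : ℝ) 1 →ᵇ ℂ)) (M : ℝ≥0)
    (h1 : ∀ f x, ‖T f x‖ ≤ M * ‖f‖) (h2 : ∀ f, LipschitzWith (M * ‖f‖₊) (T f)) :
    IsCompactOperator T := by
  rw [isCompactOperator_iff_exists_mem_nhds_isCompact_closure_image]
  refine ⟨Metric.ball 0 1, Metric.ball_mem_nhds 0 one_pos, ?_⟩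
  refine BoundedContinuousFunction.arzela_ascoli (Metric.closedBall 0 M)
    (isCompact_closedBall 0 (M : ℝ)) _ ?_ ?_
  · rintro _ x ⟨f, hf, rfl⟩
    rw [mem_closedBall_zero_iff]
    refine (h1 f x).trans (mul_le_of_le_one_right M.2 ?_)
    exact (mem_ball_zero_iff.1 hf).le
  · refine Metric.equicontinuous_of_continuity_modulus (fun t => M * t) ?_ _ ?_
    · simpa using (by fun_prop : Continuous fun t : ℝ => (M : ℝ) * t).tendsto 0
    · rintro x y ⟨_, f, hf, rfl⟩
      refine ((h2 f).dist_le_mul x y).trans ?_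
      refine mul_le_mul_of_nonneg_right ?_ dist_nonneg
      push_cast
      exact mul_le_of_le_one_right M.2 (mem_ball_zero_iff.1 hf).le

/-! ### The resolvent as a compact operator -/

namespace GreenData

variable {b l : ℝ} {u ωu v ωv : ℝ → ℝ} {W : ℝ}

theorem greenFun_add {p r : ℝ → ℝ} (h : GreenData b l u ωu v ωv W) (f g : UnitL2) {x : ℝ}
    (hx : x ∈ Icc (0 : ℝ) 1) :
    greenFun u v W p r (f + g : UnitL2) x = greenFun u v W p r f x + greenFun u v W p r g x := by
  rw [greenFun_congr (Lp.coeFn_add f g) hx]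
  have hs : ∀ {c : ℝ}, c ∈ Icc (0 : ℝ) 1 → uIcc c x ⊆ uIcc (0 : ℝ) 1 := fun hc => by
    rw [uIcc_of_le (zero_le_one' ℝ)]; exact uIcc_subset_Icc hc hx
  simp only [greenFun, Pi.add_apply, mul_add]
  have i : ∀ {p : ℝ → ℝ} (_ : Continuous p) (f : UnitL2) {c : ℝ} (_ : c ∈ Icc (0 : ℝ) 1),
    IntervalIntegrable (fun y => (p y : ℂ) * (f : ℝ → ℂ) y) volume c x := fun hp f _ hc =>
      (intervalIntegrable_mul hp (Lp.memLp f)).mono_set (hs hc)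
  rw [intervalIntegral.integral_add (i h.left.cont f (by simp)) (i h.left.cont g (by simp)),
    intervalIntegral.integral_add (i h.right.cont f (by simp)) (i h.right.cont g (by simp))]
  ring

theorem greenFun_smul {p r : ℝ → ℝ} (c : ℂ) (f : UnitL2) {x : ℝ} (hx : x ∈ Icc (0 : ℝ) 1) :
    greenFun u v W p r (c • f : UnitL2) x = c * greenFun u v W p r f x := by
  rw [greenFun_congr (Lp.coeFn_smul c f) hx]
  simp only [greenFun, Pi.smul_apply, smul_eq_mul, mul_left_comm _ c,
    intervalIntegral.integral_const_mul]
  ring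

theorem exists_compact (h : GreenData b l u ωu v ωv W) :
    ∃ K : UnitL2 →L[ℂ] UnitL2, IsCompactOperator K ∧
      ∀ f : UnitL2, ∀ᵐ x ∂unitMeasure, (K f : ℝ → ℂ) x = greenFun u v W v u f x := by
  obtain ⟨M, hM⟩ := h.exists_bound
  have hbd : ∀ f : UnitL2, ∀ x : Icc (0 : ℝ) 1, ‖greenFun u v W v u f x‖ ≤ M * ‖f‖ :=
    fun f x => (hM f).1 x x.2
  have hc : ∀ f : UnitL2, Continuous fun x : Icc (0 : ℝ) 1 => greenFun u v W v u f x := fun f =>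
    continuousOn_iff_continuous_domRestrict.1 (hM f).2.continuousOn
  let T : UnitL2 →L[ℂ] (Icc (0 : ℝ) 1 →ᵇ ℂ) := LinearMap.mkContinuous
    { toFun := fun f => BoundedContinuousFunction.ofNormedAddCommGroup _ (hc f) _ (hbd f)
      map_add' := fun f g => by
        ext x; exact h.greenFun_add f g x.2
      map_smul' := fun c f => by
        ext x; exact greenFun_smul c f x.2 } M (fun f =>
      (BoundedContinuousFunction.norm_le (by positivity)).2 (hbd f))
  have hT : ∀ (f : UnitL2) (x : Icc (0 : ℝ) 1), T f x = greenFun u v W v u f x := fun _ _ => rfl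
  refine ⟨continuousToL2.comp T, ?_, fun f => ?_⟩
  · refine (LinearMap_isCompactOperator_of_lipschitz T M hbd fun f => ?_).clm_comp continuousToL2
    exact (lipschitzOnWith_iff_restrict).1 (hM f).2
  · filter_upwards [continuousToL2_coeFn (T f), ae_restrict_mem measurableSet_Ioo] with x hx hx'
    rw [ContinuousLinearMap.comp_apply, hx, IccExtend_of_mem _ _ (Ioo_subset_Icc_self hx'), hT]

end GreenData

/-- The eigenfunction as an element of `L²(0,1)`. -/
noncomputable def eigvec (b : ℝ) (hb : b ∈ Ioo (0 : ℝ) 1) (l : {l : ℝ // IsEigen b l}) : UnitL2 :=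
  (l.2.isInDomain hb).memLp_fun.toLp _

variable {b : ℝ} (hb : b ∈ Ioo (0 : ℝ) 1)

theorem eigvec_coeFn (l : {l : ℝ // IsEigen b l}) :
    ∀ᵐ x ∂unitMeasure, (eigvec b hb l : ℝ → ℂ) x = eigfun b l x :=
  (l.2.isInDomain hb).memLp_fun.coeFn_toLp

theorem eigvec_ne_zero (l : {l : ℝ // IsEigen b l}) : eigvec b hb l ≠ 0 := by
  intro h0
  have h1 : ∀ᵐ x ∂unitMeasure, (eigfun b l x : ℂ) = (fun _ => (0 : ℂ)) x := by
    have := Lp.coeFn_zero ℂ 2 unitMeasure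
    rw [← h0] at this
    filter_upwards [this, eigvec_coeFn hb l] with x h1 h2
    rw [← h2, h1]; rfl
  have := eqOn_of_ae_eq (l.2.isInDomain hb).continuousOn continuousOn_const h1
    (Ioo_subset_Icc_self hb)
  exact l.2.eigfun_ne_zero hb (Complex.ofReal_eq_zero.1 this)

/-- Pairing with an eigenfunction. -/
theorem IsInDomain.pairing_eigfun (hb : b ∈ Ioo (0 : ℝ) 1) {φ w : ℝ → ℂ} (h : IsInDomain b φ w)
    {l : ℝ} (hl : IsEigen b l) :
    ∫ x, conj (deriv w x) * (eigfun b l x : ℂ) ∂unitMeasure =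
      l * ∫ x, conj (φ x) * (eigfun b l x : ℂ) ∂unitMeasure := by
  rw [← h.symmetric (hl.isInDomain hb), ← integral_const_mul]
  refine integral_congr_ae (ae_restrict_of_ae ?_)
  filter_upwards [ae_ne b] with x hx
  rw [hl.quasiSol.deriv_quasi_ofReal hx]; ring

theorem inner_eigvec_ne {l l' : {l : ℝ // IsEigen b l}} (hne : l ≠ l') :
    inner ℂ (eigvec b hb l) (eigvec b hb l') = 0 := by
  rw [eigvec, eigvec, inner_toLp]
  have h := IsInDomain.pairing_eigfun hb (l.2.isInDomain hb) l'.2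
  have e : ∫ x, conj (deriv (fun x => (eigquasi b l x : ℂ)) x) * (eigfun b l' x : ℂ) ∂unitMeasure
      = l * ∫ x, conj (eigfun b l x : ℂ) * (eigfun b l' x : ℂ) ∂unitMeasure := by
    rw [← integral_const_mul]
    refine integral_congr_ae (ae_restrict_of_ae ?_)
    filter_upwards [ae_ne b] with x hx
    rw [l.2.quasiSol.deriv_quasi_ofReal hx, map_mul, Complex.conj_ofReal]; ring
  rw [e] at h
  have hs : ((l : ℝ) : ℂ) - (l' : ℝ) ≠ 0 := by
    rw [sub_ne_zero]; exact fun h => hne (Subtype.ext (by exact_mod_cast h))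
  refine mul_left_cancel₀ hs ?_
  rw [mul_zero, sub_mul, h, sub_self]

/-- The normalised eigenfunction. -/
noncomputable def eigunit (l : {l : ℝ // IsEigen b l}) : UnitL2 :=
  ((‖eigvec b hb l‖⁻¹ : ℝ) : ℂ) • eigvec b hb l

theorem orthonormal_eigunit : Orthonormal ℂ (eigunit hb) := by
  constructor
  · intro l
    rw [eigunit, norm_smul, Complex.norm_real, Real.norm_eq_abs, abs_inv, abs_norm,
      inv_mul_cancel₀ (norm_ne_zero_iff.2 (eigvec_ne_zero hb l))]
  · intro l l' hne
    rw [eigunit, eigunit, inner_smul_left, inner_smul_right, inner_eigvec_ne hb hne]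
    simp

/-- The resolvent `K` is compact and symmetric, so its eigenspaces are total. An eigenvector of `K`
for `κ` solves the eigenvalue equation of `D` at `l₀ + 1/κ`, and `eq_eigfun` makes it a multiple of
a single `eigfun`. -/
theorem span_eigunit_orthogonal : (Submodule.span ℂ (range (eigunit hb)))ᗮ = ⊥ := by
  obtain ⟨l₀, u, ωu, v, ωv, W, h⟩ := exists_greenData hb
  obtain ⟨K, hK, hKf⟩ := h.exists_compact
  have hcont : ∀ f : UnitL2, ContinuousOn (greenFun u v W v u f) (Icc 0 1) := fun f =>
    (h.isInDomain (Lp.memLp f)).1.continuousOn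
  have hmem : ∀ f : UnitL2, MemLp (greenFun u v W v u f) 2 unitMeasure := fun f =>
    memLp_of_continuousOn (hcont f)
  have hsymm : (K : UnitL2 →ₗ[ℂ] UnitL2).IsSymmetric := by
    intro f g
    have hf := h.isInDomain (Lp.memLp f)
    have hg := h.isInDomain (Lp.memLp g)
    have e1 : inner ℂ (K f) g = ∫ x, conj (greenFun u v W v u f x) * (g : ℝ → ℂ) x ∂unitMeasure := by
      rw [inner_eq_integral]
      exact integral_congr_ae (by filter_upwards [hKf f] with x hx; rw [hx])
    have e2 : inner ℂ f (K g) = ∫ x, conj ((f : ℝ → ℂ) x) * greenFun u v W v u g x ∂unitMeasure := by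
      rw [inner_eq_integral]
      exact integral_congr_ae (by filter_upwards [hKf g] with x hx; rw [hx])
    simp only [ContinuousLinearMap.coe_coe]
    rw [e1, e2]
    -- Symmetry of `K` follows from that of `D`: the terms with `l₀` are the same on both sides
    -- because `l₀` is real.
    have key := hf.1.symmetric hg.1
    have k1 : ∫ x, conj (greenFun u v W v u f x) * deriv (greenFun u v W ωv ωu g) x ∂unitMeasure
        = l₀ * (∫ x, conj (greenFun u v W v u f x) * greenFun u v W v u g x ∂unitMeasure)
          + ∫ x, conj (greenFun u v W v u f x) * (g : ℝ → ℂ) x ∂unitMeasure := by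
      rw [← integral_const_mul, ← integral_add ((integrable_conj_mul (hmem f) (hmem g)).const_mul _)
        (integrable_conj_mul (hmem f) (Lp.memLp g))]
      exact integral_congr_ae (by filter_upwards [hg.2] with x hx; rw [hx]; ring)
    have k2 : ∫ x, conj (deriv (greenFun u v W ωv ωu f) x) * greenFun u v W v u g x ∂unitMeasure
        = l₀ * (∫ x, conj (greenFun u v W v u f x) * greenFun u v W v u g x ∂unitMeasure)
          + ∫ x, conj ((f : ℝ → ℂ) x) * greenFun u v W v u g x ∂unitMeasure := by
      rw [← integral_const_mul, ← integral_add ((integrable_conj_mul (hmem f) (hmem g)).const_mul _)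
        (integrable_conj_mul (Lp.memLp f) (hmem g))]
      refine integral_congr_ae ?_
      filter_upwards [hf.2] with x hx
      rw [hx, map_add, map_mul, Complex.conj_ofReal]; ring
    rw [k1, k2] at key
    exact add_left_cancel key
  have hspec := ContinuousLinearMap.orthogonalComplement_iSup_eigenspaces_eq_bot hK hsymm
  rw [eq_bot_iff, ← hspec]
  refine Submodule.orthogonal_le (iSup_le fun κ f hf => ?_)
  rw [Module.End.mem_eigenspace_iff, ContinuousLinearMap.coe_coe] at hf
  by_cases hf0 : f = 0
  · rw [hf0]; exact Submodule.zero_mem _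
  obtain ⟨hdom, hder⟩ := h.isInDomain (Lp.memLp f)
  have hgf : ∀ᵐ x ∂unitMeasure, greenFun u v W v u f x = κ * (f : ℝ → ℂ) x := by
    filter_upwards [hKf f, Lp.coeFn_smul κ f] with x h1 h2
    rw [← h1, hf, h2]; rfl
  -- `K` is injective: if `K f = 0`, then the Green function and hence its quasi-derivative vanish
  -- identically, and `f` is read off from `(D - l₀) K f = f`.
  have hκ : κ ≠ 0 := by
    rintro rfl
    have z1 : EqOn (greenFun u v W v u f) (fun _ => 0) (Icc 0 1) :=
      eqOn_of_ae_eq (hcont f) continuousOn_const (by filter_upwards [hgf] with x hx; simpa using hx)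
    have z2 : EqOn (greenFun u v W ωv ωu f) (fun _ => 0) (Icc 0 1) := by
      refine eqOn_of_ae_eq (by simpa [uIcc_of_le zero_le_one] using hdom.ac_quasi.continuousOn)
        continuousOn_const ?_
      filter_upwards [hdom.quasi_eq, ae_restrict_mem measurableSet_Ioo] with x hx hx'
      have : greenFun u v W v u f =ᶠ[𝓝 x] fun _ => 0 := by
        filter_upwards [Ioo_mem_nhds hx'.1 hx'.2] with y hy using z1 (Ioo_subset_Icc_self hy)
      rw [hx, this.deriv_eq]; simp
    apply hf0
    refine Lp.ext ?_
    filter_upwards [hder, ae_restrict_mem measurableSet_Ioo, Lp.coeFn_zero ℂ 2 unitMeasure]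
      with x hx hx' h0
    have : greenFun u v W ωv ωu f =ᶠ[𝓝 x] fun _ => 0 := by
      filter_upwards [Ioo_mem_nhds hx'.1 hx'.2] with y hy using z2 (Ioo_subset_Icc_self hy)
    rw [this.deriv_eq, z1 (Ioo_subset_Icc_self hx')] at hx
    rw [h0]
    simpa using hx.symm
  have hκr : ((κ.re : ℝ) : ℂ) = κ := by
    have := hsymm.conj_eigenvalue_eq_self (Module.End.hasEigenvalue_of_hasEigenvector
      (x := f) (μ := κ) ⟨Module.End.mem_eigenspace_iff.2 hf, hf0⟩)
    exact Complex.conj_eq_iff_re.1 this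
  have hfg : ∀ᵐ x ∂unitMeasure, (f : ℝ → ℂ) x = κ⁻¹ * greenFun u v W v u f x := by
    filter_upwards [hgf] with x hx
    rw [hx, inv_mul_cancel_left₀ hκ]
  obtain ⟨⟨γ, hγ⟩, hE⟩ := hdom.eq_eigfun (l := l₀ + κ.re⁻¹) hb (by
    filter_upwards [hder, hfg] with x h1 h2
    rw [h1]
    conv_lhs => rw [h2]
    push_cast
    rw [hκr]; ring)
  have hl : IsEigen b (l₀ + κ.re⁻¹) := by
    apply hE
    by_contra! hz
    apply hf0
    refine Lp.ext ?_
    filter_upwards [hfg, ae_restrict_mem measurableSet_Ioo, Lp.coeFn_zero ℂ 2 unitMeasure]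
      with x h1 h2 h3
    rw [h1, hz x (Ioo_subset_Icc_self h2), h3]; simp
  have hfin : f = (κ⁻¹ * γ * ‖eigvec b hb ⟨_, hl⟩‖) • eigunit hb ⟨_, hl⟩ := by
    rw [eigunit, smul_smul, mul_assoc]
    have : ((‖eigvec b hb ⟨_, hl⟩‖ : ℝ) : ℂ) ≠ 0 := by
      exact_mod_cast norm_ne_zero_iff.2 (eigvec_ne_zero hb ⟨_, hl⟩)
    push_cast
    rw [mul_inv_cancel₀ this, mul_one]
    refine Lp.ext ?_
    filter_upwards [hfg, ae_restrict_mem measurableSet_Ioo,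
      Lp.coeFn_smul (κ⁻¹ * γ) (eigvec b hb ⟨_, hl⟩), eigvec_coeFn hb ⟨_, hl⟩] with x h1 h2 h3 h4
    rw [h1, h3, Pi.smul_apply, h4, hγ x (Ioo_subset_Icc_self h2), smul_eq_mul]; ring
  rw [hfin]
  exact Submodule.smul_mem _ _ (Submodule.subset_span ⟨_, rfl⟩)

/-- The Hilbert basis of normalised eigenfunctions. -/
noncomputable def eigbasis : HilbertBasis {l : ℝ // IsEigen b l} ℂ UnitL2 :=
  HilbertBasis.mkOfOrthogonalEqBot (orthonormal_eigunit hb) (span_eigunit_orthogonal hb)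

theorem eigbasis_apply (l : {l : ℝ // IsEigen b l}) : eigbasis hb l = eigunit hb l := by
  rw [eigbasis, HilbertBasis.coe_mkOfOrthogonalEqBot]

end

section

/-! ### Existence, uniqueness and spectral expansion of the solution -/

/-- The unimodular factor `exp(-i l t)`. -/
noncomputable def rot (l t : ℝ) : ℂ := Complex.exp (-Complex.I * ((l : ℂ) * (t : ℂ)))

theorem norm_rot (l t : ℝ) : ‖rot l t‖ = 1 := by
  rw [rot, show -Complex.I * ((l : ℂ) * (t : ℂ)) = ((-(l * t) : ℝ) : ℂ) * Complex.I by
    push_cast; ring, Complex.norm_exp_ofReal_mul_I]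

theorem rot_zero (l : ℝ) : rot l 0 = 1 := by simp [rot]

theorem hasDerivAt_rot (l t : ℝ) : HasDerivAt (rot l) (-Complex.I * l * rot l t) t := by
  have h : HasDerivAt (fun t : ℝ => -Complex.I * ((l : ℂ) * (t : ℂ))) (-Complex.I * l) t := by
    simpa using ((hasDerivAt_id t).ofReal_comp.const_mul (l : ℂ)).const_mul (-Complex.I)
  convert! h.cexp using 1
  rw [rot]; ring

theorem continuous_rot (l : ℝ) : Continuous (rot l) :=
  continuous_iff_continuousAt.2 fun t => (hasDerivAt_rot l t).continuousAt

theorem eq_rot_mul {f : ℝ → ℂ} {l : ℝ} (h : ∀ t, HasDerivAt f (-Complex.I * (l * f t)) t) (t : ℝ) :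
    f t = rot l t * f 0 := by
  have h1 : ∀ t, HasDerivAt (fun t => rot (-l) t * f t) 0 t := fun t => by
    convert! (hasDerivAt_rot (-l) t).mul (h t) using 1
    push_cast; ring
  have h2 := is_const_of_deriv_eq_zero (fun t => (h1 t).differentiableAt) (fun t => (h1 t).deriv) t 0
  have h3 : rot l t * rot (-l) t = 1 := by
    rw [rot, rot, ← Complex.exp_add]; simp
  simp only [rot_zero, one_mul] at h2
  rw [← h2, ← mul_assoc, h3, one_mul]

/-! ### Diagonal unitary groups in a Hilbert basis -/

variable {ι : Type*} {E : Type*} [NormedAddCommGroup E] [InnerProductSpace ℂ E]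

theorem memℓp_rot_mul (B : HilbertBasis ι ℂ E) (lam : ι → ℝ) (v : E) (t : ℝ) :
    Memℓp (fun i => rot (lam i) t * B.repr v i) 2 := by
  have h := lp.memℓp (B.repr v)
  rw [memℓp_gen_iff (by norm_num)] at h ⊢
  simpa [norm_mul, norm_rot] using h

/-- The unitary group that is diagonal in the Hilbert basis `B` with frequencies `lam`. -/
noncomputable def diagEvolution (B : HilbertBasis ι ℂ E) (lam : ι → ℝ) (v : E) (t : ℝ) : E :=
  B.repr.symm ⟨_, memℓp_rot_mul B lam v t⟩

variable (B : HilbertBasis ι ℂ E) (lam : ι → ℝ) (v : E)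

theorem repr_diagEvolution (t : ℝ) (i : ι) :
    B.repr (diagEvolution B lam v t) i = rot (lam i) t * B.repr v i := by
  rw [diagEvolution, LinearIsometryEquiv.apply_symm_apply]

theorem diagEvolution_zero : diagEvolution B lam v 0 = v := by
  apply B.repr.injective
  ext i
  rw [repr_diagEvolution, rot_zero, one_mul]

theorem hasSum_diagEvolution (t : ℝ) :
    HasSum (fun i => (rot (lam i) t * B.repr v i) • B i) (diagEvolution B lam v t) := by
  simpa only [repr_diagEvolution] using B.hasSum_repr (diagEvolution B lam v t)

/-- The phases are not equicontinuous for unbounded frequencies. By Parseval the squared distance is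
a series dominated by `4 ‖v_i‖²`, and dominated convergence applies. -/
theorem continuous_diagEvolution : Continuous (diagEvolution B lam v) := by
  rw [continuous_iff_continuousAt]
  intro t
  rw [ContinuousAt, tendsto_iff_norm_sub_tendsto_zero]
  have hsq : Tendsto (fun s => ‖diagEvolution B lam v s - diagEvolution B lam v t‖ ^ 2) (𝓝 t)
      (𝓝 0) := by
    have e : ∀ s, ‖diagEvolution B lam v s - diagEvolution B lam v t‖ ^ 2
        = ∑' i, ‖(rot (lam i) s - rot (lam i) t) * B.repr v i‖ ^ 2 := fun s => by
      rw [← B.repr.norm_map]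
      have := lp.norm_rpow_eq_tsum (p := 2) (by norm_num)
        (B.repr (diagEvolution B lam v s - diagEvolution B lam v t))
      simp only [ENNReal.toReal_ofNat, Real.rpow_ofNat] at this
      rw [this]
      refine tsum_congr fun i => ?_
      rw [map_sub, lp.coeFn_sub, Pi.sub_apply, repr_diagEvolution, repr_diagEvolution, sub_mul]
    simp only [e]
    have hs : Summable fun i => ‖B.repr v i‖ ^ 2 := by
      have h := lp.memℓp (B.repr v)
      rw [memℓp_gen_iff (by norm_num)] at h
      simpa using h
    have := tendsto_tsum_of_dominated_convergence (𝓕 := 𝓝 t)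
      (f := fun s i => ‖(rot (lam i) s - rot (lam i) t) * B.repr v i‖ ^ 2) (g := fun _ => 0)
      (bound := fun i => 4 * ‖B.repr v i‖ ^ 2) (hs.mul_left 4) (fun i => ?_) ?_
    · simpa using this
    · have hc : Continuous fun s => ‖(rot (lam i) s - rot (lam i) t) * B.repr v i‖ ^ 2 :=
        (((continuous_rot _).sub continuous_const).mul continuous_const).norm.pow 2
      simpa using hc.tendsto t
    · refine Eventually.of_forall fun s i => ?_
      rw [Real.norm_eq_abs, abs_of_nonneg (by positivity), norm_mul, mul_pow]
      refine mul_le_mul_of_nonneg_right ?_ (by positivity)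
      have : ‖rot (lam i) s - rot (lam i) t‖ ≤ 2 := (norm_sub_le _ _).trans (by
        rw [norm_rot, norm_rot]; norm_num)
      nlinarith [norm_nonneg (rot (lam i) s - rot (lam i) t)]
  have := (Real.continuous_sqrt.tendsto 0).comp hsq
  simpa [Function.comp_def, Real.sqrt_sq] using this

/-- Differentiating a term brings down the factor `lam i`, which is absorbed by passing from the
coefficients of `φ` to those of `ψ`. The phases are unimodular, so the differentiated series is
dominated uniformly in time by a summable product of `ℓ²` sequences. -/
theorem hasDerivAt_inner_diagEvolution {φ ψ : E}
    (h : ∀ i, inner ℂ ψ (B i) = lam i * inner ℂ φ (B i)) (t : ℝ) :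
    HasDerivAt (fun s => inner ℂ φ (diagEvolution B lam v s))
      (-Complex.I * inner ℂ ψ (diagEvolution B lam v t)) t := by
  have e : ∀ (χ : E) (s : ℝ), HasSum (fun i => inner ℂ χ (B i) * (rot (lam i) s * B.repr v i))
      (inner ℂ χ (diagEvolution B lam v s)) := fun χ s => by
    have := B.hasSum_inner_mul_inner χ (diagEvolution B lam v s)
    refine this.congr_fun fun i => ?_
    rw [← repr_diagEvolution, B.repr_apply_apply]
  have hs : Summable fun i => ‖inner ℂ ψ (B i) * B.repr v i‖ := by
    have := (B.summable_inner_mul_inner ψ v).norm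
    simpa only [B.repr_apply_apply] using this
  have key := hasDerivAt_tsum (𝕜 := ℝ) (y₀ := t) hs
    (g := fun i s => inner ℂ φ (B i) * (rot (lam i) s * B.repr v i))
    (g' := fun i s => -Complex.I * (inner ℂ ψ (B i) * (rot (lam i) s * B.repr v i)))
    (fun i s => ?_) (fun i s => ?_) (e φ t).summable t
  · simp only [(e φ _).tsum_eq] at key
    rw [tsum_mul_left, (e ψ t).tsum_eq] at key
    exact key
  · convert! ((hasDerivAt_rot (lam i) s).mul_const (B.repr v i)).const_mul (inner ℂ φ (B i)) using 1
    rw [h i]; ring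
  · simp only [norm_mul, norm_neg, Complex.norm_I, norm_rot, one_mul, le_refl]

/-! ### The dislocated evolution in the eigenbasis -/

variable {b : ℝ} (hb : b ∈ Ioo (0 : ℝ) 1)

theorem IsInDomain.inner_eigunit {φ w : ℝ → ℂ} (h : IsInDomain b φ w) (l : {l : ℝ // IsEigen b l}) :
    inner ℂ (h.memLp.toLp _) (eigbasis hb l)
      = ((l : ℝ) : ℂ) * inner ℂ (h.memLp_fun.toLp _) (eigbasis hb l) := by
  rw [eigbasis_apply, eigunit, inner_smul_right, inner_smul_right, eigvec, inner_toLp, inner_toLp,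
    IsInDomain.pairing_eigfun hb h l.2]
  ring

theorem isSolution_diagEvolution {u₀ : ℝ → ℂ} (h₀ : MemLp u₀ 2 unitMeasure) :
    IsSolution b u₀ (diagEvolution (eigbasis hb) (fun l => l) (h₀.toLp u₀)) where
  continuous := continuous_diagEvolution _ _ _
  initial := by
    rw [diagEvolution_zero]; exact h₀.coeFn_toLp
  evolution φ w h t := by
    have := hasDerivAt_inner_diagEvolution (eigbasis hb) (fun l => l) (h₀.toLp u₀)
      (φ := h.memLp_fun.toLp _) (ψ := h.memLp.toLp _) (h.inner_eigunit hb) t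
    simpa only [inner_toLp_left] using this

/-- Eigenfunctions are admissible test functions, so each coordinate of a solution satisfies `f' =
-i l f`; by completeness the coordinates determine the solution. -/
theorem IsSolution.eq_diagEvolution {u₀ : ℝ → ℂ} (h₀ : MemLp u₀ 2 unitMeasure)
    {u : ℝ → UnitL2} (h : IsSolution b u₀ u) :
    u = diagEvolution (eigbasis hb) (fun l => l) (h₀.toLp u₀) := by
  funext t
  apply (eigbasis hb).repr.injective
  ext l
  have hu0 : u 0 = h₀.toLp u₀ := by
    refine Lp.ext ?_
    filter_upwards [h.initial, h₀.coeFn_toLp] with x h1 h2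
    rw [h1, h2]
  rw [repr_diagEvolution, ← hu0, HilbertBasis.repr_apply_apply, HilbertBasis.repr_apply_apply,
    eigbasis_apply, eigunit, inner_smul_left, inner_smul_left, mul_left_comm]
  congr 1
  refine eq_rot_mul (f := fun t => inner ℂ (eigvec b hb l) (u t)) (fun t => ?_) t
  have key := h.evolution _ _ (l.2.isInDomain hb) t
  simp only [eigvec, inner_toLp_left]
  convert! key using 2
  rw [← integral_const_mul]
  refine integral_congr_ae (ae_restrict_of_ae ?_)
  filter_upwards [ae_ne b] with x hx
  rw [l.2.quasiSol.deriv_quasi_ofReal hx]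
  simp only [map_mul, Complex.conj_ofReal]; ring

theorem existsUnique_isSolution (hb : b ∈ Ioo (0 : ℝ) 1) {u₀ : ℝ → ℂ} (h₀ : MemLp u₀ 2 unitMeasure) :
    ∃! u : ℝ → UnitL2, IsSolution b u₀ u :=
  ⟨_, isSolution_diagEvolution hb h₀, fun _ h => h.eq_diagEvolution hb h₀⟩

theorem hasSum_evolution (w : UnitL2) (t : ℝ) :
    HasSum (fun l : {l : ℝ // IsEigen b l} =>
      (rot l t * (inner ℂ (eigvec b hb l) w / (‖eigvec b hb l‖ : ℂ) ^ 2)) • eigvec b hb l)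
      (diagEvolution (eigbasis hb) (fun l => l) w t) := by
  refine (hasSum_diagEvolution (eigbasis hb) (fun l => l) w t).congr_fun fun l => ?_
  rw [HilbertBasis.repr_apply_apply, eigbasis_apply, eigunit, inner_smul_left, smul_smul,
    Complex.conj_ofReal]
  congr 1
  push_cast
  ring

end

section

/-! ### Pointwise convergence of one-sided Fourier series -/

/-- The character `exp(i π n y)`. -/
noncomputable def char (n : ℤ) (y : ℝ) : ℂ := Complex.exp (Complex.I * ((Real.pi * n * y : ℝ) : ℂ))

theorem char_add (n : ℤ) (x y : ℝ) : char n (x + y) = char n x * char n y := by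
  rw [char, char, char, ← Complex.exp_add]; congr 1; push_cast; ring

theorem char_add_left (m n : ℤ) (y : ℝ) : char (m + n) y = char m y * char n y := by
  rw [char, char, char, ← Complex.exp_add]; congr 1; push_cast; ring

theorem char_zero_left (y : ℝ) : char 0 y = 1 := by simp [char]

theorem char_zero_right (n : ℤ) : char n 0 = 1 := by simp [char]

theorem char_neg_mul (n : ℤ) (y : ℝ) : char (-n) y * char n y = 1 := by
  rw [← char_add_left, neg_add_cancel, char_zero_left]

theorem norm_char (n : ℤ) (y : ℝ) : ‖char n y‖ = 1 := by
  rw [char, mul_comm, Complex.norm_exp_ofReal_mul_I]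

theorem continuous_char (n : ℤ) : Continuous (char n) := by unfold char; fun_prop

theorem char_periodic (n : ℤ) : Function.Periodic (char n) 2 := fun y => by
  rw [char_add]
  have : char n 2 = 1 := by
    rw [char, Complex.exp_eq_one_iff]
    exact ⟨n, by push_cast; ring⟩
  rw [this, mul_one]

theorem fourierCoefficient_two (f : ℝ → ℂ) (n : ℤ) :
    fourierCoefficient 2 f n = 1 / 2 * ∫ y in (0 : ℝ)..2, f y * char (-n) y := by
  rw [fourierCoefficient, Complex.ofReal_ofNat]
  congr 1
  refine intervalIntegral.integral_congr fun y _ => ?_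
  simp only [char]
  congr 2
  push_cast; ring

theorem integral_char (n : ℤ) (hn : n ≠ 0) : ∫ s in (-1 : ℝ)..1, char n s = 0 := by
  have h : ∀ s : ℝ, char n s = Complex.exp ((Complex.I * Real.pi * n) * s) := fun s => by
    rw [char]; congr 1; push_cast; ring
  have hne : Complex.I * (Real.pi : ℂ) * (n : ℂ) ≠ 0 := by
    simp [Real.pi_ne_zero, hn]
  simp only [h]
  rw [integral_exp_mul_complex hne, ← h, ← h]
  have : char n 1 = char n (-1) := by
    have := char_periodic n (-1); norm_num at this; exact this
  rw [this, sub_self, zero_div]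

/-- The Riemann–Lebesgue lemma on the line, for `g` cut off to one period. The frequency of `char n`
is `n / 2` because the period is `2`. -/
theorem tendsto_integral_char {g : ℝ → ℂ} {l : Filter ℤ}
    (hl : Tendsto (fun n : ℤ => (n : ℝ) / 2) l (cocompact ℝ)) :
    Tendsto (fun n : ℤ => ∫ s in (-1 : ℝ)..1, g s * char (-n) s) l (𝓝 0) := by
  have h := (Real.tendsto_integral_exp_smul_cocompact (indicator (Ioc (-1) 1) g)).comp hl
  refine h.congr fun n => ?_
  rw [intervalIntegral.integral_of_le (by norm_num), ← integral_indicator measurableSet_Ioc]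
  refine integral_congr_ae (Eventually.of_forall fun s => ?_)
  simp only [indicator_apply]
  split_ifs
  · rw [Circle.smul_def, Real.fourierChar_apply, char, smul_eq_mul, mul_comm]
    congr 2
    push_cast; ring
  · simp

/-- Jordan's inequality for `sin(πs/2)`: the denominator of the Dini quotient has in one period only
a simple zero at `0`. -/
theorem two_mul_abs_le_norm_char_sub_one {s : ℝ} (hs : |s| ≤ 1) : 2 * |s| ≤ ‖char 1 s - 1‖ := by
  have h : char 1 s = Complex.exp (Complex.I * ((Real.pi * s : ℝ) : ℂ)) := by
    rw [char]; congr 2; push_cast; ring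
  rw [h, Complex.norm_exp_I_mul_ofReal_sub_one, norm_mul, Real.norm_eq_abs, Real.norm_eq_abs, abs_two]
  refine mul_le_mul_of_nonneg_left ?_ zero_le_two
  have h2 : |Real.pi * s / 2| ≤ Real.pi / 2 := by
    rw [abs_div, abs_mul, abs_two, abs_of_pos Real.pi_pos]
    have := mul_le_mul_of_nonneg_left hs Real.pi_pos.le
    linarith
  have := Real.mul_abs_le_abs_sin h2
  rw [abs_div, abs_mul, abs_two, abs_of_pos Real.pi_pos] at this
  refine le_trans (le_of_eq ?_) this
  field_simp

theorem exists_bound_of_isBigO {f : ℝ → ℂ} {y₀ M : ℝ} (hM : ∀ y, ‖f y‖ ≤ M)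
    (h : (fun y => f y - f y₀) =O[𝓝 y₀] fun y => y - y₀) :
    ∃ C, ∀ s, ‖f (y₀ + s) - f y₀‖ ≤ C * |s| := by
  obtain ⟨K, hK⟩ := h.bound
  obtain ⟨δ, hδ, H⟩ := Metric.eventually_nhds_iff.1 hK
  have hM0 : 0 ≤ M := (norm_nonneg _).trans (hM 0)
  refine ⟨max K (2 * M / δ), fun s => ?_⟩
  rcases lt_or_ge |s| δ with hs | hs
  · have := H (y := y₀ + s) (by simpa [Real.dist_eq] using hs)
    simp only [add_sub_cancel_left, Real.norm_eq_abs] at this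
    exact this.trans (mul_le_mul_of_nonneg_right (le_max_left _ _) (abs_nonneg _))
  · refine ((norm_sub_le _ _).trans (add_le_add (hM _) (hM _))).trans ?_
    refine le_trans ?_ (mul_le_mul_of_nonneg_right (le_max_right _ _) (abs_nonneg _))
    rw [div_mul_eq_mul_div, le_div_iff₀ hδ]
    nlinarith

/-- Dini's test for the two halves of a Fourier series. -/
theorem exists_tendsto_half_series {f : ℝ → ℂ} {y₀ M : ℝ} (hf : Function.Periodic f 2)
    (hm : AEStronglyMeasurable f volume) (hM : ∀ y, ‖f y‖ ≤ M)
    (h : (fun y => f y - f y₀) =O[𝓝 y₀] fun y => y - y₀) :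
    ∃ P Q : ℂ, Tendsto (fun N : ℕ => ∑ n ∈ Finset.Icc 1 N,
        fourierCoefficient 2 f n * char n y₀) atTop (𝓝 P) ∧
      Tendsto (fun N : ℕ => ∑ n ∈ Finset.Icc 1 N,
        fourierCoefficient 2 f (-(n : ℤ)) * char (-(n : ℤ)) y₀) atTop (𝓝 Q) ∧
      fourierCoefficient 2 f 0 + P + Q = f y₀ := by
  obtain ⟨C, hC⟩ := exists_bound_of_isBigO hM h
  have hC0 : 0 ≤ C := by simpa using (norm_nonneg _).trans (hC 1)
  -- The Dini quotient, bounded because its numerator is `O(s)`. As `g` times `char 1 s - 1` is the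
  -- increment of `f`, each term with `n ≠ 0` becomes `G (n - 1) - G n`. Both half series telescope,
  -- and Riemann–Lebesgue removes the far end.
  set g : ℝ → ℂ := fun s => (f (y₀ + s) - f y₀) / (char 1 s - 1) with hg
  have hms : AEStronglyMeasurable (fun s => f (y₀ + s)) volume :=
    hm.comp_measurePreserving (measurePreserving_add_left volume y₀)
  have hgm : AEStronglyMeasurable g volume :=
    ((hms.sub aestronglyMeasurable_const).aemeasurable.div
      ((continuous_char 1).sub continuous_const).aemeasurable).aestronglyMeasurable
  have hne : ∀ s, |s| ≤ 1 → s ≠ 0 → char 1 s - 1 ≠ 0 := fun s h1 h2 => by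
    have := two_mul_abs_le_norm_char_sub_one h1
    exact norm_pos_iff.1 (lt_of_lt_of_le (by positivity) this)
  have hgb : ∀ s, |s| ≤ 1 → ‖g s‖ ≤ C := fun s hs => by
    rcases eq_or_ne s 0 with rfl | h0
    · simpa [hg] using hC0
    · rw [hg, norm_div, div_le_iff₀ (norm_pos_iff.2 (hne s hs h0))]
      refine (hC s).trans (mul_le_mul_of_nonneg_left ?_ hC0)
      linarith [two_mul_abs_le_norm_char_sub_one hs, abs_nonneg s]
  have habs : ∀ {s : ℝ}, s ∈ uIoc (-1 : ℝ) 1 → |s| ≤ 1 := fun hs => by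
    rw [uIoc_of_le (by norm_num)] at hs; exact abs_le.2 ⟨hs.1.le, hs.2⟩
  have hgi : ∀ n, IntervalIntegrable (fun s => g s * char n s) volume (-1) 1 := fun n => by
    refine (intervalIntegrable_const (c := C)).mono_fun
      (hgm.mul (continuous_char n).aestronglyMeasurable).restrict ?_
    refine (ae_restrict_iff' measurableSet_uIoc).2 (Eventually.of_forall fun s hs => ?_)
    beta_reduce
    rw [norm_mul, norm_char, mul_one, Real.norm_eq_abs, abs_of_nonneg hC0]
    exact hgb s (habs hs)
  set G : ℤ → ℂ := fun n => 1 / 2 * ∫ s in (-1 : ℝ)..1, g s * char (-n) s with hG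
  have hfi : ∀ n, IntervalIntegrable (fun s => f (y₀ + s) * char n s) volume (-1) 1 := fun n => by
    refine (intervalIntegrable_const (c := M)).mono_fun
      (hms.mul (continuous_char n).aestronglyMeasurable).restrict ?_
    refine Eventually.of_forall fun s => ?_
    beta_reduce
    rw [norm_mul, norm_char, mul_one]
    exact (hM _).trans (le_abs_self _)
  have hshift : ∀ n, fourierCoefficient 2 f n * char n y₀
      = 1 / 2 * ∫ s in (-1 : ℝ)..1, f (y₀ + s) * char (-n) s := fun n => by
    have hp : Function.Periodic (fun y => f y * char (-n) y) 2 := hf.mul (char_periodic (-n))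
    have h1 := hp.intervalIntegral_add_eq 0 (y₀ - 1)
    rw [zero_add] at h1
    rw [fourierCoefficient_two, h1]
    have h2 : ∫ s in (-1 : ℝ)..1, f (y₀ + s) * char (-n) (y₀ + s)
        = ∫ y in y₀ - 1..y₀ - 1 + 2, f y * char (-n) y := by
      rw [intervalIntegral.integral_comp_add_left (fun y => f y * char (-n) y)]
      congr 1; ring
    rw [← h2, mul_assoc, ← intervalIntegral.integral_mul_const]
    congr 1
    refine intervalIntegral.integral_congr fun s _ => ?_
    rw [char_add]
    linear_combination (f (y₀ + s) * char (-n) s) * char_neg_mul n y₀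
  have hdiff : ∀ n, G (n - 1) - G n
      = 1 / 2 * ∫ s in (-1 : ℝ)..1, (f (y₀ + s) - f y₀) * char (-n) s := fun n => by
    rw [hG, ← mul_sub, ← intervalIntegral.integral_sub (hgi _) (hgi _)]
    congr 1
    refine intervalIntegral.integral_congr fun s hs => ?_
    have hs' : |s| ≤ 1 := by
      rw [uIcc_of_le (by norm_num)] at hs; exact abs_le.2 ⟨hs.1, hs.2⟩
    rw [show -(n - 1) = 1 + -n by ring, char_add_left]
    rcases eq_or_ne s 0 with rfl | h0
    · simp [hg]
    · have : g s * (char 1 s - 1) = f (y₀ + s) - f y₀ := div_mul_cancel₀ _ (hne s hs' h0)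
      rw [← this]; ring
  have hci : ∀ n, IntervalIntegrable (fun s => f y₀ * char n s) volume (-1) 1 := fun n =>
    (continuous_const.mul (continuous_char n)).intervalIntegrable _ _
  have hrec : ∀ n, n ≠ 0 → fourierCoefficient 2 f n * char n y₀ = G (n - 1) - G n := fun n hn => by
    rw [hshift, hdiff]
    simp only [sub_mul]
    rw [intervalIntegral.integral_sub (hfi _) (hci _), intervalIntegral.integral_const_mul,
      integral_char _ (neg_ne_zero.2 hn)]
    simp
  -- For `n = 0` the mean of the constant `f y₀` does not vanish; this is where the value of `f`
  -- enters the sum.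
  have hrec0 : fourierCoefficient 2 f 0 = f y₀ + (G (-1) - G 0) := by
    have h1 := hshift 0
    have h2 := hdiff 0
    rw [char_zero_left, mul_one] at h1
    rw [zero_sub] at h2
    simp only [sub_mul] at h2
    rw [intervalIntegral.integral_sub (hfi _) (hci _)] at h2
    rw [h1, h2]
    simp only [neg_zero, char_zero_left, mul_one]
    rw [intervalIntegral.integral_const]
    simp only [Complex.real_smul]
    push_cast; ring
  have hcoc : cocompact ℝ = atBot ⊔ atTop := cocompact_eq_atBot_atTop
  have htop : Tendsto G atTop (𝓝 0) := by
    simpa [hG] using (tendsto_integral_char (g := g) (l := atTop) (by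
      rw [hcoc]
      exact (tendsto_intCast_atTop_atTop.atTop_div_const two_pos).mono_right le_sup_right)).const_mul
        (1 / 2 : ℂ)
  have hbot : Tendsto G atBot (𝓝 0) := by
    simpa [hG] using (tendsto_integral_char (g := g) (l := atBot) (by
      rw [hcoc]
      exact ((tendsto_intCast_atBot_iff (R := ℝ).2 tendsto_id).atBot_div_const two_pos).mono_right
        le_sup_left)).const_mul (1 / 2 : ℂ)
  have hsumP : ∀ N : ℕ, ∑ n ∈ Finset.Icc 1 N, fourierCoefficient 2 f n * char n y₀
      = G 0 - G N := fun N => by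
    induction N with
    | zero => simp
    | succ N ih =>
      rw [Finset.sum_Icc_succ_top (by omega), ih, hrec _ (by positivity)]
      push_cast
      rw [add_sub_cancel_right]; ring
  have hsumQ : ∀ N : ℕ, ∑ n ∈ Finset.Icc 1 N, fourierCoefficient 2 f (-(n : ℤ)) * char (-(n : ℤ)) y₀
      = G (-(N : ℤ) - 1) - G (-1) := fun N => by
    induction N with
    | zero => simp
    | succ N ih =>
      rw [Finset.sum_Icc_succ_top (by omega), ih, hrec _ (by push_cast; omega)]
      push_cast
      rw [show -((N : ℤ) + 1) = -(N : ℤ) - 1 by ring]; ring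
  refine ⟨G 0, -G (-1), ?_, ?_, by rw [hrec0]; ring⟩
  · simp only [hsumP]
    simpa using tendsto_const_nhds.sub (htop.comp tendsto_natCast_atTop_atTop)
  · simp only [hsumQ]
    have : Tendsto (fun N : ℕ => -(N : ℤ) - 1) atTop atBot :=
      tendsto_atBot_add_const_right _ _ (tendsto_neg_atTop_atBot.comp tendsto_natCast_atTop_atTop)
    simpa using (hbot.comp this).sub (tendsto_const_nhds (x := G (-1)))

theorem hilbertPartialSum_two (f : ℝ → ℂ) (N : ℕ) (y : ℝ) :
    hilbertPartialSum 2 f N y = Complex.I *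
      ((∑ n ∈ Finset.Icc 1 N, fourierCoefficient 2 f (-(n : ℤ)) * char (-(n : ℤ)) y)
        - ∑ n ∈ Finset.Icc 1 N, fourierCoefficient 2 f n * char n y) := by
  rw [hilbertPartialSum, ← Finset.sum_sub_distrib]
  congr 1
  refine Finset.sum_congr rfl fun n _ => ?_
  have e1 : Complex.exp (-Complex.I * ((2 * Real.pi / 2 * (n : ℝ) * y : ℝ) : ℂ))
      = char (-(n : ℤ)) y := by
    rw [char]; congr 1; push_cast; ring
  have e2 : Complex.exp (Complex.I * ((2 * Real.pi / 2 * (n : ℝ) * y : ℝ) : ℂ)) = char n y := by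
    rw [char]; congr 1; push_cast; ring
  rw [e1, e2]

/-- Where the Dini condition holds, the series of the Hilbert transform converges, and the analytic
half of the Fourier series sums to `(f - f̂(0) + i H f) / 2`. -/
theorem tendsto_half_series {f : ℝ → ℂ} {y₀ M : ℝ} (hf : Function.Periodic f 2)
    (hm : AEStronglyMeasurable f volume) (hM : ∀ y, ‖f y‖ ≤ M)
    (h : (fun y => f y - f y₀) =O[𝓝 y₀] fun y => y - y₀) :
    Tendsto (fun N : ℕ => hilbertPartialSum 2 f N y₀) atTop (𝓝 (hilbertTransform 2 f y₀)) ∧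
      Tendsto (fun N : ℕ => ∑ n ∈ Finset.Icc 1 N, fourierCoefficient 2 f n * char n y₀) atTop
        (𝓝 ((f y₀ - fourierCoefficient 2 f 0 + Complex.I * hilbertTransform 2 f y₀) / 2)) := by
  obtain ⟨P, Q, hP, hQ, hPQ⟩ := exists_tendsto_half_series hf hm hM h
  have hH : Tendsto (fun N : ℕ => hilbertPartialSum 2 f N y₀) atTop (𝓝 (Complex.I * (Q - P))) := by
    simp only [hilbertPartialSum_two]
    exact (hQ.sub hP).const_mul _
  have hH' : hilbertTransform 2 f y₀ = Complex.I * (Q - P) := hH.limUnder_eq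
  refine ⟨hH' ▸ hH, ?_⟩
  convert! hP using 2
  rw [hH', ← hPQ]
  linear_combination (Q - P) / 2 * Complex.I_sq

end

section

/-! ### One-sided Lipschitz behaviour -/

/-- Along the filter `l`, `f` approaches some value at a Lipschitz rate in the distance to `y`. -/
def LipAlong (f : ℝ → ℂ) (l : Filter ℝ) (y : ℝ) : Prop :=
  ∃ c : ℂ, (fun z => f z - c) =O[l] fun z => z - y

namespace LipAlong

variable {f g : ℝ → ℂ} {l : Filter ℝ} {y : ℝ}

theorem congr (hf : LipAlong f l y) (h : f =ᶠ[l] g) : LipAlong g l y := by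
  obtain ⟨c, hc⟩ := hf
  exact ⟨c, hc.congr' (by filter_upwards [h] with z hz; rw [hz]) EventuallyEq.rfl⟩

theorem of_lipschitz {K : ℝ≥0} (hf : LipschitzWith K f) (l : Filter ℝ) (y : ℝ) : LipAlong f l y :=
  ⟨f y, Asymptotics.IsBigO.of_bound K (Eventually.of_forall fun z => by
    simpa [dist_eq_norm] using hf.dist_le_mul z y)⟩

theorem const_mul (hf : LipAlong f l y) (a : ℂ) : LipAlong (fun z => a * f z) l y := by
  obtain ⟨c, hc⟩ := hf
  exact ⟨a * c, (hc.const_mul_left a).congr_left fun z => by ring⟩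

theorem const_add (hf : LipAlong f l y) (a : ℂ) : LipAlong (fun z => a + f z) l y := by
  obtain ⟨c, hc⟩ := hf
  exact ⟨a + c, hc.congr_left fun z => by ring⟩

theorem mul_differentiable (hf : LipAlong f l y) {m : ℝ → ℂ} (hm : DifferentiableAt ℝ m y)
    (hl : l ≤ 𝓝 y) : LipAlong (fun z => m z * f z) l y := by
  obtain ⟨c, hc⟩ := hf
  refine ⟨m y * c, ?_⟩
  have h1 : (fun z => m z * (f z - c)) =O[l] fun z => z - y := by
    have hb : m =O[l] fun _ => (1 : ℝ) := (hm.continuousAt.isBigO_one ℝ).mono hl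
    simpa using hb.mul hc
  have h2 : (fun z => (m z - m y) * c) =O[l] fun z => z - y := by
    have hb := (hm.isBigO_sub).mono hl
    simpa [mul_comm] using hb.const_mul_left c
  exact (h1.add h2).congr_left fun z => by ring

theorem comp_affine {l' : Filter ℝ} {a d : ℝ} (hf : LipAlong f l' (a * y + d))
    (h : Tendsto (fun z => a * z + d) l l') : LipAlong (fun z => f (a * z + d)) l y := by
  obtain ⟨c, hc⟩ := hf
  refine ⟨c, (hc.comp_tendsto h).trans ?_⟩
  refine Asymptotics.IsBigO.of_bound |a| (Eventually.of_forall fun z => ?_)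
  simp only [Function.comp_apply, Real.norm_eq_abs]
  rw [← abs_mul]; apply le_of_eq; congr 1; ring

theorem eq_of_continuousAt {c : ℂ} (hl : l ≤ 𝓝 y) [l.NeBot]
    (hc : (fun z => f z - c) =O[l] fun z => z - y) (h : ContinuousAt f y) : c = f y := by
  have h1 : Tendsto (fun z => z - y) l (𝓝 0) := by
    have : Tendsto (fun z => z - y) (𝓝 y) (𝓝 (y - y)) := tendsto_id.sub_const y
    rw [sub_self] at this
    exact this.mono_left hl
  have h2 : Tendsto (fun z => f z - c) l (𝓝 0) := hc.trans_tendsto h1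
  have h3 : Tendsto (fun z => f z - c) l (𝓝 (f y - c)) := (h.mono_left hl).sub_const c
  exact (sub_eq_zero.1 (tendsto_nhds_unique h3 h2)).symm

/-- At a point of continuity both one-sided limits are the value of `f`, so the two one-sided rates
merge into Dini's condition. -/
theorem isBigO_of_continuousAt (h₁ : LipAlong f (𝓝[<] y) y) (h₂ : LipAlong f (𝓝[>] y) y)
    (h : ContinuousAt f y) : (fun z => f z - f y) =O[𝓝 y] fun z => z - y := by
  obtain ⟨c₁, hc₁⟩ := h₁
  obtain ⟨c₂, hc₂⟩ := h₂
  rw [eq_of_continuousAt nhdsWithin_le_nhds hc₁ h] at hc₁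
  rw [eq_of_continuousAt nhdsWithin_le_nhds hc₂ h] at hc₂
  have h3 : (fun z => f z - f y) =O[pure y] fun z => z - y := by
    refine Asymptotics.IsBigO.of_bound 1 ?_
    simp
  have := (hc₁.sup hc₂).sup h3
  rwa [nhdsLT_sup_nhdsGT, nhdsNE_sup_pure] at this

end LipAlong

/-! ### Piecewise Lipschitz functions -/

namespace PiecewiseLipschitz

variable {u : ℝ → ℂ}

/-- Every piece extends to a globally Lipschitz function. -/
theorem exists_extension (hu : PiecewiseLipschitz u) :
    ∃ (k : ℕ) (x : Fin (k + 2) → ℝ), StrictMono x ∧ x 0 = 0 ∧ x (Fin.last (k + 1)) = 1 ∧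
      ∀ j : Fin (k + 1), ∃ (K : ℝ≥0) (g : ℝ → ℂ), LipschitzWith K g ∧
        EqOn u g (Ioo (x j.castSucc) (x j.succ)) := by
  obtain ⟨k, x, h1, h2, h3, h4⟩ := hu
  refine ⟨k, x, h1, h2, h3, fun j => ?_⟩
  obtain ⟨K, hK⟩ := h4 j
  obtain ⟨g, hg, hg'⟩ := hK.extend_finite_dimension
  exact ⟨_, g, hg, hg'⟩

/-- Otherwise induction along the nodes would put every node at or below `y`, including the last
one. -/
theorem exists_piece_right {k : ℕ} {x : Fin (k + 2) → ℝ} (h0 : x 0 = 0)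
    (h1 : x (Fin.last (k + 1)) = 1) {y : ℝ} (hy : y ∈ Ico (0 : ℝ) 1) :
    ∃ j : Fin (k + 1), x j.castSucc ≤ y ∧ y < x j.succ := by
  by_contra! H
  have : ∀ j : Fin (k + 2), x j ≤ y := fun j => by
    induction j using Fin.induction with
    | zero => rw [h0]; exact hy.1
    | succ j ih => exact H j ih
  exact absurd (this (Fin.last _)) (by rw [h1]; exact hy.2.not_ge)

theorem exists_piece_left {k : ℕ} {x : Fin (k + 2) → ℝ} (h0 : x 0 = 0)
    (h1 : x (Fin.last (k + 1)) = 1) {y : ℝ} (hy : y ∈ Ioc (0 : ℝ) 1) :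
    ∃ j : Fin (k + 1), x j.castSucc < y ∧ y ≤ x j.succ := by
  by_contra! H
  have : ∀ j : Fin (k + 2), x j < y := fun j => by
    induction j using Fin.induction with
    | zero => rw [h0]; exact hy.1
    | succ j ih => exact H j ih
  exact absurd (this (Fin.last _)) (by rw [h1]; exact hy.2.not_gt)

theorem lipAlong_right (hu : PiecewiseLipschitz u) {y : ℝ} (hy : y ∈ Ico (0 : ℝ) 1) :
    LipAlong u (𝓝[>] y) y := by
  obtain ⟨k, x, -, h0, h1, h⟩ := hu.exists_extension
  obtain ⟨j, hj1, hj2⟩ := exists_piece_right h0 h1 hy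
  obtain ⟨K, g, hg, hug⟩ := h j
  refine (LipAlong.of_lipschitz hg _ y).congr ?_
  filter_upwards [Ioo_mem_nhdsGT hj2] with z hz
  exact (hug ⟨hj1.trans_lt hz.1, hz.2⟩).symm

theorem lipAlong_left (hu : PiecewiseLipschitz u) {y : ℝ} (hy : y ∈ Ioc (0 : ℝ) 1) :
    LipAlong u (𝓝[<] y) y := by
  obtain ⟨k, x, -, h0, h1, h⟩ := hu.exists_extension
  obtain ⟨j, hj1, hj2⟩ := exists_piece_left h0 h1 hy
  obtain ⟨K, g, hg, hug⟩ := h j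
  refine (LipAlong.of_lipschitz hg _ y).congr ?_
  filter_upwards [Ioo_mem_nhdsLT hj1] with z hz
  exact (hug ⟨hz.1, hz.2.trans_le hj2⟩).symm

theorem exists_finite (hu : PiecewiseLipschitz u) :
    ∃ F : Set ℝ, F.Finite ∧ ∀ y ∈ Ioo (0 : ℝ) 1, y ∉ F → ContinuousAt u y := by
  obtain ⟨k, x, -, h0, h1, h⟩ := hu.exists_extension
  refine ⟨range x, finite_range x, fun y hy hyF => ?_⟩
  obtain ⟨j, hj1, hj2⟩ := exists_piece_right h0 h1 (Ioo_subset_Ico_self hy)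
  have hj1' : x j.castSucc < y := lt_of_le_of_ne hj1 fun h => hyF ⟨_, h⟩
  obtain ⟨K, g, hg, hug⟩ := h j
  refine hg.continuous.continuousAt.congr ?_
  filter_upwards [Ioo_mem_nhds hj1' hj2] with z hz using (hug hz).symm

/-- The values at the nodes are unrelated to the pieces, but there are finitely many; on each piece
the Lipschitz extension is continuous on a compact interval. -/
theorem exists_bound (hu : PiecewiseLipschitz u) : ∃ M : ℝ, ∀ y ∈ Icc (0 : ℝ) 1, ‖u y‖ ≤ M := by
  obtain ⟨k, x, -, h0, h1, h⟩ := hu.exists_extension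
  choose K g hg hug using h
  have hb : Bornology.IsBounded (u '' range x ∪ ⋃ j, g j '' Icc 0 1) := by
    refine Bornology.IsBounded.union ((finite_range x).image u).isBounded ?_
    exact Bornology.isBounded_iUnion.2 fun j =>
      (isCompact_Icc.image (hg j).continuous).isBounded
  obtain ⟨M, hM⟩ := hb.exists_norm_le
  refine ⟨M, fun y hy => hM _ ?_⟩
  by_cases hyF : y ∈ range x
  · exact Or.inl ⟨y, hyF, rfl⟩
  · have hy1 : y < 1 := lt_of_le_of_ne hy.2 fun h => hyF ⟨_, h1.trans h.symm⟩
    obtain ⟨j, hj1, hj2⟩ := exists_piece_right h0 h1 ⟨hy.1, hy1⟩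
    have hj1' : x j.castSucc < y := lt_of_le_of_ne hj1 fun h => hyF ⟨_, h⟩
    exact Or.inr (mem_iUnion.2 ⟨j, y, hy, (hug j ⟨hj1', hj2⟩).symm⟩)

theorem aestronglyMeasurable_of_continuousAt {f : ℝ → ℂ} {s F : Set ℝ} (hs : MeasurableSet s)
    (hF : F.Countable) (h : ∀ y ∈ s, y ∉ F → ContinuousAt f y) :
    AEStronglyMeasurable f (volume.restrict s) := by
  have h1 : AEStronglyMeasurable f (volume.restrict (s \ F)) :=
    ContinuousOn.aestronglyMeasurable
      (fun y hy => (h y hy.1 hy.2).continuousWithinAt) (hs.diff hF.measurableSet)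
  rwa [Measure.restrict_congr_set (sdiff_null_ae_eq_self (hF.measure_zero _))] at h1

theorem memLp (hu : PiecewiseLipschitz u) : MemLp u 2 unitMeasure := by
  obtain ⟨M, hM⟩ := hu.exists_bound
  obtain ⟨F, hF, h⟩ := hu.exists_finite
  refine MemLp.of_bound (aestronglyMeasurable_of_continuousAt measurableSet_Ioo hF.countable h) M ?_
  rw [ae_unitMeasure]
  exact Eventually.of_forall fun x hx => hM x (Ioo_subset_Icc_self hx)

/-- Near `b` this is the one-sided Lipschitz rate, and at distance at least `δ` boundedness
suffices. The linear bound on all of `(b,1)` is what gets integrated against the exponential tails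
of the modes. -/
theorem exists_rightLim_bound (hu : PiecewiseLipschitz u) {b : ℝ} (hb : b ∈ Ioo (0 : ℝ) 1) :
    ∃ C : ℝ, 0 ≤ C ∧ ∀ y ∈ Ioo b 1, ‖u y - Function.rightLim u b‖ ≤ C * (y - b) := by
  obtain ⟨c, hc⟩ := hu.lipAlong_right (Ioo_subset_Ico_self hb)
  have hlim : Tendsto u (𝓝[>] b) (𝓝 c) := by
    have h1 : Tendsto (fun z => z - b) (𝓝[>] b) (𝓝 0) := by
      have : Tendsto (fun z => z - b) (𝓝 b) (𝓝 (b - b)) := tendsto_id.sub_const b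
      rw [sub_self] at this
      exact this.mono_left nhdsWithin_le_nhds
    have := (hc.trans_tendsto h1).add_const c
    simpa using this
  rw [rightLim_eq_of_tendsto hlim]
  obtain ⟨M, hM⟩ := hu.exists_bound
  obtain ⟨K, hK⟩ := hc.bound
  rw [eventually_nhdsWithin_iff, Metric.eventually_nhds_iff] at hK
  obtain ⟨δ, hδ, H⟩ := hK
  have hM0 : 0 ≤ M := (norm_nonneg _).trans (hM 0 (by simp))
  refine ⟨max K ((M + ‖c‖) / δ), le_max_of_le_right (by positivity), fun y hy => ?_⟩
  have hyb : 0 < y - b := sub_pos.2 hy.1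
  rcases lt_or_ge (y - b) δ with hs | hs
  · have := H (y := y) (by rwa [Real.dist_eq, abs_of_pos hyb]) hy.1
    rw [Real.norm_eq_abs, abs_of_pos hyb] at this
    exact this.trans (mul_le_mul_of_nonneg_right (le_max_left _ _) hyb.le)
  · refine (norm_sub_le _ _).trans ?_
    refine le_trans ?_ (mul_le_mul_of_nonneg_right (le_max_right _ _) hyb.le)
    rw [div_mul_eq_mul_div, le_div_iff₀ hδ]
    have := hM y ⟨(hb.1.trans hy.1).le, hy.2.le⟩
    nlinarith [norm_nonneg c]

end PiecewiseLipschitz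

/-! ### The profile -/

theorem profile_periodic (b : ℝ) (u : ℝ → ℂ) : Function.Periodic (profile b u) 2 := fun y => by
  rw [profile, profile, add_div, div_self two_ne_zero, Int.fract_add_one]

/-- The reduction of `y` modulo `2` to `[0,2)`. -/
noncomputable def redTwo (y : ℝ) : ℝ := 2 * Int.fract (y / 2)

theorem redTwo_mem (y : ℝ) : redTwo y ∈ Ico (0 : ℝ) 2 :=
  ⟨by have := Int.fract_nonneg (y / 2); rw [redTwo]; linarith,
    by have := Int.fract_lt_one (y / 2); rw [redTwo]; linarith⟩

theorem redTwo_add_floor (y : ℝ) : redTwo y + 2 * ⌊y / 2⌋ = y := by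
  have := Int.fract_add_floor (y / 2)
  rw [redTwo]; linarith

theorem profile_eq (b : ℝ) (u : ℝ → ℂ) {y t : ℝ} {m : ℤ} (h : y = t + 2 * m)
    (ht : t ∈ Ico (0 : ℝ) 2) : profile b u y = profileCore b u t := by
  have : Int.fract (y / 2) = t / 2 := by
    rw [Int.fract_eq_iff]
    exact ⟨by linarith [ht.1], by linarith [ht.2], m, by rw [h]; ring⟩
  rw [profile, this]
  congr 1; ring

/-! ### One-sided regularity, boundedness and continuity points of the profile -/

section

variable {b : ℝ} {u : ℝ → ℂ}

/-- The `+ 0` gives the argument of `u` the affine shape expected by `LipAlong.comp_affine`. -/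
theorem profileCore_of_le {y : ℝ} (h : y ≤ 1) : profileCore b u y =
    Complex.exp (-Complex.I * ((Real.pi * y / 4 : ℝ) : ℂ)) *
      (Function.rightLim u b + Complex.I * u (b * y + 0)) := by
  rw [profileCore, if_pos h, add_zero]

theorem profileCore_of_gt {y : ℝ} (h : 1 < y) : profileCore b u y =
    Complex.exp (-Complex.I * ((Real.pi * y / 4 : ℝ) : ℂ)) *
      (Complex.I * Function.rightLim u b + u (-b * y + 2 * b)) := by
  rw [profileCore, if_neg h.not_ge]
  congr 3; ring

theorem differentiable_twist :
    Differentiable ℝ fun y : ℝ => Complex.exp (-Complex.I * ((Real.pi * y / 4 : ℝ) : ℂ)) := by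
  intro y
  have h : HasDerivAt (fun y : ℝ => Real.pi * y / 4) (Real.pi * 1 / 4) y :=
    ((hasDerivAt_id y).const_mul _).div_const _
  exact (h.ofReal_comp.const_mul (-Complex.I)).cexp.differentiableAt

theorem profileCore_lipAlong_right (hb : b ∈ Ioo (0 : ℝ) 1) (hu : PiecewiseLipschitz u) {t : ℝ}
    (ht : t ∈ Ico (0 : ℝ) 2) : LipAlong (profileCore b u) (𝓝[>] t) t := by
  rcases lt_or_ge t 1 with h1 | h1
  · have hm : b * t + 0 ∈ Ico (0 : ℝ) 1 := by
      have := mul_nonneg hb.1.le ht.1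
      exact ⟨by linarith, by nlinarith [hb.1, hb.2]⟩
    have hφ : Tendsto (fun z => b * z + 0) (𝓝[>] t) (𝓝[>] (b * t + 0)) := by
      refine tendsto_nhdsWithin_iff.2 ⟨?_, ?_⟩
      · exact ((by fun_prop : Continuous fun z : ℝ => b * z + 0).tendsto t).mono_left
          nhdsWithin_le_nhds
      · filter_upwards [self_mem_nhdsWithin] with z hz
        have := mul_lt_mul_of_pos_left (mem_Ioi.1 hz) hb.1
        simpa using this
    refine LipAlong.congr ((((hu.lipAlong_right hm).comp_affine hφ).const_mul Complex.I).const_add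
      (Function.rightLim u b) |>.mul_differentiable (differentiable_twist t) nhdsWithin_le_nhds) ?_
    filter_upwards [Ioo_mem_nhdsGT h1] with z hz
    rw [profileCore_of_le hz.2.le]
  · have hm : -b * t + 2 * b ∈ Ioc (0 : ℝ) 1 :=
      ⟨by nlinarith [hb.1, hb.2, ht.2], by nlinarith [hb.1, hb.2, ht.2]⟩
    -- The second half of the profile is reflected, so right neighbourhoods become left ones.
    have hφ : Tendsto (fun z => -b * z + 2 * b) (𝓝[>] t) (𝓝[<] (-b * t + 2 * b)) := by
      refine tendsto_nhdsWithin_iff.2 ⟨?_, ?_⟩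
      · exact ((by fun_prop : Continuous fun z : ℝ => -b * z + 2 * b).tendsto t).mono_left
          nhdsWithin_le_nhds
      · filter_upwards [self_mem_nhdsWithin] with z hz
        have := mul_lt_mul_of_pos_left (mem_Ioi.1 hz) hb.1
        simp only [mem_Iio]; linarith
    refine LipAlong.congr (((hu.lipAlong_left hm).comp_affine hφ).const_add
      (Complex.I * Function.rightLim u b) |>.mul_differentiable (differentiable_twist t)
      nhdsWithin_le_nhds) ?_
    filter_upwards [self_mem_nhdsWithin] with z hz
    rw [profileCore_of_gt (h1.trans_lt hz)]

theorem profileCore_lipAlong_left (hb : b ∈ Ioo (0 : ℝ) 1) (hu : PiecewiseLipschitz u) {t : ℝ}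
    (ht : t ∈ Ioc (0 : ℝ) 2) : LipAlong (profileCore b u) (𝓝[<] t) t := by
  rcases le_or_gt t 1 with h1 | h1
  · have hm : b * t + 0 ∈ Ioc (0 : ℝ) 1 := by
      have := mul_pos hb.1 ht.1
      exact ⟨by linarith, by nlinarith [hb.1, hb.2]⟩
    have hφ : Tendsto (fun z => b * z + 0) (𝓝[<] t) (𝓝[<] (b * t + 0)) := by
      refine tendsto_nhdsWithin_iff.2 ⟨?_, ?_⟩
      · exact ((by fun_prop : Continuous fun z : ℝ => b * z + 0).tendsto t).mono_left
          nhdsWithin_le_nhds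
      · filter_upwards [self_mem_nhdsWithin] with z hz
        have := mul_lt_mul_of_pos_left (mem_Iio.1 hz) hb.1
        simpa using this
    refine LipAlong.congr ((((hu.lipAlong_left hm).comp_affine hφ).const_mul Complex.I).const_add
      (Function.rightLim u b) |>.mul_differentiable (differentiable_twist t) nhdsWithin_le_nhds) ?_
    filter_upwards [self_mem_nhdsWithin] with z hz
    rw [profileCore_of_le ((mem_Iio.1 hz).le.trans h1)]
  · have hm : -b * t + 2 * b ∈ Ico (0 : ℝ) 1 :=
      ⟨by nlinarith [hb.1, hb.2, ht.2], by nlinarith [hb.1, hb.2, ht.2]⟩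
    have hφ : Tendsto (fun z => -b * z + 2 * b) (𝓝[<] t) (𝓝[>] (-b * t + 2 * b)) := by
      refine tendsto_nhdsWithin_iff.2 ⟨?_, ?_⟩
      · exact ((by fun_prop : Continuous fun z : ℝ => -b * z + 2 * b).tendsto t).mono_left
          nhdsWithin_le_nhds
      · filter_upwards [self_mem_nhdsWithin] with z hz
        have := mul_lt_mul_of_pos_left (mem_Iio.1 hz) hb.1
        simp only [mem_Ioi]; linarith
    refine LipAlong.congr (((hu.lipAlong_right hm).comp_affine hφ).const_add
      (Complex.I * Function.rightLim u b) |>.mul_differentiable (differentiable_twist t)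
      nhdsWithin_le_nhds) ?_
    filter_upwards [Ioo_mem_nhdsLT h1] with z hz
    rw [profileCore_of_gt hz.1]

theorem LipAlong.shift {f g : ℝ → ℂ} {s : ℝ → Set ℝ} {t y d : ℝ} (hy : y = t + d)
    (hs : ∀ z, z ∈ s y → z - d ∈ s t)
    (hf : LipAlong f (𝓝[s t] t) t) (h : ∀ᶠ z in 𝓝[s y] y, g z = f (z - d)) :
    LipAlong g (𝓝[s y] y) y := by
  have ht : t = 1 * y + -d := by rw [hy]; ring
  have hφ : Tendsto (fun z => 1 * z + -d) (𝓝[s y] y) (𝓝[s t] t) := by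
    refine tendsto_nhdsWithin_iff.2 ⟨?_, ?_⟩
    · have := (by fun_prop : Continuous fun z : ℝ => 1 * z + -d).tendsto y
      rw [← ht] at this
      exact this.mono_left nhdsWithin_le_nhds
    · filter_upwards [self_mem_nhdsWithin] with z hz
      simpa [sub_eq_add_neg] using hs z hz
  have hf' : LipAlong f (𝓝[s t] t) (1 * y + -d) := by rwa [← ht]
  refine (hf'.comp_affine hφ).congr ?_
  filter_upwards [h] with z hz
  rw [hz, one_mul, sub_eq_add_neg]

theorem profile_lipAlong_right (hb : b ∈ Ioo (0 : ℝ) 1) (hu : PiecewiseLipschitz u) (y : ℝ) :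
    LipAlong (profile b u) (𝓝[>] y) y := by
  have ht := redTwo_mem y
  have hy := redTwo_add_floor y
  refine LipAlong.shift (s := Ioi) hy.symm (fun z hz => by simp only [mem_Ioi] at *; linarith)
    (profileCore_lipAlong_right hb hu ht) ?_
  have : y < 2 + 2 * (⌊y / 2⌋ : ℝ) := by linarith [ht.2]
  filter_upwards [Ioo_mem_nhdsGT this] with z hz
  exact profile_eq b u (m := ⌊y / 2⌋) (by ring) ⟨by linarith [hz.1, ht.1], by linarith [hz.2]⟩

theorem profile_lipAlong_left (hb : b ∈ Ioo (0 : ℝ) 1) (hu : PiecewiseLipschitz u) (y : ℝ) :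
    LipAlong (profile b u) (𝓝[<] y) y := by
  have ht := redTwo_mem y
  have hy := redTwo_add_floor y
  rcases ht.1.eq_or_lt with h0 | h0
  -- At an even integer the left neighbourhood lies in the preceding period, so the core is used at
  -- `t = 2` instead of `t = 0`.
  · refine LipAlong.shift (s := Iio) (t := 2) (d := 2 * (⌊y / 2⌋ - 1 : ℤ)) (by
        push_cast; rw [← h0] at hy; linarith)
      (fun z hz => by
        simp only [mem_Iio] at *
        push_cast; rw [← h0] at hy; linarith)
      (profileCore_lipAlong_left hb hu ⟨two_pos, le_rfl⟩) ?_
    filter_upwards [Ioo_mem_nhdsLT (show y - 2 < y by linarith)] with z hz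
    refine profile_eq b u (m := ⌊y / 2⌋ - 1) (by ring) ⟨?_, ?_⟩
    · push_cast; rw [← h0] at hy; linarith [hz.1]
    · push_cast; rw [← h0] at hy; linarith [hz.2]
  · refine LipAlong.shift (s := Iio) hy.symm (fun z hz => by simp only [mem_Iio] at *; linarith)
      (profileCore_lipAlong_left hb hu ⟨h0, ht.2.le⟩) ?_
    have : 2 * (⌊y / 2⌋ : ℝ) < y := by linarith
    filter_upwards [Ioo_mem_nhdsLT this] with z hz
    exact profile_eq b u (m := ⌊y / 2⌋) (by ring) ⟨by linarith [hz.1], by linarith [hz.2, ht.2]⟩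

theorem profile_bound (hb : b ∈ Ioo (0 : ℝ) 1) (hu : PiecewiseLipschitz u) :
    ∃ M : ℝ, ∀ y, ‖profile b u y‖ ≤ M := by
  obtain ⟨M, hM⟩ := hu.exists_bound
  refine ⟨‖Function.rightLim u b‖ + M, fun y => ?_⟩
  have ht := redTwo_mem y
  rw [show profile b u y = profileCore b u (redTwo y) from rfl]
  have he : ∀ t : ℝ, ‖Complex.exp (-Complex.I * ((Real.pi * t / 4 : ℝ) : ℂ))‖ = 1 := fun t => by
    rw [show -Complex.I * ((Real.pi * t / 4 : ℝ) : ℂ) = ((-(Real.pi * t / 4) : ℝ) : ℂ) * Complex.I by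
      push_cast; ring, Complex.norm_exp_ofReal_mul_I]
  rcases le_or_gt (redTwo y) 1 with h | h
  · rw [profileCore_of_le h, norm_mul, he, one_mul]
    refine (norm_add_le _ _).trans (add_le_add le_rfl ?_)
    rw [norm_mul, Complex.norm_I, one_mul]
    have := mul_nonneg hb.1.le ht.1
    exact hM _ ⟨by linarith, by nlinarith [hb.1, hb.2]⟩
  · rw [profileCore_of_gt h, norm_mul, he, one_mul]
    refine (norm_add_le _ _).trans (add_le_add ?_ ?_)
    · rw [norm_mul, Complex.norm_I, one_mul]
    · exact hM _ ⟨by nlinarith [hb.1, hb.2, ht.2], by nlinarith [hb.1, hb.2, ht.2]⟩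

theorem profile_exists_finite (hb : b ∈ Ioo (0 : ℝ) 1) (hu : PiecewiseLipschitz u) :
    ∃ F : Set ℝ, F.Finite ∧ ∀ y, redTwo y ∉ F → ContinuousAt (profile b u) y := by
  obtain ⟨F, hF, h⟩ := hu.exists_finite
  have inj1 : Function.Injective fun t : ℝ => b * t + 0 := fun s t h => by
    simpa [hb.1.ne'] using h
  have inj2 : Function.Injective fun t : ℝ => -b * t + 2 * b := fun s t h => by
    simpa [hb.1.ne'] using h
  -- The point `0` is the junction of two periods and `1` the change of branch; the preimages carry
  -- the possible jumps of `u` through the two affine maps.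
  refine ⟨{0, 1} ∪ ((fun t => b * t + 0) ⁻¹' F ∪ (fun t => -b * t + 2 * b) ⁻¹' F),
    (Set.toFinite _).union ((hF.preimage inj1.injOn).union (hF.preimage inj2.injOn)),
    fun y hy => ?_⟩
  simp only [mem_union, mem_insert_iff, mem_singleton_iff, mem_preimage, not_or] at hy
  obtain ⟨⟨h0, h1⟩, h2, h3⟩ := hy
  have ht := redTwo_mem y
  have ht0 : 0 < redTwo y := lt_of_le_of_ne ht.1 (Ne.symm h0)
  have hyt := redTwo_add_floor y
  have hcore : ContinuousAt (profileCore b u) (redTwo y) := by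
    rcases lt_or_gt_of_ne h1 with h1 | h1
    · have hc : ContinuousAt u (b * redTwo y + 0) := h _ (by
        have := mul_pos hb.1 ht0
        exact ⟨by linarith, by nlinarith [hb.1, hb.2]⟩) h2
      have hc' : ContinuousAt (fun t => u (b * t + 0)) (redTwo y) :=
        ContinuousAt.comp (f := fun t : ℝ => b * t + 0) hc (by fun_prop)
      refine ((differentiable_twist _).continuousAt.mul
        ((continuousAt_const (y := Function.rightLim u b)).add
          ((continuousAt_const (y := Complex.I)).mul hc'))).congr ?_
      filter_upwards [Iio_mem_nhds h1] with z hz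
      rw [profileCore_of_le (mem_Iio.1 hz).le]; rfl
    · have hc : ContinuousAt u (-b * redTwo y + 2 * b) := h _
        ⟨by nlinarith [hb.1, hb.2, ht.2], by nlinarith [hb.1, hb.2, ht.2]⟩ h3
      have hc' : ContinuousAt (fun t => u (-b * t + 2 * b)) (redTwo y) :=
        ContinuousAt.comp (f := fun t : ℝ => -b * t + 2 * b) hc (by fun_prop)
      refine ((differentiable_twist _).continuousAt.mul
        ((continuousAt_const (y := Complex.I * Function.rightLim u b)).add hc')).congr ?_
      filter_upwards [Ioi_mem_nhds h1] with z hz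
      rw [profileCore_of_gt (mem_Ioi.1 hz)]; rfl
  have hs : ContinuousAt (fun z => profileCore b u (z - 2 * ⌊y / 2⌋)) y := by
    have hcore' : ContinuousAt (profileCore b u) (y - 2 * ⌊y / 2⌋) := by
      rwa [show y - 2 * (⌊y / 2⌋ : ℝ) = redTwo y by linarith]
    exact ContinuousAt.comp (f := fun z : ℝ => z - 2 * ⌊y / 2⌋) hcore' (by fun_prop)
  refine hs.congr ?_
  have a1 : 2 * (⌊y / 2⌋ : ℝ) < y := by linarith
  have a2 : y < 2 + 2 * (⌊y / 2⌋ : ℝ) := by linarith [ht.2]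
  filter_upwards [Ioo_mem_nhds a1 a2] with z hz
  exact (profile_eq b u (m := ⌊y / 2⌋) (by ring) ⟨by linarith [hz.1], by linarith [hz.2]⟩).symm

theorem finite_redTwo_mem {F : Set ℝ} (hF : F.Finite) (c d : ℝ) :
    {y ∈ Icc c d | redTwo y ∈ F}.Finite := by
  refine ((hF.prod (Set.finite_Icc ⌊c / 2⌋ ⌊d / 2⌋)).image
    fun p : ℝ × ℤ => p.1 + 2 * (p.2 : ℝ)).subset ?_
  rintro y ⟨hy, hyF⟩
  refine ⟨(redTwo y, ⌊y / 2⌋), ⟨hyF, ?_, ?_⟩, redTwo_add_floor y⟩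
  · exact Int.floor_le_floor (by linarith [hy.1])
  · exact Int.floor_le_floor (by linarith [hy.2])

theorem profile_aestronglyMeasurable (hb : b ∈ Ioo (0 : ℝ) 1) (hu : PiecewiseLipschitz u) :
    AEStronglyMeasurable (profile b u) volume := by
  obtain ⟨F, hF, h⟩ := profile_exists_finite hb hu
  have hc : {y | redTwo y ∈ F}.Countable := by
    refine (countable_iUnion fun n : ℕ => (finite_redTwo_mem hF (-n) n).countable).mono fun y hy => ?_
    obtain ⟨n, hn⟩ := exists_nat_ge |y|
    exact mem_iUnion.2 ⟨n, abs_le.1 hn, hy⟩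
  have := PiecewiseLipschitz.aestronglyMeasurable_of_continuousAt MeasurableSet.univ hc
    (f := profile b u) fun y _ hy => h y hy
  rwa [Measure.restrict_univ] at this

theorem exceptionalSet_finite (hb : b ∈ Ioo (0 : ℝ) 1) (hu : PiecewiseLipschitz u) (q : ℕ) :
    (exceptionalSet b u q).Finite := by
  obtain ⟨F, hF, h⟩ := profile_exists_finite hb hu
  have key : ∀ a d : ℝ, a ≠ 0 → {x ∈ Ioo 0 b | redTwo (a * x - d) ∈ F}.Finite := fun a d ha => by
    have hinj : Function.Injective fun x : ℝ => a * x - d := fun s t h => by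
      simpa [ha] using h
    refine ((finite_redTwo_mem hF (-(|a| * b) - d) (|a| * b - d)).preimage hinj.injOn).subset ?_
    rintro x ⟨hx, hxF⟩
    refine ⟨?_, hxF⟩
    have : |a * x| ≤ |a| * b := by
      rw [abs_mul, abs_of_pos hx.1]
      exact mul_le_mul_of_nonneg_left hx.2.le (abs_nonneg _)
    exact ⟨by linarith [(abs_le.1 this).1], by linarith [(abs_le.1 this).2]⟩
  refine ((Set.finite_lt_nat (2 * q)).biUnion fun k _ =>
    (key b⁻¹ (k / q) (inv_ne_zero hb.1.ne')).union
      (key (-b⁻¹) (k / q) (neg_ne_zero.2 (inv_ne_zero hb.1.ne')))).subset ?_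
  rintro x ⟨hx, k, hk, hd⟩
  refine mem_biUnion (show k ∈ {k | k < 2 * q} from hk) ?_
  rcases hd with hd | hd
  · refine Or.inl ⟨hx, by_contra fun hn => hd (h _ ?_)⟩
    rwa [show x / b - (k : ℝ) / q = b⁻¹ * x - k / q by ring]
  · refine Or.inr ⟨hx, by_contra fun hn => hd (h _ ?_)⟩
    rwa [show -(x / b) - (k : ℝ) / q = -b⁻¹ * x - k / q by ring]

end

end

section

/-! ### The revival series at rational times -/

/-! ### Revival coefficients as Fourier coefficients of the profile -/

section

variable {b : ℝ} {u : ℝ → ℂ}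

theorem profile_intervalIntegrable (hb : b ∈ Ioo (0 : ℝ) 1) (hu : PiecewiseLipschitz u) (n : ℤ)
    (c d : ℝ) : IntervalIntegrable (fun y => profile b u y * char n y) volume c d := by
  obtain ⟨M, hM⟩ := profile_bound hb hu
  refine (intervalIntegrable_const (c := M)).mono_fun
    ((profile_aestronglyMeasurable hb hu).mul (continuous_char n).aestronglyMeasurable).restrict ?_
  refine Eventually.of_forall fun s => ?_
  beta_reduce
  rw [norm_mul, norm_char, mul_one]
  exact (hM _).trans (le_abs_self _)

theorem exp_I_mul_ofReal (x : ℝ) :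
    Complex.exp (Complex.I * (x : ℂ)) = (Real.cos x : ℂ) + Complex.I * (Real.sin x : ℂ) := by
  rw [mul_comm, Complex.exp_mul_I, ← Complex.ofReal_cos, ← Complex.ofReal_sin]; ring

theorem exp_neg_I_mul_ofReal (x : ℝ) :
    Complex.exp (-Complex.I * (x : ℂ)) = (Real.cos x : ℂ) - Complex.I * (Real.sin x : ℂ) := by
  have := exp_I_mul_ofReal (-x)
  rw [Real.cos_neg, Real.sin_neg] at this
  rw [show -Complex.I * (x : ℂ) = Complex.I * ((-x : ℝ) : ℂ) by push_cast; ring, this]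
  push_cast; ring

/-- The revival coefficients are twice the Fourier coefficients of the profile. -/
theorem coeff_eq (hb : b ∈ Ioo (0 : ℝ) 1) (hu : PiecewiseLipschitz u) (n : ℕ) :
    coeff b u n = 2 * fourierCoefficient 2 (profile b u) n := by
  have hint := profile_intervalIntegrable hb hu (-n)
  rw [fourierCoefficient_two, ← intervalIntegral.integral_add_adjacent_intervals (hint 0 1) (hint 1 2)]
  have hflip : ∫ y in (1 : ℝ)..2, profile b u y * char (-n) y
      = ∫ y in (0 : ℝ)..1, profile b u (2 - y) * char (-n) (2 - y) := by
    rw [intervalIntegral.integral_comp_sub_left (fun y => profile b u y * char (-n) y)]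
    norm_num
  have hint2 : IntervalIntegrable (fun y => profile b u (2 - y) * char (-n) (2 - y)) volume 0 1 := by
    have := (hint 1 2).comp_sub_left 2
    norm_num at this
    exact this.symm
  rw [hflip, ← intervalIntegral.integral_add (hint 0 1) hint2, coeff]
  congr 1
  rw [← intervalIntegral.integral_const_mul]
  refine intervalIntegral.integral_congr_ae ?_
  -- At `y = 1` the reflected point `2 - y` falls into the other branch of `profileCore`, so this
  -- point is discarded.
  filter_upwards [ae_ne 1] with y hy1 hy
  rw [uIoc_of_le zero_le_one] at hy
  have hy1' : y < 1 := lt_of_le_of_ne hy.2 hy1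
  rw [profile_eq b u (t := y) (m := 0) (by simp) ⟨hy.1.le, by linarith⟩,
    profile_eq b u (t := 2 - y) (m := 0) (by simp) ⟨by linarith, by linarith [hy.1]⟩,
    profileCore_of_le hy.2, profileCore_of_gt (by linarith), add_zero,
    show -b * (2 - y) + 2 * b = b * y by ring]
  set r := Function.rightLim u b
  -- The twist `exp(-iπy/4)` shifts the frequency from `n` to `n + 1/4`. After reflection it also
  -- leaves a factor `exp(-iπ/2) = -i`, and the factors `i` in `profileCore` are placed so that only
  -- `u` times sine and `r` times cosine survive.
  have e1 : Complex.exp (-Complex.I * ((Real.pi * y / 4 : ℝ) : ℂ)) * char (-(n : ℤ)) y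
      = Complex.exp (-Complex.I * ((Real.pi * ((n : ℝ) + 1 / 4) * y : ℝ) : ℂ)) := by
    rw [char, ← Complex.exp_add]; congr 1; push_cast; ring
  have e2 : Complex.exp (-Complex.I * ((Real.pi * (2 - y) / 4 : ℝ) : ℂ)) * char (-(n : ℤ)) (2 - y)
      = -Complex.I * Complex.exp (Complex.I * ((Real.pi * ((n : ℝ) + 1 / 4) * y : ℝ) : ℂ)) := by
    have : char (-(n : ℤ)) (2 - y) = char (-(n : ℤ)) (-y) := by
      rw [← char_periodic _ (-y)]; congr 1; ring
    have h2 : -Complex.I = Complex.exp (-Complex.I * ((Real.pi / 2 : ℝ) : ℂ)) := by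
      rw [exp_neg_I_mul_ofReal, Real.cos_pi_div_two, Real.sin_pi_div_two]; simp
    rw [this, char, ← Complex.exp_add]
    conv_rhs => rw [h2, ← Complex.exp_add]
    congr 1; push_cast; ring
  replace e1 := e1.trans (exp_neg_I_mul_ofReal _)
  rw [exp_I_mul_ofReal] at e2
  set c := (Real.cos (Real.pi * ((n : ℝ) + 1 / 4) * y) : ℂ)
  set s := (Real.sin (Real.pi * ((n : ℝ) + 1 / 4) * y) : ℂ)
  linear_combination (-(1 / 2 : ℂ) * (r + Complex.I * u (b * y))) * e1
    + (-(1 / 2 : ℂ) * (Complex.I * r + u (b * y))) * e2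
    + (u (b * y) * s + 1 / 2 * r * c + 1 / 2 * Complex.I * r * s) * Complex.I_sq

end

/-- The quadratic phases `exp(-i (n + 1/4)² 2πp/q)`. -/
noncomputable def gaussPhase (p q n : ℕ) : ℂ :=
  Complex.exp (-Complex.I * ((((n : ℝ) + 1 / 4) ^ 2 * (2 * Real.pi * (p : ℝ) / (q : ℝ)) : ℝ) : ℂ))

/-- The shift by `2qm` changes `(n + 1/4)² p/q` by the integer `p(4nm + 4qm² + m)`. A shift by `q`
would leave a half-integer from the quarter, whence the period `2q`. -/
theorem gaussPhase_periodic {p q : ℕ} (hq : 0 < q) (n m : ℕ) :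
    gaussPhase p q (n + 2 * q * m) = gaussPhase p q n := by
  have hq' : (q : ℂ) ≠ 0 := by exact_mod_cast hq.ne'
  rw [gaussPhase, gaussPhase, Complex.exp_eq_exp_iff_exists_int]
  refine ⟨-(p * (4 * n * m + 4 * q * m ^ 2 + m)), ?_⟩
  push_cast
  field_simp
  ring

theorem sum_char_div {q : ℕ} (hq : 0 < q) (j : ℤ) :
    ∑ k ∈ Finset.range (2 * q), char j ((k : ℝ) / q) = if (2 * q : ℤ) ∣ j then (2 * q : ℂ) else 0 := by
  have hq' : (q : ℂ) ≠ 0 := by exact_mod_cast hq.ne'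
  have hpow : ∀ k : ℕ, char j ((k : ℝ) / q) = char j (1 / q) ^ k := fun k => by
    rw [char, char, ← Complex.exp_nat_mul]; congr 1; push_cast; ring
  simp only [hpow]
  have h1 : char j (1 / q) = 1 ↔ (2 * q : ℤ) ∣ j := by
    rw [char, Complex.exp_eq_one_iff]
    have hpi : (Real.pi : ℂ) ≠ 0 := by exact_mod_cast Real.pi_ne_zero
    constructor
    · rintro ⟨m, hm⟩
      refine ⟨m, ?_⟩
      push_cast at hm
      field_simp at hm
      have : (j : ℂ) = ((2 * q * m : ℤ) : ℂ) := by push_cast; linear_combination hm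
      exact_mod_cast this
    · rintro ⟨m, rfl⟩
      refine ⟨m, ?_⟩
      push_cast
      field_simp
  split_ifs with hd
  · rw [h1.2 hd]; simp
  · have hne : char j (1 / q) ≠ 1 := fun h => hd (h1.1 h)
    have hper : char j (1 / q) ^ (2 * q) = 1 := by
      rw [← hpow]
      have : (((2 * q : ℕ) : ℝ) / q) = 0 + 2 := by
        have : (q : ℝ) ≠ 0 := by exact_mod_cast hq.ne'
        push_cast; field_simp; ring
      rw [this, char_periodic, char_zero_right]
    rw [geom_sum_eq hne, hper, sub_self, zero_div]

theorem dCoeff_eq (p q k : ℕ) : dCoeff p q k = 1 / (2 * (q : ℂ)) *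
    ∑ m ∈ Finset.range (2 * q), gaussPhase p q m * char m ((k : ℝ) / q) := by
  rw [dCoeff]
  congr 1
  refine Finset.sum_congr rfl fun m _ => ?_
  rw [gaussPhase, char]
  congr 3; push_cast; ring

/-- Finite Fourier inversion for the quadratic phases. -/
theorem sum_dCoeff_mul_char {p q : ℕ} (hq : 0 < q) (n : ℕ) :
    ∑ k ∈ Finset.range (2 * q), dCoeff p q k * char n (-((k : ℝ) / q)) = gaussPhase p q n := by
  have hq' : (q : ℂ) ≠ 0 := by exact_mod_cast hq.ne'
  have e : ∀ k : ℕ, dCoeff p q k * char n (-((k : ℝ) / q)) = ∑ m ∈ Finset.range (2 * q),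
      1 / (2 * (q : ℂ)) * gaussPhase p q m * char ((m : ℤ) - n) ((k : ℝ) / q) := fun k => by
    rw [dCoeff_eq, mul_assoc, Finset.sum_mul, Finset.mul_sum]
    refine Finset.sum_congr rfl fun m _ => ?_
    have : char n (-((k : ℝ) / q)) = char (-n) ((k : ℝ) / q) := by
      rw [char, char]; congr 1; push_cast; ring
    rw [this, sub_eq_add_neg, char_add_left]; ring
  simp only [e]
  rw [Finset.sum_comm]
  simp only [← Finset.mul_sum, sum_char_div hq]
  have hmem : n % (2 * q) ∈ Finset.range (2 * q) := Finset.mem_range.2 (Nat.mod_lt _ (by omega))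
  rw [Finset.sum_eq_single_of_mem _ hmem]
  · have hd : (2 * q : ℤ) ∣ ((n % (2 * q) : ℕ) : ℤ) - n := by
      rw [Int.natCast_mod]; push_cast
      exact Int.dvd_emod_sub_self
    rw [if_pos hd]
    have := gaussPhase_periodic (p := p) hq (n % (2 * q)) (n / (2 * q))
    rw [Nat.mod_add_div] at this
    rw [this]
    field_simp
  · intro m hm hne
    rw [if_neg, mul_zero]
    intro hd
    apply hne
    have h1 : (n : ℤ) ≡ m [ZMOD ((2 * q : ℕ) : ℤ)] := by
      rw [Int.modEq_iff_dvd]; push_cast; exact hd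
    have h2 : n ≡ m [MOD 2 * q] := (Int.natCast_modEq_iff).1 h1
    rw [h2, Nat.mod_eq_of_lt (Finset.mem_range.1 hm)]

/-- Finite Fourier inversion at `n = 0`. This sum multiplies the mean of the profile and so produces
the phase in `L₃`. -/
theorem sum_dCoeff {p q : ℕ} (hq : 0 < q) : ∑ k ∈ Finset.range (2 * q), dCoeff p q k =
    Complex.exp (-Complex.I * ((Real.pi * (p : ℝ) / (8 * (q : ℝ)) : ℝ) : ℂ)) := by
  have := sum_dCoeff_mul_char (p := p) hq 0
  simp only [Nat.cast_zero, char_zero_left, mul_one] at this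
  rw [this, gaussPhase]
  congr 2; push_cast; ring

/-! ### Rational times as finite sums of half Fourier series -/

section

variable {b : ℝ} {u : ℝ → ℂ}

theorem sin_eq_phase (hb : b ≠ 0) (n : ℕ) (x : ℝ) :
    (Real.sin (Real.pi / b * ((n : ℝ) + 1 / 4) * x) : ℂ)
      = -Complex.I / 2 * (phase b x * char n (x / b) - phase b (-x) * char n (-(x / b))) := by
  have hb' : (b : ℂ) ≠ 0 := by exact_mod_cast hb
  have e1 : phase b x * char n (x / b)
      = Complex.exp (Complex.I * ((Real.pi / b * ((n : ℝ) + 1 / 4) * x : ℝ) : ℂ)) := by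
    rw [phase, char, ← Complex.exp_add]; congr 1; push_cast; field_simp; ring
  have e2 : phase b (-x) * char n (-(x / b))
      = Complex.exp (-Complex.I * ((Real.pi / b * ((n : ℝ) + 1 / 4) * x : ℝ) : ℂ)) := by
    rw [phase, char, ← Complex.exp_add]; congr 1; push_cast; field_simp; ring
  rw [e1, e2, exp_I_mul_ofReal, exp_neg_I_mul_ofReal]
  linear_combination
    (Real.sin (Real.pi / b * ((n : ℝ) + 1 / 4) * x) : ℂ) * Complex.I_sq

theorem phase_sub_phase (x : ℝ) : phase b x - phase b (-x)
    = 2 * Complex.I * (Real.sin (Real.pi * x / (4 * b)) : ℂ) := by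
  have e1 : phase b x = Complex.exp (Complex.I * ((Real.pi * x / (4 * b) : ℝ) : ℂ)) := by
    rw [phase]; congr 2; push_cast; ring
  have e2 : phase b (-x) = Complex.exp (-Complex.I * ((Real.pi * x / (4 * b) : ℝ) : ℂ)) := by
    rw [phase]; congr 1; push_cast; ring
  rw [e1, e2, exp_I_mul_ofReal, exp_neg_I_mul_ofReal]; ring

/-- At this time `(π/b)²` cancels and the time factor is a `gaussPhase`, that is, a superposition of
translations by `k/q`. With the sine written as a difference of exponentials, the identity already
holds for partial sums, so no rearrangement of the series is needed. -/
theorem revivalPartialSum_rational (hb : b ∈ Ioo (0 : ℝ) 1) (hu : PiecewiseLipschitz u) {p q : ℕ}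
    (hq : 0 < q) (N : ℕ) (x : ℝ) :
    revivalPartialSum b u N x (2 * b ^ 2 / Real.pi * ((p : ℝ) / (q : ℝ))) =
      -Complex.I * ∑ k ∈ Finset.range (2 * q), dCoeff p q k *
        (phase b x * (∑ n ∈ Finset.Icc 1 N, fourierCoefficient 2 (profile b u) n *
            char n (x / b - (k : ℝ) / q))
          - phase b (-x) * (∑ n ∈ Finset.Icc 1 N, fourierCoefficient 2 (profile b u) n *
            char n (-(x / b) - (k : ℝ) / q))) := by
  have hb' : (b : ℂ) ≠ 0 := by exact_mod_cast hb.1.ne'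
  have hpi : (Real.pi : ℂ) ≠ 0 := by exact_mod_cast Real.pi_ne_zero
  have term : ∀ n : ℕ, coeff b u n *
      Complex.exp (-Complex.I * ((Real.pi / b * ((n : ℝ) + 1 / 4) : ℝ) : ℂ) ^ 2 *
        ((2 * b ^ 2 / Real.pi * ((p : ℝ) / (q : ℝ)) : ℝ) : ℂ)) *
      (Real.sin (Real.pi / b * ((n : ℝ) + 1 / 4) * x) : ℂ) =
      ∑ k ∈ Finset.range (2 * q), -Complex.I * (dCoeff p q k *
        (phase b x * (fourierCoefficient 2 (profile b u) n * char n (x / b - (k : ℝ) / q))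
          - phase b (-x) * (fourierCoefficient 2 (profile b u) n *
            char n (-(x / b) - (k : ℝ) / q)))) := fun n => by
    have e : Complex.exp (-Complex.I * ((Real.pi / b * ((n : ℝ) + 1 / 4) : ℝ) : ℂ) ^ 2 *
        ((2 * b ^ 2 / Real.pi * ((p : ℝ) / (q : ℝ)) : ℝ) : ℂ)) = gaussPhase p q n := by
      rw [gaussPhase]; congr 1; push_cast; field_simp
    rw [e, coeff_eq hb hu, sin_eq_phase hb.1.ne', ← sum_dCoeff_mul_char hq, Finset.mul_sum,
      Finset.sum_mul]
    refine Finset.sum_congr rfl fun k _ => ?_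
    rw [sub_eq_add_neg (x / b), sub_eq_add_neg (-(x / b)), char_add, char_add]
    ring
  rw [revivalPartialSum, Finset.sum_congr rfl fun n _ => term n, Finset.sum_comm, Finset.mul_sum]
  refine Finset.sum_congr rfl fun k _ => ?_
  rw [← Finset.mul_sum, ← Finset.mul_sum, Finset.sum_sub_distrib, ← Finset.mul_sum, ← Finset.mul_sum]

/-- Each half series tends to `(G - Ĝ(0) + i𝓗G)/2`. The summand `G` gives `L₁`, the mean gives `L₃`
after summing the weights, and `𝓗G` gives `L₂`. -/
theorem tendsto_revivalPartialSum_rational (hb : b ∈ Ioo (0 : ℝ) 1) (hu : PiecewiseLipschitz u)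
    {p q : ℕ} (hq : 0 < q) {x : ℝ}
    (hx : ∀ k < 2 * q, ContinuousAt (profile b u) (x / b - (k : ℝ) / (q : ℝ)) ∧
      ContinuousAt (profile b u) (-(x / b) - (k : ℝ) / (q : ℝ))) :
    (∀ k < 2 * q,
      Tendsto (fun N : ℕ => hilbertPartialSum 2 (profile b u) N (x / b - (k : ℝ) / (q : ℝ)))
        atTop (𝓝 (hilbertTransform 2 (profile b u) (x / b - (k : ℝ) / (q : ℝ)))) ∧
      Tendsto (fun N : ℕ => hilbertPartialSum 2 (profile b u) N (-(x / b) - (k : ℝ) / (q : ℝ)))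
        atTop (𝓝 (hilbertTransform 2 (profile b u) (-(x / b) - (k : ℝ) / (q : ℝ))))) ∧
    Tendsto (fun N : ℕ => revivalPartialSum b u N x (2 * b ^ 2 / Real.pi * ((p : ℝ) / (q : ℝ))))
      atTop (𝓝 (L₁ b u p q x + L₂ b u p q x + L₃ b u p q x)) := by
  obtain ⟨M, hM⟩ := profile_bound hb hu
  have half := fun (y : ℝ) (hy : ContinuousAt (profile b u) y) =>
    tendsto_half_series (profile_periodic b u) (profile_aestronglyMeasurable hb hu) hM
      (LipAlong.isBigO_of_continuousAt (profile_lipAlong_left hb hu y)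
        (profile_lipAlong_right hb hu y) hy)
  refine ⟨fun k hk => ⟨(half _ (hx k hk).1).1, (half _ (hx k hk).2).1⟩, ?_⟩
  simp only [revivalPartialSum_rational hb hu hq]
  have key := (tendsto_finsetSum (Finset.range (2 * q)) fun k hk =>
    (((half _ (hx k (Finset.mem_range.1 hk)).1).2.const_mul (phase b x)).sub
      ((half _ (hx k (Finset.mem_range.1 hk)).2).2.const_mul (phase b (-x)))).const_mul
        (dCoeff p q k)).const_mul (-Complex.I)
  refine key.congr' EventuallyEq.rfl |>.trans (le_of_eq (congrArg 𝓝 ?_))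
  have h0 : fourierCoefficient 2 (profile b u) 0 = 1 / 2 * ∫ y in (0 : ℝ)..2, profile b u y := by
    rw [fourierCoefficient_two]; simp [char_zero_left]
  have h3 : L₃ b u p q x = Complex.I / 2 * fourierCoefficient 2 (profile b u) 0 *
      ∑ k ∈ Finset.range (2 * q), dCoeff p q k * (phase b x - phase b (-x)) := by
    rw [← Finset.sum_mul, sum_dCoeff hq, phase_sub_phase, L₃, h0]
    linear_combination (-(1 / 2 * ∫ y in (0 : ℝ)..2, profile b u y) *
      (Real.sin (Real.pi * x / (4 * b)) : ℂ) *
      Complex.exp (-Complex.I * ((Real.pi * (p : ℝ) / (8 * (q : ℝ)) : ℝ) : ℂ))) * Complex.I_sq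
  rw [h3, L₁, L₂, Finset.mul_sum, Finset.mul_sum, Finset.mul_sum, Finset.mul_sum,
    ← Finset.sum_add_distrib, ← Finset.sum_add_distrib]
  refine Finset.sum_congr rfl fun k _ => ?_
  linear_combination (-(1 / 2) * dCoeff p q k *
    (phase b x * hilbertTransform 2 (profile b u) (x / b - (k : ℝ) / (q : ℝ))
      - phase b (-x) * hilbertTransform 2 (profile b u) (-(x / b) - (k : ℝ) / (q : ℝ)))) *
    Complex.I_sq

theorem continuous_L₃ (p q : ℕ) : Continuous (L₃ b u p q) := by
  unfold L₃
  fun_prop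

end

end

section

/-! ### The characteristic equation -/

/-- The characteristic equation for a frequency `m`, oscillating over a length `B` and
exponential over a length `A`. -/
def IsFreq (A B m : ℝ) : Prop := Real.sinh (m * A) * Real.cos (m * B) = Real.sin (m * B) * Real.cosh (m * A)

theorem isEigen_sq_iff {b m : ℝ} (hm : 0 < m) : IsEigen b (m ^ 2) ↔ IsFreq (1 - b) b m := by
  have h1 : (0 : ℝ) < m ^ 2 := by positivity
  have h2 : -m ^ 2 < 0 := by linarith
  rw [IsEigen, sinGen_neg h2, cosGen_neg h2, sinGen_pos h1, cosGen_pos h1, neg_neg,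
    Real.sqrt_sq hm.le, IsFreq]
  field_simp

theorem isEigen_neg_sq_iff {b m : ℝ} (hm : 0 < m) : IsEigen b (-m ^ 2) ↔ IsFreq b (1 - b) m := by
  have h1 : (0 : ℝ) < m ^ 2 := by positivity
  have h2 : -m ^ 2 < 0 := by linarith
  rw [IsEigen, neg_neg, sinGen_neg h2, cosGen_neg h2, sinGen_pos h1, cosGen_pos h1, neg_neg,
    Real.sqrt_sq hm.le, IsFreq]
  field_simp
  constructor <;> intro h <;> linarith

/-- The phase function whose values at the frequencies are `π/4` modulo `π`. -/
noncomputable def freqPhase (A B m : ℝ) : ℝ := m * B + Real.arctan (Real.exp (-(2 * m * A)))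

variable {A B : ℝ}

/-- With `E = exp(-2mA)` one has `tanh(mA) = (1-E)/(1+E) = tan(π/4 - arctan E)`, so `tan(mB) =
tanh(mA)` says that the phase is `π/4` modulo `π`. Working with the sine of the difference avoids
dividing by `cos(mB)`. -/
theorem isFreq_iff {m : ℝ} : IsFreq A B m ↔ ∃ n : ℤ, freqPhase A B m = n * Real.pi + Real.pi / 4 := by
  set E := Real.exp (-(2 * m * A)) with hE
  set θ := Real.arctan E with hθ
  have hc : 0 < Real.cos θ := Real.cos_arctan_pos E
  have hs : Real.sin θ = E * Real.cos θ := by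
    rw [← Real.tan_mul_cos hc.ne', hθ, Real.tan_arctan]
  have he : 0 < Real.exp (m * A) := Real.exp_pos _
  have hE' : Real.exp (-(m * A)) = E * Real.exp (m * A) := by
    rw [hE, ← Real.exp_add]; congr 1; ring
  have key : Real.sin (freqPhase A B m - Real.pi / 4) = -(√2 * Real.cos θ / Real.exp (m * A)) *
      (Real.sinh (m * A) * Real.cos (m * B) - Real.sin (m * B) * Real.cosh (m * A)) := by
    rw [freqPhase, Real.sin_sub, Real.sin_pi_div_four, Real.cos_pi_div_four, Real.sin_add,
      Real.cos_add, Real.sinh_eq, Real.cosh_eq, hE', ← hE, ← hθ, hs]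
    field_simp
    ring
  have hne : -(√2 * Real.cos θ / Real.exp (m * A)) ≠ 0 := by
    apply neg_ne_zero.2; positivity
  rw [IsFreq, ← sub_eq_zero, ← mul_eq_zero_iff_left hne, ← key, Real.sin_eq_zero_iff]
  exact exists_congr fun n => by constructor <;> intro h <;> linarith

theorem hasDerivAt_freqPhase (A B m : ℝ) : HasDerivAt (freqPhase A B)
    (B - 2 * A * (Real.exp (-(2 * m * A)) / (1 + Real.exp (-(2 * m * A)) ^ 2))) m := by
  have h1 : HasDerivAt (fun m : ℝ => -(2 * m * A)) (-(2 * A)) m := by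
    convert! (((hasDerivAt_id m).const_mul 2).mul_const A).neg using 1
    ring
  convert! ((hasDerivAt_id m).mul_const B).add (h1.exp.arctan) using 1
  ring

theorem continuous_freqPhase : Continuous (freqPhase A B) :=
  continuous_iff_continuousAt.2 fun m => (hasDerivAt_freqPhase A B m).continuousAt

theorem freqPhase_zero : freqPhase A B 0 = Real.pi / 4 := by simp [freqPhase, Real.arctan_one]

/-- In the derivative, `E/(1+E²)` increases with `E` on `(0,1)`, while `E` decreases in `m`. -/
theorem strictConvexOn_freqPhase (hA : 0 < A) : StrictConvexOn ℝ (Ici 0) (freqPhase A B) := by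
  refine StrictMonoOn.strictConvexOn_of_deriv (convex_Ici 0) continuous_freqPhase.continuousOn ?_
  rw [interior_Ici]
  intro m₁ h₁ m₂ h₂ h
  simp only [mem_Ioi] at h₁ h₂
  rw [(hasDerivAt_freqPhase A B m₁).deriv, (hasDerivAt_freqPhase A B m₂).deriv]
  set E₁ := Real.exp (-(2 * m₁ * A))
  set E₂ := Real.exp (-(2 * m₂ * A))
  have hE1 : E₁ < 1 := Real.exp_lt_one_iff.2 (by have := mul_pos h₁ hA; linarith)
  have hE2 : E₂ < 1 := Real.exp_lt_one_iff.2 (by have := mul_pos h₂ hA; linarith)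
  have hE : E₂ < E₁ := Real.exp_lt_exp.2 (by nlinarith)
  have p1 : 0 < E₁ := Real.exp_pos _
  have p2 : 0 < E₂ := Real.exp_pos _
  have : E₂ / (1 + E₂ ^ 2) < E₁ / (1 + E₁ ^ 2) := by
    rw [div_lt_div_iff₀ (by positivity) (by positivity)]
    have h12 : E₁ * E₂ < 1 := by nlinarith
    nlinarith
  have := mul_lt_mul_of_pos_left this (show 0 < 2 * A by linarith)
  linarith

/-- The phase need not be monotone: its slope at `0` is `B - A`. But it starts at height `π/4` and
lies strictly below its chords, so it stays below any later value that is at least `π/4`. -/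
theorem freqPhase_lt {m₁ m₂ : ℝ} (hA : 0 < A) (h₁ : 0 < m₁) (h : m₁ < m₂)
    (hc : Real.pi / 4 ≤ freqPhase A B m₂) : freqPhase A B m₁ < freqPhase A B m₂ := by
  have h2 : 0 < m₂ := h₁.trans h
  have key : freqPhase A B ((1 - m₁ / m₂) • 0 + (m₁ / m₂) • m₂) <
      (1 - m₁ / m₂) • freqPhase A B 0 + (m₁ / m₂) • freqPhase A B m₂ :=
    (strictConvexOn_freqPhase hA).2 self_mem_Ici h2.le h2.ne
      (sub_pos.2 ((div_lt_one h2).2 h)) (div_pos h₁ h2) (by ring)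
  simp only [smul_eq_mul, mul_zero, zero_add, div_mul_cancel₀ _ h2.ne', freqPhase_zero] at key
  have h3 : 0 ≤ 1 - m₁ / m₂ := sub_nonneg.2 ((div_le_one h2).2 h.le)
  nlinarith

theorem freqPhase_inj {m₁ m₂ : ℝ} (hA : 0 < A) (h₁ : 0 < m₁) (h₂ : 0 < m₂)
    (h : freqPhase A B m₁ = freqPhase A B m₂) (hc : Real.pi / 4 ≤ freqPhase A B m₂) : m₁ = m₂ := by
  rcases lt_trichotomy m₁ m₂ with h' | h' | h'
  · exact absurd h (freqPhase_lt hA h₁ h' hc).ne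
  · exact h'
  · exact absurd h (freqPhase_lt hA h₂ h' (h ▸ hc)).ne'

/-- Intermediate values on `[0, c/B]`. The level `π/4` itself is left out, since it is attained at
`m = 0` and need not recur. -/
theorem exists_freqPhase_eq (hB : 0 < B) (n : ℕ) :
    ∃ m, 0 < m ∧ freqPhase A B m = (n + 1) * Real.pi + Real.pi / 4 := by
  obtain ⟨c, hcdef⟩ : ∃ c : ℝ, c = (n + 1) * Real.pi + Real.pi / 4 := ⟨_, rfl⟩
  rw [← hcdef]
  have hpi := Real.pi_pos
  have hc : Real.pi / 4 < c := by
    have : 0 < ((n : ℝ) + 1) * Real.pi := by positivity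
    linarith
  have hc0 : 0 < c := by linarith
  have h1 : c ≤ freqPhase A B (c / B) := by
    rw [freqPhase, div_mul_cancel₀ _ hB.ne']
    have := Real.arctan_nonneg.2 (Real.exp_pos (-(2 * (c / B) * A))).le
    linarith
  obtain ⟨m, hm, hmc⟩ := intermediate_value_Icc (div_nonneg hc0.le hB.le)
    (continuous_freqPhase (A := A) (B := B)).continuousOn
    ⟨(by rw [freqPhase_zero]; exact hc.le : freqPhase A B 0 ≤ c), h1⟩
  refine ⟨m, lt_of_le_of_ne hm.1 ?_, hmc⟩
  rintro rfl
  rw [freqPhase_zero] at hmc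
  exact hc.ne hmc

/-- The `n`-th frequency (with `n = 0` for the one near `5π/(4B)`). -/
noncomputable def freq (A : ℝ) {B : ℝ} (hB : 0 < B) (n : ℕ) : ℝ :=
  Classical.choose (exists_freqPhase_eq (A := A) hB n)

theorem freq_pos (A : ℝ) (hB : 0 < B) (n : ℕ) : 0 < freq A hB n :=
  (Classical.choose_spec (exists_freqPhase_eq (A := A) hB n)).1

theorem freqPhase_freq (A : ℝ) (hB : 0 < B) (n : ℕ) :
    freqPhase A B (freq A hB n) = (n + 1) * Real.pi + Real.pi / 4 :=
  (Classical.choose_spec (exists_freqPhase_eq (A := A) hB n)).2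

theorem isFreq_freq (A : ℝ) (hB : 0 < B) (n : ℕ) : IsFreq A B (freq A hB n) :=
  isFreq_iff.2 ⟨n + 1, by rw [freqPhase_freq]; push_cast; rfl⟩

theorem freq_injective (A : ℝ) (hB : 0 < B) : Function.Injective (freq A hB) := fun n m h => by
  have := congrArg (freqPhase A B) h
  rw [freqPhase_freq, freqPhase_freq, add_left_inj] at this
  have := mul_right_cancel₀ Real.pi_pos.ne' this
  exact_mod_cast add_right_cancel this

theorem IsFreq.eq_freq_or (hA : 0 < A) (hB : 0 < B) {m : ℝ} (hm : 0 < m) (h : IsFreq A B m) :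
    (∃ n, m = freq A hB n) ∨ freqPhase A B m = Real.pi / 4 := by
  obtain ⟨n, hn⟩ := isFreq_iff.1 h
  have hpi := Real.pi_pos
  have h0 : 0 < freqPhase A B m := by
    have := Real.arctan_nonneg.2 (Real.exp_pos (-(2 * m * A))).le
    have := mul_pos hm hB
    rw [freqPhase]; linarith
  have hn0 : 0 ≤ n := by
    by_contra! hneg
    have : (n : ℝ) ≤ -1 := by exact_mod_cast (by omega : n ≤ -1)
    nlinarith
  rcases hn0.eq_or_lt with rfl | hpos
  · right; simpa using hn
  · left
    refine ⟨(n - 1).toNat, freqPhase_inj (B := B) hA hm (freq_pos A hB _) ?_ ?_⟩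
    · rw [freqPhase_freq, hn]
      have : (((n - 1).toNat : ℤ) : ℝ) = n - 1 := by
        rw [Int.toNat_of_nonneg (by omega)]; push_cast; rfl
      rw [Int.cast_natCast] at this
      rw [this]; ring
    · rw [freqPhase_freq]
      have : 0 ≤ (((n - 1).toNat : ℝ) + 1) * Real.pi := by positivity
      linarith

/-- The model frequency `π (n + 5/4) / B`. -/
noncomputable def modelFreq (B : ℝ) (n : ℕ) : ℝ := Real.pi / B * (((n + 1 : ℕ) : ℝ) + 1 / 4)

theorem modelFreq_mul (hB : 0 < B) (n : ℕ) :
    modelFreq B n * B = (n + 1) * Real.pi + Real.pi / 4 := by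
  rw [modelFreq]; push_cast; field_simp

theorem freq_mul_add (A : ℝ) (hB : 0 < B) (n : ℕ) :
    freq A hB n * B + Real.arctan (Real.exp (-(2 * freq A hB n * A))) = modelFreq B n * B := by
  rw [modelFreq_mul hB, ← freqPhase_freq A hB, freqPhase]

theorem freq_le_modelFreq (A : ℝ) (hB : 0 < B) (n : ℕ) : freq A hB n ≤ modelFreq B n := by
  have h := freq_mul_add A hB n
  have := Real.arctan_nonneg.2 (Real.exp_pos (-(2 * freq A hB n * A))).le
  exact le_of_mul_le_mul_right (by linarith) hB

theorem pi_le_freq_mul (hA : 0 < A) (hB : 0 < B) (n : ℕ) :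
    (n + 1) * Real.pi ≤ freq A hB n * B := by
  have h := freq_mul_add A hB n
  rw [modelFreq_mul hB] at h
  have h1 : Real.arctan (Real.exp (-(2 * freq A hB n * A))) ≤ Real.pi / 4 := by
    rw [← Real.arctan_one]
    refine Real.arctan_strictMono.monotone (Real.exp_le_one_iff.2 ?_)
    have := mul_pos (freq_pos A hB n) hA
    linarith
  linarith

theorem add_one_le_freq (hA : 0 < A) (hB : 0 < B) (hB1 : B ≤ 1) (n : ℕ) :
    (n : ℝ) + 1 ≤ freq A hB n := by
  have h := pi_le_freq_mul hA hB n
  have h2 := freq_pos A hB n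
  have h3 : freq A hB n * B ≤ freq A hB n := mul_le_of_le_one_right h2.le hB1
  have h4 : (n : ℝ) + 1 ≤ (n + 1) * Real.pi :=
    le_mul_of_one_le_right (by positivity) (by linarith [Real.pi_gt_three])
  linarith

theorem modelFreq_le (hA : 0 < A) (hB : 0 < B) (n : ℕ) : modelFreq B n ≤ 2 * freq A hB n := by
  have h := pi_le_freq_mul hA hB n
  have h2 := modelFreq_mul hB n
  have h3 := Real.pi_pos
  have h4 : (0 : ℝ) ≤ n * Real.pi := by positivity
  exact le_of_mul_le_mul_right (by nlinarith) hB

theorem arctan_le_self {x : ℝ} (hx : 0 ≤ x) : Real.arctan x ≤ x := by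
  rcases hx.eq_or_lt with rfl | h
  · simp
  · have h1 : 0 < Real.arctan x := by simpa using Real.arctan_strictMono h
    have := Real.le_tan h1.le (Real.arctan_lt_pi_div_two x)
    rwa [Real.tan_arctan] at this

/-- The gap is `arctan(exp(-2mA))/B`, hence exponentially small. The cube is enough: it absorbs the
factor `m` in the difference of squared frequencies and still leaves a summable `m⁻²`. -/
theorem modelFreq_sub_freq_le (hA : 0 < A) (hB : 0 < B) (n : ℕ) :
    modelFreq B n - freq A hB n ≤ 1 / (A ^ 3 * B) / freq A hB n ^ 3 := by
  set m := freq A hB n with hm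
  have hm0 : 0 < m := freq_pos A hB n
  have h := freq_mul_add A hB n
  rw [← hm] at h
  have h1 := arctan_le_self (Real.exp_pos (-(2 * m * A))).le
  have h2 : Real.exp (-(2 * m * A)) ≤ 1 / (m * A) ^ 3 := by
    have h3 := Real.pow_div_factorial_le_exp (2 * m * A) (by positivity) 3
    rw [Real.exp_neg, inv_eq_one_div]
    refine one_div_le_one_div_of_le (by positivity) (le_trans ?_ h3)
    norm_num [Nat.factorial]
    rw [show (2 * m * A) ^ 3 = 8 * (m * A) ^ 3 by ring]
    have : 0 < (m * A) ^ 3 := by positivity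
    linarith
  have h4 : (modelFreq B n - m) * B ≤ 1 / (m * A) ^ 3 := by linarith
  calc modelFreq B n - m ≤ 1 / (m * A) ^ 3 / B := by rwa [le_div_iff₀ hB]
    _ = _ := by field_simp

/-! ### Enumeration of the eigenvalues -/

variable {b : ℝ} (hb : b ∈ Ioo (0 : ℝ) 1)

theorem one_sub_pos (hb : b ∈ Ioo (0 : ℝ) 1) : 0 < 1 - b := sub_pos.2 hb.2

/-- The positive eigenvalues, up to finitely many. -/
noncomputable def posEig (n : ℕ) : {l : ℝ // IsEigen b l} :=
  ⟨freq (1 - b) hb.1 n ^ 2, (isEigen_sq_iff (freq_pos _ _ n)).2 (isFreq_freq _ _ n)⟩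

/-- The negative eigenvalues, up to finitely many. -/
noncomputable def negEig (n : ℕ) : {l : ℝ // IsEigen b l} :=
  ⟨-freq b (one_sub_pos hb) n ^ 2,
    (isEigen_neg_sq_iff (freq_pos _ _ n)).2 (isFreq_freq _ _ n)⟩

theorem posEig_injective : Function.Injective (posEig hb) := fun n m h => by
  have : freq (1 - b) hb.1 n ^ 2 = freq (1 - b) hb.1 m ^ 2 := congrArg Subtype.val h
  exact freq_injective _ _ ((sq_eq_sq₀ (freq_pos _ _ n).le (freq_pos _ _ m).le).1 this)

theorem negEig_injective : Function.Injective (negEig hb) := fun n m h => by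
  have : -freq b (one_sub_pos hb) n ^ 2 = -freq b (one_sub_pos hb) m ^ 2 := congrArg Subtype.val h
  exact freq_injective _ _ ((sq_eq_sq₀ (freq_pos _ _ n).le (freq_pos _ _ m).le).1 (neg_inj.1 this))

theorem posEig_ne_negEig (n m : ℕ) : posEig hb n ≠ negEig hb m := fun h => by
  have : freq (1 - b) hb.1 n ^ 2 = -freq b (one_sub_pos hb) m ^ 2 := congrArg Subtype.val h
  nlinarith [freq_pos (1 - b) hb.1 n, freq_pos b (one_sub_pos hb) m]

/-- What remains is `l = 0` and, for each sign, at most one eigenvalue at the phase level `π/4`,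
where `freqPhase_inj` still applies. -/
theorem finite_rest : ((range (posEig hb) ∪ range (negEig hb))ᶜ).Finite := by
  have hA := one_sub_pos hb
  have s1 : {l : {l : ℝ // IsEigen b l} | (l : ℝ) = 0}.Subsingleton := fun x hx y hy =>
    Subtype.ext (hx.trans hy.symm)
  have s2 : {l : {l : ℝ // IsEigen b l} | 0 < (l : ℝ) ∧
      freqPhase (1 - b) b √l = Real.pi / 4}.Subsingleton := fun x hx y hy => by
    have := freqPhase_inj hA (Real.sqrt_pos.2 hx.1) (Real.sqrt_pos.2 hy.1) (hx.2.trans hy.2.symm)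
      hy.2.ge
    exact Subtype.ext ((Real.sqrt_inj hx.1.le hy.1.le).1 this)
  have s3 : {l : {l : ℝ // IsEigen b l} | (l : ℝ) < 0 ∧
      freqPhase b (1 - b) √(-l) = Real.pi / 4}.Subsingleton := fun x hx y hy => by
    have hx1 := neg_pos.2 hx.1
    have hy1 := neg_pos.2 hy.1
    have := freqPhase_inj hb.1 (Real.sqrt_pos.2 hx1) (Real.sqrt_pos.2 hy1) (hx.2.trans hy.2.symm)
      hy.2.ge
    exact Subtype.ext (neg_inj.1 ((Real.sqrt_inj hx1.le hy1.le).1 this))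
  refine ((s1.finite.union s2.finite).union s3.finite).subset fun l hl => ?_
  rw [mem_compl_iff, mem_union, not_or] at hl
  rcases lt_trichotomy (l : ℝ) 0 with h | h | h
  · right
    refine ⟨h, ?_⟩
    have hs := Real.sqrt_pos.2 (neg_pos.2 h)
    have he : (l : ℝ) = -√(-l) ^ 2 := by rw [Real.sq_sqrt (neg_pos.2 h).le, neg_neg]
    have hf : IsFreq b (1 - b) √(-l) := (isEigen_neg_sq_iff hs).1 (he ▸ l.2)
    refine (hf.eq_freq_or hb.1 hA hs).resolve_left ?_
    rintro ⟨n, hn⟩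
    exact hl.2 ⟨n, Subtype.ext (by rw [he, hn]; rfl)⟩
  · left; left; exact h
  · left; right
    refine ⟨h, ?_⟩
    have hs := Real.sqrt_pos.2 h
    have he : (l : ℝ) = √l ^ 2 := by rw [Real.sq_sqrt h.le]
    have hf : IsFreq (1 - b) b √l := (isEigen_sq_iff hs).1 (he ▸ l.2)
    refine (hf.eq_freq_or hA hb.1 hs).resolve_left ?_
    rintro ⟨n, hn⟩
    exact hl.1 ⟨n, Subtype.ext (by rw [he, hn]; rfl)⟩

/-- Unconditional convergence allows any exhaustion: the sets `S N`, made of the finite remainder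
and the first `N` members of each sequence, are cofinal and split disjointly. -/
theorem hasSum_split {E : Type*} [NormedAddCommGroup E] [CompleteSpace E]
    {F : {l : ℝ // IsEigen b l} → E} {v : E} (h : HasSum F v) :
    ∃ p q : E, Tendsto (fun N => ∑ n ∈ Finset.range N, F (posEig hb n)) atTop (𝓝 p) ∧
      Tendsto (fun N => ∑ n ∈ Finset.range N, F (negEig hb n)) atTop (𝓝 q) ∧
      v = ∑ l ∈ (finite_rest hb).toFinset, F l + p + q := by
  classical
  have hp := (h.summable.comp_injective (posEig_injective hb)).hasSum.tendsto_sum_nat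
  have hq := (h.summable.comp_injective (negEig_injective hb)).hasSum.tendsto_sum_nat
  refine ⟨_, _, hp, hq, ?_⟩
  set R := (finite_rest hb).toFinset with hR
  have hmem : ∀ {l}, l ∈ R ↔ l ∉ range (posEig hb) ∧ l ∉ range (negEig hb) := fun {l} => by
    rw [hR, Set.Finite.mem_toFinset, mem_compl_iff, mem_union, not_or]
  let S : ℕ → Finset {l : ℝ // IsEigen b l} := fun N =>
    R ∪ (Finset.range N).image (posEig hb) ∪ (Finset.range N).image (negEig hb)
  have hS : Tendsto S atTop atTop := by
    refine tendsto_atTop_finset_of_monotone (fun N M hNM => ?_) fun l => ?_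
    · have : Finset.range N ⊆ Finset.range M := Finset.range_subset_range.2 hNM
      exact Finset.union_subset_union (Finset.union_subset_union le_rfl
        (Finset.image_subset_image this)) (Finset.image_subset_image this)
    · by_cases h1 : l ∈ range (posEig hb)
      · obtain ⟨n, rfl⟩ := h1
        exact ⟨n + 1, Finset.mem_union_left _ (Finset.mem_union_right _
          (Finset.mem_image_of_mem _ (Finset.self_mem_range_succ n)))⟩
      by_cases h2 : l ∈ range (negEig hb)
      · obtain ⟨n, rfl⟩ := h2
        exact ⟨n + 1, Finset.mem_union_right _
          (Finset.mem_image_of_mem _ (Finset.self_mem_range_succ n))⟩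
      exact ⟨0, Finset.mem_union_left _ (Finset.mem_union_left _ (hmem.2 ⟨h1, h2⟩))⟩
  have hsum : ∀ N, ∑ l ∈ S N, F l = ∑ l ∈ R, F l + ∑ n ∈ Finset.range N, F (posEig hb n)
      + ∑ n ∈ Finset.range N, F (negEig hb n) := fun N => by
    rw [Finset.sum_union, Finset.sum_union, Finset.sum_image fun x _ y _ h => posEig_injective hb h,
      Finset.sum_image fun x _ y _ h => negEig_injective hb h]
    · refine Finset.disjoint_left.2 fun l hl hl' => ?_
      obtain ⟨n, -, rfl⟩ := Finset.mem_image.1 hl'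
      exact (hmem.1 hl).1 ⟨n, rfl⟩
    · refine Finset.disjoint_left.2 fun l hl hl' => ?_
      obtain ⟨n, -, rfl⟩ := Finset.mem_image.1 hl'
      rcases Finset.mem_union.1 hl with hl | hl
      · exact (hmem.1 hl).2 ⟨n, rfl⟩
      · obtain ⟨m, -, hm⟩ := Finset.mem_image.1 hl
        exact posEig_ne_negEig hb m n hm
  refine tendsto_nhds_unique (h.comp hS) ?_
  have := (tendsto_const_nhds (x := ∑ l ∈ R, F l)).add hp |>.add hq
  refine this.congr fun N => ?_
  exact (hsum N).symm

end

section

/-! ### Normalised eigenfunctions -/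

/-- The function that is `sin (m x)` on `[0, B]`, continued to `[B, 1]` by a multiple of
`sinh (m (1 - x))`. -/
noncomputable def mode (B m : ℝ) : ℝ → ℝ :=
  glue B (fun x => Real.sin (m * x))
    (fun x => Real.sin (m * B) * (Real.sinh (m * (1 - x)) / Real.sinh (m * (1 - B))))

section Mode

variable {B m : ℝ}

theorem sinh_pos (hB : B ∈ Ioo (0 : ℝ) 1) (hm : 0 < m) : 0 < Real.sinh (m * (1 - B)) :=
  Real.sinh_pos_iff.2 (mul_pos hm (one_sub_pos hB))

theorem mode_of_le {x : ℝ} (h : x ≤ B) : mode B m x = Real.sin (m * x) := glue_of_le _ _ h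

theorem mode_of_ge (hB : B ∈ Ioo (0 : ℝ) 1) (hm : 0 < m) {x : ℝ} (h : B ≤ x) :
    mode B m x = Real.sin (m * B) * (Real.sinh (m * (1 - x)) / Real.sinh (m * (1 - B))) :=
  glue_of_ge (by simp [div_self (sinh_pos hB hm).ne']) h

theorem continuous_mode (hB : B ∈ Ioo (0 : ℝ) 1) (hm : 0 < m) : Continuous (mode B m) :=
  glue_continuous (by fun_prop) (by fun_prop) (by simp [div_self (sinh_pos hB hm).ne'])

theorem sinh_div_sinh_le (hB : B ∈ Ioo (0 : ℝ) 1) (hm : 0 < m) {x : ℝ} (h : B ≤ x) :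
    Real.sinh (m * (1 - x)) / Real.sinh (m * (1 - B)) ≤ Real.exp (-(m * (x - B))) := by
  rw [div_le_iff₀ (sinh_pos hB hm), Real.sinh_eq, Real.sinh_eq, mul_div_assoc', mul_sub (Real.exp _),
    ← Real.exp_add, ← Real.exp_add]
  have h1 : -(m * (x - B)) + m * (1 - B) = m * (1 - x) := by ring
  have h2 : Real.exp (-(m * (x - B)) + -(m * (1 - B))) ≤ Real.exp (-(m * (1 - x))) :=
    Real.exp_le_exp.2 (by nlinarith)
  rw [h1]
  linarith

theorem sinh_div_sinh_nonneg (hB : B ∈ Ioo (0 : ℝ) 1) (hm : 0 < m) {x : ℝ} (h : x ≤ 1) :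
    0 ≤ Real.sinh (m * (1 - x)) / Real.sinh (m * (1 - B)) :=
  div_nonneg (Real.sinh_nonneg_iff.2 (mul_nonneg hm.le (sub_nonneg.2 h))) (sinh_pos hB hm).le

theorem abs_mode_le_exp (hB : B ∈ Ioo (0 : ℝ) 1) (hm : 0 < m) {x : ℝ} (h : B ≤ x) (h1 : x ≤ 1) :
    |mode B m x| ≤ Real.exp (-(m * (x - B))) := by
  rw [mode_of_ge hB hm h, abs_mul, abs_of_nonneg (sinh_div_sinh_nonneg hB hm h1)]
  exact (mul_le_of_le_one_left (sinh_div_sinh_nonneg hB hm h1) (Real.abs_sin_le_one _)).trans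
    (sinh_div_sinh_le hB hm h)

theorem abs_mode_le_one (hB : B ∈ Ioo (0 : ℝ) 1) (hm : 0 < m) {x : ℝ} (h1 : x ≤ 1) :
    |mode B m x| ≤ 1 := by
  rcases le_total x B with h | h
  · rw [mode_of_le h]; exact Real.abs_sin_le_one _
  · refine (abs_mode_le_exp hB hm h h1).trans (Real.exp_le_one_iff.2 ?_)
    have := mul_nonneg hm.le (sub_nonneg.2 h)
    linarith

theorem integral_sin_mul_sq (hm : 0 < m) :
    ∫ x in (0 : ℝ)..B, Real.sin (m * x) ^ 2 =
      B / 2 - Real.sin (m * B) * Real.cos (m * B) / (2 * m) := by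
  have h : ∀ x ∈ uIcc 0 B, HasDerivAt
      (fun x => x / 2 - Real.sin (m * x) * Real.cos (m * x) / (2 * m)) (Real.sin (m * x) ^ 2) x := by
    intro x _
    have h0 : HasDerivAt (fun x => m * x) m x := by simpa using (hasDerivAt_id x).const_mul m
    convert! ((hasDerivAt_id x).div_const 2).sub ((h0.sin.mul h0.cos).div_const (2 * m)) using 1
    field_simp
    nlinarith [Real.sin_sq_add_cos_sq (m * x)]
  rw [intervalIntegral.integral_eq_sub_of_hasDerivAt h
    (Continuous.intervalIntegrable (by fun_prop) _ _)]
  simp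

theorem integral_sinh_mul_sq (hm : 0 < m) :
    ∫ x in B..1, Real.sinh (m * (1 - x)) ^ 2 =
      Real.sinh (m * (1 - B)) * Real.cosh (m * (1 - B)) / (2 * m) - (1 - B) / 2 := by
  have h : ∀ x ∈ uIcc B 1, HasDerivAt
      (fun x => (1 - x) / 2 - Real.sinh (m * (1 - x)) * Real.cosh (m * (1 - x)) / (2 * m))
      (Real.sinh (m * (1 - x)) ^ 2) x := by
    intro x _
    have h1 : HasDerivAt (fun x : ℝ => 1 - x) (-1) x := by
      simpa using (hasDerivAt_id x).const_sub 1
    have h0 : HasDerivAt (fun x => m * (1 - x)) (m * -1) x := h1.const_mul m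
    convert! (h1.div_const 2).sub ((h0.sinh.mul h0.cosh).div_const (2 * m)) using 1
    field_simp
    nlinarith [Real.cosh_sq (m * (1 - x))]
  rw [intervalIntegral.integral_eq_sub_of_hasDerivAt h
    (Continuous.intervalIntegrable (by fun_prop) _ _)]
  simp

theorem integral_mode_sq_split (hB : B ∈ Ioo (0 : ℝ) 1) (hm : 0 < m) :
    ∫ x in (0 : ℝ)..1, mode B m x ^ 2 = (∫ x in (0 : ℝ)..B, Real.sin (m * x) ^ 2) +
      (Real.sin (m * B) / Real.sinh (m * (1 - B))) ^ 2 *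
        ∫ x in B..1, Real.sinh (m * (1 - x)) ^ 2 := by
  have hc : Continuous fun x => mode B m x ^ 2 := (continuous_mode hB hm).pow 2
  rw [← intervalIntegral.integral_add_adjacent_intervals (hc.intervalIntegrable 0 B)
    (hc.intervalIntegrable B 1), ← intervalIntegral.integral_const_mul]
  congr 1
  · refine intervalIntegral.integral_congr fun x hx => ?_
    rw [uIcc_of_le hB.1.le] at hx
    simp only [mode_of_le hx.2]
  · refine intervalIntegral.integral_congr fun x hx => ?_
    rw [uIcc_of_le hB.2.le] at hx
    simp only [mode_of_ge hB hm hx.1]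
    ring

/-- The boundary terms of the two intervals cancel exactly because of the characteristic equation.
-/
theorem integral_mode_sq (hB : B ∈ Ioo (0 : ℝ) 1) (hm : 0 < m) (h : IsFreq (1 - B) B m) :
    ∫ x in (0 : ℝ)..1, mode B m x ^ 2 =
      B / 2 - (1 - B) / 2 * (Real.sin (m * B) / Real.sinh (m * (1 - B))) ^ 2 := by
  rw [integral_mode_sq_split hB hm, integral_sin_mul_sq hm, integral_sinh_mul_sq hm]
  have hs := (sinh_pos hB hm).ne'
  have h' : Real.sinh (m * (1 - B)) * Real.cos (m * B) = Real.sin (m * B) * Real.cosh (m * (1 - B)) := h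
  have : Real.cos (m * B) = Real.sin (m * B) * Real.cosh (m * (1 - B)) / Real.sinh (m * (1 - B)) := by
    rw [eq_div_iff hs, ← h']; ring
  rw [this]
  field_simp
  ring

theorem abs_integral_mode_sq_sub_le (hB : B ∈ Ioo (0 : ℝ) 1) (hm : 0 < m) (h : IsFreq (1 - B) B m) :
    |(∫ x in (0 : ℝ)..1, mode B m x ^ 2) - B / 2| ≤ 1 / (2 * (1 - B)) / m ^ 2 := by
  have hA := one_sub_pos hB
  have h1 : m * (1 - B) ≤ Real.sinh (m * (1 - B)) := Real.self_le_sinh_iff.2 (by positivity)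
  rw [integral_mode_sq hB hm h, sub_sub_cancel_left, abs_neg, abs_of_nonneg (by positivity), div_pow]
  calc (1 - B) / 2 * (Real.sin (m * B) ^ 2 / Real.sinh (m * (1 - B)) ^ 2)
      ≤ (1 - B) / 2 * (1 / (m * (1 - B)) ^ 2) := by
        gcongr
        exact Real.sin_sq_le_one _
    _ = _ := by field_simp

/-- A lower bound for dividing: the part on `[0,B]` alone suffices, since `sin cos ≤ 1/2` and `1 ≤
mB`. -/
theorem le_integral_mode_sq (hB : B ∈ Ioo (0 : ℝ) 1) (hm : 0 < m) (h : 1 ≤ m * B) :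
    B / 4 ≤ ∫ x in (0 : ℝ)..1, mode B m x ^ 2 := by
  rw [integral_mode_sq_split hB hm, integral_sin_mul_sq hm]
  have h1 : 0 ≤ ∫ x in B..1, Real.sinh (m * (1 - x)) ^ 2 :=
    intervalIntegral.integral_nonneg hB.2.le fun x _ => sq_nonneg _
  have h2 : Real.sin (m * B) * Real.cos (m * B) / (2 * m) ≤ B / 4 := by
    rw [div_le_iff₀ (by positivity)]
    nlinarith [Real.sin_sq_add_cos_sq (m * B), sq_nonneg (Real.sin (m * B) - Real.cos (m * B))]
  have := mul_nonneg (sq_nonneg (Real.sin (m * B) / Real.sinh (m * (1 - B)))) h1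
  linarith

end Mode

/-! ### Eigenfunctions in terms of modes -/

theorem eigfun_sq {b m : ℝ} (hb : b ∈ Ioo (0 : ℝ) 1) (hm : 0 < m) (x : ℝ) :
    eigfun b (m ^ 2) x = Real.sinh (m * (1 - b)) / m ^ 2 * mode b m x := by
  have h1 : (0 : ℝ) < m ^ 2 := by positivity
  have h2 : -m ^ 2 < 0 := by linarith
  have hs := (sinh_pos hb hm).ne'
  rw [eigfun]
  rcases le_or_gt x b with h | h
  · rw [glue_of_le _ _ h, mode_of_le h, sinGen_neg h2, sinGen_pos h1, neg_neg, Real.sqrt_sq hm.le]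
    field_simp
  · rw [glue_of_lt _ _ h, mode_of_ge hb hm h.le, sinGen_neg h2, sinGen_pos h1, neg_neg,
      Real.sqrt_sq hm.le]
    field_simp

/-- The reflection `x ↦ 1 - x` exchanges the oscillating and the exponential interval, so one family
of modes serves both signs. -/
theorem eigfun_neg_sq {b m : ℝ} (hb : b ∈ Ioo (0 : ℝ) 1) (hm : 0 < m) (x : ℝ) :
    eigfun b (-m ^ 2) x = Real.sinh (m * b) / m ^ 2 * mode (1 - b) m (1 - x) := by
  have h1 : (0 : ℝ) < m ^ 2 := by positivity
  have h2 : -m ^ 2 < 0 := by linarith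
  have hb' : 1 - b ∈ Ioo (0 : ℝ) 1 := ⟨one_sub_pos hb, by linarith [hb.1]⟩
  have hs := (sinh_pos hb' hm).ne'
  rw [sub_sub_cancel] at hs
  rw [eigfun]
  rcases le_or_gt x b with h | h
  · rw [glue_of_le _ _ h, mode_of_ge hb' hm (by linarith), sinGen_neg h2, neg_neg, sinGen_pos h1,
      Real.sqrt_sq hm.le, sub_sub_cancel, sub_sub_cancel]
    field_simp
  · rw [glue_of_lt _ _ h, mode_of_le (by linarith), sinGen_neg h2, neg_neg, sinGen_pos h1,
      Real.sqrt_sq hm.le]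
    field_simp

/-- The generalised Fourier coefficient of `u` along the real function `φ`. -/
noncomputable def genCoeff (φ : ℝ → ℝ) (u : ℝ → ℂ) : ℂ :=
  (∫ x in (0 : ℝ)..1, (φ x : ℂ) * u x) / ((∫ x in (0 : ℝ)..1, φ x ^ 2 : ℝ) : ℂ)

/-- A term of the expansion depends only on the line spanned by `φ`, so `eigfun` may be replaced by
the better scaled `mode`. -/
theorem genCoeff_mul {σ : ℝ} (hσ : σ ≠ 0) (φ : ℝ → ℝ) (u : ℝ → ℂ) (x : ℝ) :
    genCoeff (fun y => σ * φ y) u * ((σ * φ x : ℝ) : ℂ) = genCoeff φ u * (φ x : ℂ) := by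
  have hσ' : (σ : ℂ) ≠ 0 := by exact_mod_cast hσ
  simp only [genCoeff, mul_pow, intervalIntegral.integral_const_mul, Complex.ofReal_mul, mul_assoc,
    Complex.ofReal_pow]
  rw [div_mul_eq_mul_div, div_mul_eq_mul_div, pow_two]
  -- If the integral of `φ²` is zero, both sides are zero because division by zero gives zero.
  by_cases h : ((∫ x in (0 : ℝ)..1, φ x ^ 2 : ℝ) : ℂ) = 0
  · simp [h]
  · field_simp

variable {b : ℝ} (hb : b ∈ Ioo (0 : ℝ) 1)

theorem inner_eigvec_div_eq {u : ℝ → ℂ} (hu : MemLp u 2 unitMeasure) (l : {l : ℝ // IsEigen b l}) :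
    inner ℂ (eigvec b hb l) (hu.toLp u) / (‖eigvec b hb l‖ : ℂ) ^ 2 = genCoeff (eigfun b l) u := by
  have h : ((‖eigvec b hb l‖ : ℂ)) ^ 2 = inner ℂ (eigvec b hb l) (eigvec b hb l) := by
    rw [inner_self_eq_norm_sq_to_K]; rfl
  rw [h, genCoeff, eigvec, inner_toLp, inner_toLp, integral_unitMeasure, integral_unitMeasure,
    ← intervalIntegral.integral_ofReal]
  simp only [Complex.conj_ofReal, Complex.ofReal_mul, pow_two]

end

section

/-! ### Asymptotics of the generalised Fourier coefficients -/

theorem abs_sin_sub_sin_le (x y : ℝ) : |Real.sin x - Real.sin y| ≤ |x - y| := by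
  have := Convex.norm_image_sub_le_of_norm_deriv_le (f := Real.sin) (s := univ) (C := 1)
    (fun _ _ => Real.differentiableAt_sin) (fun z _ => by
      rw [Real.deriv_sin]; exact Real.abs_cos_le_one z) convex_univ (mem_univ y) (mem_univ x)
  simpa using this

variable {b : ℝ} {u : ℝ → ℂ}

/-- The pairing of `u` with `sin (m ·)` on `[0, b]`, plus the leading contribution of `[b, 1]`. -/
noncomputable def leadingPairing (b : ℝ) (u : ℝ → ℂ) (m : ℝ) : ℂ :=
  (∫ y in (0 : ℝ)..b, (Real.sin (m * y) : ℂ) * u y) +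
    Function.rightLim u b * ((Real.sin (m * b) / m : ℝ) : ℂ)

theorem intervalIntegrable_real_mul {f : ℝ → ℝ} (hf : Continuous f) {c d : ℝ}
    (hu : IntervalIntegrable u volume c d) :
    IntervalIntegrable (fun y => (f y : ℂ) * u y) volume c d :=
  hu.continuousOn_mul (Complex.continuous_ofReal.comp hf).continuousOn

/-- Integrating the cosine gives `sin(Mb)/(Mb)`, so the second term of `coeff` is the leading
contribution of `(b,1)` at the model frequency. The shift to `n + 1` reflects that `modelFreq` is
numbered from zero. -/
theorem coeff_succ_eq (hb : b ∈ Ioo (0 : ℝ) 1) (hu : IntervalIntegrable u volume 0 1) (n : ℕ) :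
    coeff b u (n + 1) = ((2 / b : ℝ) : ℂ) * leadingPairing b u (modelFreq b n) := by
  set M := modelFreq b n with hM
  have hM0 : 0 < M := by
    have := Real.pi_pos
    have := hb.1
    rw [hM, modelFreq]; positivity
  have hMb : Real.pi * (((n + 1 : ℕ) : ℝ) + 1 / 4) = M * b := by
    rw [hM, modelFreq]; have := hb.1.ne'; field_simp
  have hbC : (b : ℂ) ≠ 0 := by exact_mod_cast hb.1.ne'
  have hub : IntervalIntegrable u volume 0 b := hu.mono_set (by
    rw [uIcc_of_le hb.1.le, uIcc_of_le zero_le_one]; exact Icc_subset_Icc_right hb.2.le)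
  have h1 : IntervalIntegrable (fun y => (Real.sin (M * y) : ℂ) * u y) volume 0 b :=
    intervalIntegrable_real_mul (f := fun y => Real.sin (M * y)) (by fun_prop) hub
  have h2 : ∫ y in (0 : ℝ)..1, (Real.sin (M * (b * y)) : ℂ) * u (b * y)
      = ((b⁻¹ : ℝ) : ℂ) * ∫ y in (0 : ℝ)..b, (Real.sin (M * y) : ℂ) * u y := by
    rw [intervalIntegral.integral_comp_mul_left (fun y => (Real.sin (M * y) : ℂ) * u y) hb.1.ne']
    simp
  have h3 : ∫ y in (0 : ℝ)..1, (Real.cos (M * b * y) : ℂ) = ((Real.sin (M * b) / (M * b) : ℝ) : ℂ) := by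
    rw [intervalIntegral.integral_ofReal, intervalIntegral.integral_comp_mul_left Real.cos
      (mul_pos hM0 hb.1).ne', integral_cos]
    simp [div_eq_inv_mul]
  have h4 : IntervalIntegrable (fun y => (Real.sin (M * (b * y)) : ℂ) * u (b * y)) volume 0 1 := by
    have := h1.comp_mul_left (c := b)
    simpa [hb.1.ne'] using this
  have h5 : IntervalIntegrable (fun y => Function.rightLim u b * (Real.cos (M * b * y) : ℂ))
      volume 0 1 := Continuous.intervalIntegrable (by fun_prop) _ _
  rw [coeff]
  simp only [hMb]
  have e : ∀ y : ℝ, u (b * y) * (Real.sin (M * b * y) : ℂ) +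
      Function.rightLim u b * (Real.cos (M * b * y) : ℂ) =
      (Real.sin (M * (b * y)) : ℂ) * u (b * y) +
      Function.rightLim u b * (Real.cos (M * b * y) : ℂ) := fun y => by rw [mul_assoc M]; ring
  simp only [e]
  rw [intervalIntegral.integral_add h4 h5, h2, intervalIntegral.integral_const_mul, h3,
    leadingPairing]
  have hMC : (M : ℂ) ≠ 0 := by exact_mod_cast hM0.ne'
  push_cast
  field_simp

theorem norm_coeff_le (hb : b ∈ Ioo (0 : ℝ) 1) {U : ℝ} (hU : ∀ y ∈ Icc (0 : ℝ) 1, ‖u y‖ ≤ U) (n : ℕ) :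
    ‖coeff b u n‖ ≤ 2 * (U + ‖Function.rightLim u b‖) := by
  rw [coeff, norm_mul, Complex.norm_ofNat]
  refine mul_le_mul_of_nonneg_left ?_ (by norm_num)
  refine (intervalIntegral.norm_integral_le_of_norm_le_const (C := U + ‖Function.rightLim u b‖)
    fun y hy => ?_).trans (by simp)
  rw [uIoc_of_le zero_le_one] at hy
  have hby : b * y ∈ Icc (0 : ℝ) 1 := ⟨mul_nonneg hb.1.le hy.1.le, mul_le_one₀ hb.2.le hy.1.le hy.2⟩
  refine (norm_add_le _ _).trans (add_le_add ?_ ?_)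
  · rw [norm_mul, Complex.norm_real]
    exact (mul_le_of_le_one_right (norm_nonneg _) (Real.abs_sin_le_one _)).trans (hU _ hby)
  · rw [norm_mul, Complex.norm_real]
    exact mul_le_of_le_one_right (norm_nonneg _) (Real.abs_cos_le_one _)

theorem norm_leadingPairing_sub_le (hb : b ∈ Ioo (0 : ℝ) 1) (hu : IntervalIntegrable u volume 0 1)
    {U : ℝ} (hU : ∀ y ∈ Icc (0 : ℝ) 1, ‖u y‖ ≤ U) {m M : ℝ} (hm : 1 ≤ m) (hM : 1 ≤ M) :
    ‖leadingPairing b u m - leadingPairing b u M‖ ≤ (U + 2 * ‖Function.rightLim u b‖) * |m - M| := by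
  have hub : IntervalIntegrable u volume 0 b := hu.mono_set (by
    rw [uIcc_of_le hb.1.le, uIcc_of_le zero_le_one]; exact Icc_subset_Icc_right hb.2.le)
  have hi : ∀ m : ℝ, IntervalIntegrable (fun y => (Real.sin (m * y) : ℂ) * u y) volume 0 b := fun m =>
    intervalIntegrable_real_mul (f := fun y => Real.sin (m * y)) (by fun_prop) hub
  have hU0 : 0 ≤ U := (norm_nonneg _).trans (hU 0 (by simp))
  have e : leadingPairing b u m - leadingPairing b u M =
      (∫ y in (0 : ℝ)..b, ((Real.sin (m * y) : ℂ) * u y - (Real.sin (M * y) : ℂ) * u y)) +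
        Function.rightLim u b * ((Real.sin (m * b) / m - Real.sin (M * b) / M : ℝ) : ℂ) := by
    rw [intervalIntegral.integral_sub (hi m) (hi M), leadingPairing, leadingPairing]
    push_cast; ring
  have h1 : ‖∫ y in (0 : ℝ)..b, ((Real.sin (m * y) : ℂ) * u y - (Real.sin (M * y) : ℂ) * u y)‖
      ≤ U * |m - M| := by
    refine (intervalIntegral.norm_integral_le_of_norm_le_const (C := U * |m - M|)
      fun y hy => ?_).trans ?_
    · rw [uIoc_of_le hb.1.le] at hy
      have hy1 : y ≤ 1 := hy.2.trans hb.2.le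
      rw [← sub_mul, ← Complex.ofReal_sub, norm_mul, Complex.norm_real, mul_comm]
      refine mul_le_mul (hU y ⟨hy.1.le, hy1⟩) ?_ (norm_nonneg _) hU0
      refine (abs_sin_sub_sin_le _ _).trans ?_
      rw [← sub_mul, abs_mul, abs_of_pos hy.1]
      exact mul_le_of_le_one_right (abs_nonneg _) hy1
    · rw [sub_zero, abs_of_pos hb.1]
      exact mul_le_of_le_one_right (by positivity) hb.2.le
  have h2 : |Real.sin (m * b) / m - Real.sin (M * b) / M| ≤ 2 * |m - M| := by
    have hm0 : 0 < m := by linarith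
    have hM0 : 0 < M := by linarith
    have e2 : Real.sin (m * b) / m - Real.sin (M * b) / M =
        (Real.sin (m * b) - Real.sin (M * b)) / m + Real.sin (M * b) * ((M - m) / (m * M)) := by
      field_simp; ring
    have e3 : |(Real.sin (m * b) - Real.sin (M * b)) / m| ≤ |m - M| := by
      rw [abs_div, abs_of_pos hm0]
      refine (div_le_self (abs_nonneg _) hm).trans ((abs_sin_sub_sin_le _ _).trans ?_)
      rw [← sub_mul, abs_mul, abs_of_pos hb.1]
      exact mul_le_of_le_one_right (abs_nonneg _) hb.2.le
    have e4 : |Real.sin (M * b) * ((M - m) / (m * M))| ≤ |m - M| := by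
      rw [abs_mul, abs_div, abs_of_pos (mul_pos hm0 hM0), abs_sub_comm M m]
      refine (mul_le_of_le_one_left (by positivity) (Real.abs_sin_le_one _)).trans ?_
      exact div_le_self (abs_nonneg _) (one_le_mul_of_one_le_of_one_le hm hM)
    rw [e2]
    exact (abs_add_le _ _).trans (by linarith)
  rw [e]
  refine (norm_add_le _ _).trans ?_
  rw [norm_mul, Complex.norm_real, Real.norm_eq_abs]
  have := mul_le_mul_of_nonneg_left h2 (norm_nonneg (Function.rightLim u b))
  linarith

/-! ### The contribution of the exponential tail on `(b,1)` -/

theorem integral_sub_mul_exp_le {m : ℝ} (hm : 0 < m) (hb : b ≤ 1) :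
    ∫ y in b..1, (y - b) * Real.exp (-(m * (y - b))) ≤ 1 / m ^ 2 := by
  have h : ∀ x ∈ uIcc b 1, HasDerivAt (fun y => -((y - b) / m + 1 / m ^ 2) * Real.exp (-(m * (y - b))))
      ((x - b) * Real.exp (-(m * (x - b)))) x := by
    intro x _
    have h0 : HasDerivAt (fun y => y - b) 1 x := (hasDerivAt_id x).sub_const b
    have h1 : HasDerivAt (fun y => -(m * (y - b))) (-(m * 1)) x := (h0.const_mul m).neg
    convert! ((h0.div_const m).add_const (1 / m ^ 2)).neg.mul h1.exp using 1
    simp only [Pi.neg_apply]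
    field_simp
    ring
  rw [intervalIntegral.integral_eq_sub_of_hasDerivAt h
    (Continuous.intervalIntegrable (by fun_prop) _ _)]
  have : 0 ≤ ((1 - b) / m + 1 / m ^ 2) * Real.exp (-(m * (1 - b))) := by
    have := sub_nonneg.2 hb
    positivity
  simp only [sub_self, zero_div, zero_add, mul_zero, neg_zero, Real.exp_zero, mul_one]
  linarith

theorem integral_sinh_mul {m : ℝ} (hm : 0 < m) :
    ∫ y in b..1, Real.sinh (m * (1 - y)) = (Real.cosh (m * (1 - b)) - 1) / m := by
  have h : ∀ x ∈ uIcc b 1, HasDerivAt (fun y => -(Real.cosh (m * (1 - y)) / m))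
      (Real.sinh (m * (1 - x))) x := by
    intro x _
    have h0 : HasDerivAt (fun y : ℝ => 1 - y) (-1) x := by
      simpa using (hasDerivAt_id x).const_sub 1
    convert! ((h0.const_mul m).cosh.div_const m).neg using 1
    field_simp
  rw [intervalIntegral.integral_eq_sub_of_hasDerivAt h
    (Continuous.intervalIntegrable (by fun_prop) _ _)]
  simp
  ring

/-- On `(b,1)` the mode is `sin(mb)` times a tail of mass `1/m + O(m⁻²)`. Replacing `u` by its right
limit costs at most `C ∫ (y-b) exp(-m(y-b)) dy ≤ C/m²`. -/
theorem norm_integral_mode_sub_le (hb : b ∈ Ioo (0 : ℝ) 1) (hu : IntervalIntegrable u volume 0 1)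
    {C : ℝ} (hC : ∀ y ∈ Ioo b 1, ‖u y - Function.rightLim u b‖ ≤ C * (y - b)) {m : ℝ} (hm : 0 < m) :
    ‖(∫ y in (0 : ℝ)..1, (mode b m y : ℂ) * u y) - leadingPairing b u m‖ ≤
      (C + ‖Function.rightLim u b‖ / (1 - b)) / m ^ 2 := by
  set r := Function.rightLim u b with hr
  have hA := one_sub_pos hb
  have hs := sinh_pos hb hm
  have hu1 : IntervalIntegrable u volume 0 b := hu.mono_set (by
    rw [uIcc_of_le hb.1.le, uIcc_of_le zero_le_one]; exact Icc_subset_Icc_right hb.2.le)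
  have hu2 : IntervalIntegrable u volume b 1 := hu.mono_set (by
    rw [uIcc_of_le hb.2.le, uIcc_of_le zero_le_one]; exact Icc_subset_Icc_left hb.1.le)
  set ρ : ℝ → ℝ := fun y => Real.sinh (m * (1 - y)) / Real.sinh (m * (1 - b)) with hρ
  have hρc : Continuous ρ := by rw [hρ]; fun_prop
  have hmc := continuous_mode hb hm
  have i1 : ∫ y in (0 : ℝ)..b, (mode b m y : ℂ) * u y = ∫ y in (0 : ℝ)..b, (Real.sin (m * y) : ℂ) * u y := by
    refine intervalIntegral.integral_congr fun y hy => ?_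
    rw [uIcc_of_le hb.1.le] at hy
    simp only [mode_of_le hy.2]
  have hd : IntervalIntegrable (fun y => (ρ y : ℂ) * (u y - r)) volume b 1 :=
    intervalIntegrable_real_mul hρc (hu2.sub intervalIntegrable_const)
  have hρi : IntervalIntegrable (fun y => (ρ y : ℂ) * r) volume b 1 :=
    intervalIntegrable_real_mul hρc intervalIntegrable_const
  have i2 : ∫ y in b..1, (mode b m y : ℂ) * u y = (Real.sin (m * b) : ℂ) *
      ((∫ y in b..1, (ρ y : ℂ) * (u y - r)) + ((∫ y in b..1, ρ y : ℝ) : ℂ) * r) := by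
    rw [← intervalIntegral.integral_ofReal, ← intervalIntegral.integral_mul_const,
      ← intervalIntegral.integral_add hd hρi, ← intervalIntegral.integral_const_mul]
    refine intervalIntegral.integral_congr fun y hy => ?_
    rw [uIcc_of_le hb.2.le] at hy
    simp only [mode_of_ge hb hm hy.1, Complex.ofReal_mul, hρ]
    ring
  have n1 : ‖∫ y in b..1, (ρ y : ℂ) * (u y - r)‖ ≤ C / m ^ 2 := by
    refine (intervalIntegral.norm_integral_le_of_norm_le (a := b) (b := 1) hb.2.le
      (g := fun y => C * ((y - b) * Real.exp (-(m * (y - b))))) ?_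
      (Continuous.intervalIntegrable (by fun_prop) _ _)).trans ?_
    · filter_upwards [ae_ne 1] with y hy1 hy
      rw [norm_mul, Complex.norm_real, Real.norm_eq_abs,
        abs_of_nonneg (sinh_div_sinh_nonneg hb hm hy.2), mul_left_comm, mul_comm]
      have hC' := hC y ⟨hy.1, lt_of_le_of_ne hy.2 hy1⟩
      rw [mul_left_comm, ← mul_assoc]
      exact mul_le_mul hC' (sinh_div_sinh_le hb hm hy.1.le) (sinh_div_sinh_nonneg hb hm hy.2)
        ((norm_nonneg _).trans hC')
    · rw [intervalIntegral.integral_const_mul, div_eq_mul_one_div C]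
      have hC0 : 0 ≤ C := by
        have h := (norm_nonneg _).trans (hC ((b + 1) / 2) ⟨by linarith, by linarith⟩)
        exact nonneg_of_mul_nonneg_left h (by linarith)
      exact mul_le_mul_of_nonneg_left (integral_sub_mul_exp_le hm hb.2.le) hC0
  have n2 : |(∫ y in b..1, ρ y) - 1 / m| ≤ 1 / (1 - b) / m ^ 2 := by
    rw [hρ, intervalIntegral.integral_div, integral_sinh_mul hm]
    have e : (Real.cosh (m * (1 - b)) - 1) / m / Real.sinh (m * (1 - b)) - 1 / m =
        (Real.exp (-(m * (1 - b))) - 1) / (m * Real.sinh (m * (1 - b))) := by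
      rw [← Real.cosh_sub_sinh]; field_simp; ring
    have h1 : |Real.exp (-(m * (1 - b))) - 1| ≤ 1 := by
      have h2 := Real.exp_pos (-(m * (1 - b)))
      have h3 : Real.exp (-(m * (1 - b))) ≤ 1 := Real.exp_le_one_iff.2 (by nlinarith)
      rw [abs_le]; constructor <;> linarith
    have h4 : m * (1 - b) ≤ Real.sinh (m * (1 - b)) := Real.self_le_sinh_iff.2 (by positivity)
    rw [e, abs_div, abs_of_pos (mul_pos hm hs)]
    calc _ ≤ 1 / (m * (m * (1 - b))) := by gcongr
      _ = _ := by field_simp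
  have i3 : (∫ y in (0 : ℝ)..1, (mode b m y : ℂ) * u y) - leadingPairing b u m =
      (Real.sin (m * b) : ℂ) * ((∫ y in b..1, (ρ y : ℂ) * (u y - r)) +
        (((∫ y in b..1, ρ y) - 1 / m : ℝ) : ℂ) * r) := by
    rw [← intervalIntegral.integral_add_adjacent_intervals (intervalIntegrable_real_mul hmc hu1)
      (intervalIntegrable_real_mul hmc hu2), i1, i2, leadingPairing, ← hr]
    push_cast; ring
  rw [i3, norm_mul, Complex.norm_real]
  refine (mul_le_of_le_one_left (norm_nonneg _) (Real.abs_sin_le_one _)).trans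
    ((norm_add_le _ _).trans ?_)
  rw [norm_mul, Complex.norm_real, Real.norm_eq_abs, add_div]
  refine add_le_add n1 ((mul_le_mul_of_nonneg_right n2 (norm_nonneg r)).trans (le_of_eq ?_))
  field_simp

theorem norm_integral_mode_le {B : ℝ} (hB : B ∈ Ioo (0 : ℝ) 1) {U : ℝ}
    (hU : ∀ y ∈ Icc (0 : ℝ) 1, ‖u y‖ ≤ U) {m : ℝ} (hm : 0 < m) :
    ‖∫ y in (0 : ℝ)..1, (mode B m y : ℂ) * u y‖ ≤ U := by
  refine (intervalIntegral.norm_integral_le_of_norm_le_const (C := U) fun y hy => ?_).trans (by simp)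
  rw [uIoc_of_le zero_le_one] at hy
  rw [norm_mul, Complex.norm_real]
  exact (mul_le_of_le_one_left (norm_nonneg _) (abs_mode_le_one hB hm hy.2)).trans
    (hU y ⟨hy.1.le, hy.2⟩)

theorem norm_genCoeff_mode_le {B : ℝ} (hB : B ∈ Ioo (0 : ℝ) 1) {U : ℝ}
    (hU : ∀ y ∈ Icc (0 : ℝ) 1, ‖u y‖ ≤ U) {m : ℝ} (hm : 0 < m) (h : 1 ≤ m * B) :
    ‖genCoeff (mode B m) u‖ ≤ 4 / B * U := by
  have h1 := le_integral_mode_sq hB hm h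
  have hB0 := hB.1
  rw [genCoeff, norm_div, Complex.norm_real, Real.norm_eq_abs,
    abs_of_pos (lt_of_lt_of_le (by positivity) h1), div_le_iff₀ (lt_of_lt_of_le (by positivity) h1)]
  have hU0 : 0 ≤ U := (norm_nonneg _).trans (hU 0 (by simp))
  calc _ ≤ U := norm_integral_mode_le hB hU hm
    _ = 4 / B * U * (B / 4) := by field_simp
    _ ≤ _ := by gcongr

/-- There are three errors of order `m⁻²`: `K₁` for the squared norm against `b/2`, `K₂` for the
interval `(b,1)`, and `K₃` for moving from the true to the model frequency. The bound `n + 1 ≤ m`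
converts them into powers of `n`. -/
theorem exists_genCoeff_bound (hb : b ∈ Ioo (0 : ℝ) 1) (hu : PiecewiseLipschitz u) :
    ∃ K : ℝ, ∀ n : ℕ, ‖genCoeff (mode b (freq (1 - b) hb.1 n)) u - coeff b u (n + 1)‖ ≤
      K / ((n : ℝ) + 1) ^ 2 := by
  obtain ⟨U, hU⟩ := hu.exists_bound
  obtain ⟨C, hC0, hC⟩ := hu.exists_rightLim_bound hb
  have hU0 : 0 ≤ U := (norm_nonneg _).trans (hU 0 (by simp))
  have hui := intervalIntegrable_of_memLp hu.memLp
  have hA := one_sub_pos hb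
  have hb0 := hb.1
  set r := Function.rightLim u b with hr
  set K₁ := U * (8 / b ^ 2 * (1 / (2 * (1 - b)))) with hK₁
  set K₂ := C + ‖r‖ / (1 - b) with hK₂
  set K₃ := (U + 2 * ‖r‖) * (1 / ((1 - b) ^ 3 * b)) with hK₃
  have hK₂0 : 0 ≤ K₂ := by positivity
  have hK₃0 : 0 ≤ K₃ := by positivity
  have hK₁0 : 0 ≤ K₁ := by positivity
  refine ⟨K₁ + 2 / b * (K₂ + K₃), fun n => ?_⟩
  set m := freq (1 - b) hb.1 n with hm
  set M := modelFreq b n with hM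
  have hn : (n : ℝ) + 1 ≤ m := add_one_le_freq hA hb.1 hb.2.le n
  have hn1 : (1 : ℝ) ≤ (n : ℝ) + 1 := by simp
  have hm1 : 1 ≤ m := hn1.trans hn
  have hm0 : 0 < m := by linarith
  have hmM : m ≤ M := freq_le_modelFreq _ _ n
  have hmb : 1 ≤ m * b := by
    have := pi_le_freq_mul hA hb.1 n
    nlinarith [Real.pi_gt_three]
  have hfreq : IsFreq (1 - b) b m := isFreq_freq _ _ n
  set N := ∫ x in (0 : ℝ)..1, mode b m x ^ 2 with hN
  set I := ∫ y in (0 : ℝ)..1, (mode b m y : ℂ) * u y with hI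
  have hN1 : b / 4 ≤ N := le_integral_mode_sq hb hm0 hmb
  have hN0 : 0 < N := lt_of_lt_of_le (by positivity) hN1
  have hN2 : |N - b / 2| ≤ 1 / (2 * (1 - b)) / m ^ 2 := abs_integral_mode_sq_sub_le hb hm0 hfreq
  have hI1 : ‖I‖ ≤ U := norm_integral_mode_le hb hU hm0
  have hI2 : ‖I - leadingPairing b u m‖ ≤ K₂ / m ^ 2 := norm_integral_mode_sub_le hb hui hC hm0
  have hI3 : ‖leadingPairing b u m - leadingPairing b u M‖ ≤ K₃ / m ^ 2 := by
    refine (norm_leadingPairing_sub_le hb hui hU hm1 (hm1.trans hmM)).trans ?_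
    rw [abs_sub_comm, abs_of_nonneg (sub_nonneg.2 hmM), hK₃, mul_div_assoc]
    refine mul_le_mul_of_nonneg_left ((modelFreq_sub_freq_le hA hb.1 n).trans ?_) (by positivity)
    exact div_le_div_of_nonneg_left (by positivity) (by positivity)
      (pow_le_pow_right₀ hm1 (by norm_num))
  have e : genCoeff (mode b m) u - coeff b u (n + 1) =
      I * ((1 / N - 2 / b : ℝ) : ℂ) + ((2 / b : ℝ) : ℂ) *
        ((I - leadingPairing b u m) + (leadingPairing b u m - leadingPairing b u M)) := by
    rw [coeff_succ_eq hb hui, genCoeff, ← hN, ← hI, ← hM]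
    push_cast; ring
  -- The constant `8 / b²` is `2 / (N b)` with `N` replaced by its lower bound `b / 4`.
  have h1 : |1 / N - 2 / b| ≤ 8 / b ^ 2 * (1 / (2 * (1 - b))) / m ^ 2 := by
    have e1 : 1 / N - 2 / b = -(N - b / 2) * (2 / (N * b)) := by field_simp; ring
    rw [e1, abs_mul, abs_neg, abs_of_pos (show 0 < 2 / (N * b) by positivity)]
    calc _ ≤ 1 / (2 * (1 - b)) / m ^ 2 * (2 / (b / 4 * b)) := by gcongr
      _ = _ := by field_simp; norm_num
  have h2 : ‖genCoeff (mode b m) u - coeff b u (n + 1)‖ ≤ (K₁ + 2 / b * (K₂ + K₃)) / m ^ 2 := by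
    rw [e]
    refine (norm_add_le _ _).trans ?_
    rw [norm_mul, norm_mul, Complex.norm_real, Complex.norm_real, Real.norm_eq_abs, Real.norm_eq_abs,
      abs_of_pos (show 0 < 2 / b by positivity), add_div]
    refine add_le_add ?_ ?_
    · rw [hK₁, mul_div_assoc]
      exact mul_le_mul hI1 h1 (abs_nonneg _) hU0
    · rw [mul_div_assoc, add_div]
      exact mul_le_mul_of_nonneg_left ((norm_add_le _ _).trans (add_le_add hI2 hI3)) (by positivity)
  refine h2.trans (div_le_div_of_nonneg_left (by positivity) (by positivity) ?_)
  exact pow_le_pow_left₀ (by positivity) hn 2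

end

section

/-! ### The terms of the eigenfunction expansion and of the revival series -/

/-- The contribution of the eigenvalue `l` to the solution with initial value `u`. -/
noncomputable def eigenTerm (b : ℝ) (u : ℝ → ℂ) (t l x : ℝ) : ℂ :=
  rot l t * (genCoeff (eigfun b l) u * (eigfun b l x : ℂ))

/-- The terms of the revival series, numbered from zero. -/
noncomputable def revivalTerm (b : ℝ) (u : ℝ → ℂ) (t : ℝ) (n : ℕ) (x : ℝ) : ℂ :=
  rot (modelFreq b n ^ 2) t * (coeff b u (n + 1) * (Real.sin (modelFreq b n * x) : ℂ))

variable {b : ℝ} {u : ℝ → ℂ}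

theorem revivalPartialSum_eq (N : ℕ) (x t : ℝ) :
    revivalPartialSum b u N x t = ∑ n ∈ Finset.range N, revivalTerm b u t n x := by
  rw [revivalPartialSum]
  induction N with
  | zero => simp
  | succ N ih =>
    rw [Finset.sum_Icc_succ_top (by omega), ih, Finset.sum_range_succ, revivalTerm, rot, modelFreq]
    congr 1
    rw [← mul_assoc, mul_comm (Complex.exp _) (coeff b u (N + 1))]
    congr 3
    push_cast; ring

theorem eigenTerm_sq (hb : b ∈ Ioo (0 : ℝ) 1) {m : ℝ} (hm : 0 < m) (t x : ℝ) :
    eigenTerm b u t (m ^ 2) x = rot (m ^ 2) t * (genCoeff (mode b m) u * (mode b m x : ℂ)) := by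
  have hs : Real.sinh (m * (1 - b)) / m ^ 2 ≠ 0 := (div_pos (sinh_pos hb hm) (by positivity)).ne'
  rw [eigenTerm, eigfun_sq hb hm, show eigfun b (m ^ 2) = _ from funext (eigfun_sq hb hm),
    genCoeff_mul hs]

theorem genCoeff_one_sub (φ : ℝ → ℝ) (u : ℝ → ℂ) :
    genCoeff (fun x => φ (1 - x)) u = genCoeff φ fun x => u (1 - x) := by
  rw [genCoeff, genCoeff]
  congr 1
  · have := intervalIntegral.integral_comp_sub_left (a := 0) (b := 1)
      (fun x => (φ x : ℂ) * u (1 - x)) 1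
    simpa using this
  · have := intervalIntegral.integral_comp_sub_left (a := 0) (b := 1) (fun x => φ x ^ 2) 1
    rw [sub_self, sub_zero] at this
    rw [this]

theorem eigenTerm_neg_sq (hb : b ∈ Ioo (0 : ℝ) 1) {m : ℝ} (hm : 0 < m) (t x : ℝ) :
    eigenTerm b u t (-m ^ 2) x = rot (-m ^ 2) t *
      (genCoeff (mode (1 - b) m) (fun y => u (1 - y)) * (mode (1 - b) m (1 - x) : ℂ)) := by
  have hs : Real.sinh (m * b) / m ^ 2 ≠ 0 :=
    (div_pos (Real.sinh_pos_iff.2 (mul_pos hm hb.1)) (by positivity)).ne'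
  rw [eigenTerm, eigfun_neg_sq hb hm, show eigfun b (-m ^ 2) = _ from funext (eigfun_neg_sq hb hm),
    genCoeff_mul hs (fun x => mode (1 - b) m (1 - x)), genCoeff_one_sub]

theorem continuous_eigenTerm {l : ℝ} (h : IsEigen b l) (t : ℝ) : Continuous (eigenTerm b u t l) :=
  continuous_const.mul (continuous_const.mul (Complex.continuous_ofReal.comp h.quasiSol.cont))

theorem continuous_revivalTerm (t : ℝ) (n : ℕ) : Continuous (revivalTerm b u t n) := by
  unfold revivalTerm
  fun_prop

theorem norm_rot_sub_rot_le (l₁ l₂ t : ℝ) : ‖rot l₁ t - rot l₂ t‖ ≤ |l₁ - l₂| * |t| := by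
  have e : rot l₁ t - rot l₂ t =
      rot l₂ t * (Complex.exp (Complex.I * ((-((l₁ - l₂) * t) : ℝ) : ℂ)) - 1) := by
    rw [mul_sub, mul_one, rot, rot, ← Complex.exp_add]
    congr 2
    push_cast; ring
  rw [e, norm_mul, norm_rot, one_mul, ← abs_mul, ← abs_neg]
  exact Real.norm_exp_I_mul_ofReal_sub_one_le

theorem summable_div_succ_sq (K : ℝ) : Summable fun n : ℕ => K / ((n : ℝ) + 1) ^ 2 := by
  have h := (summable_nat_add_iff 1).2 (Real.summable_one_div_nat_pow.2 (by norm_num : 1 < 2))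
  simpa [div_eq_mul_inv] using h.mul_left K

/-- Coefficient, time factor and sine are exchanged one at a time, each at cost `O(n⁻²)`. For the
time factor `M² - m² = (M - m)(M + m)` is at most `3m` times the cubic gap. Uniformity in `x` makes
the sum of the differences continuous. -/
theorem exists_eigenTerm_sub_bound (hb : b ∈ Ioo (0 : ℝ) 1) (hu : PiecewiseLipschitz u) (t : ℝ) :
    ∃ K : ℝ, ∀ n : ℕ, ∀ x ∈ Ioo 0 b,
      ‖eigenTerm b u t (posEig hb n) x - revivalTerm b u t n x‖ ≤ K / ((n : ℝ) + 1) ^ 2 := by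
  obtain ⟨U, hU⟩ := hu.exists_bound
  obtain ⟨K, hK⟩ := exists_genCoeff_bound hb hu
  have hA := one_sub_pos hb
  have hb0 := hb.1
  have hU0 : 0 ≤ U := (norm_nonneg _).trans (hU 0 (by simp))
  set V := 2 * (U + ‖Function.rightLim u b‖) with hV
  set J := 1 / ((1 - b) ^ 3 * b) with hJ
  have hJ0 : 0 ≤ J := by positivity
  have hV0 : 0 ≤ V := by positivity
  refine ⟨K + V * (3 * J * |t| + J), fun n x hx => ?_⟩
  set m := freq (1 - b) hb.1 n with hm
  set M := modelFreq b n with hM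
  have hn : (n : ℝ) + 1 ≤ m := add_one_le_freq hA hb.1 hb.2.le n
  have hn1 : (1 : ℝ) ≤ (n : ℝ) + 1 := by simp
  have hm1 : 1 ≤ m := hn1.trans hn
  have hm0 : 0 < m := by linarith
  have hmM : m ≤ M := freq_le_modelFreq _ _ n
  have hM2 : M ≤ 2 * m := modelFreq_le hA hb.1 n
  have hd : M - m ≤ J / m ^ 3 := modelFreq_sub_freq_le hA hb.1 n
  set γ := genCoeff (mode b m) u with hγ
  set c := coeff b u (n + 1) with hc
  have hγc : ‖γ - c‖ ≤ K / ((n : ℝ) + 1) ^ 2 := hK n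
  have hcV : ‖c‖ ≤ V := norm_coeff_le hb hU _
  have h2 : m ^ 2 ≤ m ^ 3 := pow_le_pow_right₀ hm1 (by norm_num)
  have hd2 : M - m ≤ J / ((n : ℝ) + 1) ^ 2 := by
    refine hd.trans (div_le_div_of_nonneg_left hJ0 (by positivity) ?_)
    exact (pow_le_pow_left₀ (by positivity) hn 2).trans h2
  have hd1 : M ^ 2 - m ^ 2 ≤ 3 * J / ((n : ℝ) + 1) ^ 2 := by
    calc M ^ 2 - m ^ 2 = (M - m) * (M + m) := by ring
      _ ≤ J / m ^ 3 * (3 * m) := by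
        refine mul_le_mul hd (by linarith) (by linarith) (by positivity)
      _ = 3 * J / m ^ 2 := by field_simp
      _ ≤ _ := div_le_div_of_nonneg_left (by positivity) (by positivity)
        (pow_le_pow_left₀ (by positivity) hn 2)
  have hrot : ‖rot (m ^ 2) t - rot (M ^ 2) t‖ ≤ 3 * J * |t| / ((n : ℝ) + 1) ^ 2 := by
    refine (norm_rot_sub_rot_le _ _ _).trans ?_
    rw [abs_sub_comm, abs_of_nonneg (sub_nonneg.2 (pow_le_pow_left₀ hm0.le hmM 2)), mul_div_right_comm]
    exact mul_le_mul_of_nonneg_right hd1 (abs_nonneg t)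
  have hsin : |Real.sin (m * x) - Real.sin (M * x)| ≤ J / ((n : ℝ) + 1) ^ 2 := by
    refine (abs_sin_sub_sin_le _ _).trans (le_trans ?_ hd2)
    rw [← sub_mul, abs_mul, abs_sub_comm, abs_of_nonneg (sub_nonneg.2 hmM), abs_of_pos hx.1]
    exact mul_le_of_le_one_right (sub_nonneg.2 hmM) (hx.2.trans hb.2).le
  have e1 : eigenTerm b u t (posEig hb n) x = rot (m ^ 2) t * (γ * (Real.sin (m * x) : ℂ)) := by
    rw [show ((posEig hb n : {l : ℝ // IsEigen b l}) : ℝ) = m ^ 2 from rfl, eigenTerm_sq hb hm0,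
      mode_of_le hx.2.le]
  have e2 : eigenTerm b u t (posEig hb n) x - revivalTerm b u t n x =
      rot (m ^ 2) t * ((γ - c) * (Real.sin (m * x) : ℂ)) +
        c * ((rot (m ^ 2) t - rot (M ^ 2) t) * (Real.sin (m * x) : ℂ) +
          rot (M ^ 2) t * ((Real.sin (m * x) - Real.sin (M * x) : ℝ) : ℂ)) := by
    rw [e1, revivalTerm, ← hM, ← hc]
    push_cast; ring
  rw [e2]
  have b1 : ‖rot (m ^ 2) t * ((γ - c) * (Real.sin (m * x) : ℂ))‖ ≤ K / ((n : ℝ) + 1) ^ 2 := by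
    rw [norm_mul, norm_rot, one_mul, norm_mul, Complex.norm_real]
    exact (mul_le_of_le_one_right (norm_nonneg _) (Real.abs_sin_le_one _)).trans hγc
  have b2 : ‖(rot (m ^ 2) t - rot (M ^ 2) t) * (Real.sin (m * x) : ℂ)‖ ≤
      3 * J * |t| / ((n : ℝ) + 1) ^ 2 := by
    rw [norm_mul, Complex.norm_real]
    exact (mul_le_of_le_one_right (norm_nonneg _) (Real.abs_sin_le_one _)).trans hrot
  have b3 : ‖rot (M ^ 2) t * ((Real.sin (m * x) - Real.sin (M * x) : ℝ) : ℂ)‖ ≤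
      J / ((n : ℝ) + 1) ^ 2 := by
    rw [norm_mul, norm_rot, one_mul, Complex.norm_real]
    exact hsin
  refine (norm_add_le _ _).trans ?_
  rw [add_div]
  refine add_le_add b1 ?_
  rw [norm_mul, mul_div_assoc, add_div]
  exact mul_le_mul hcV ((norm_add_le _ _).trans (add_le_add b2 b3)) (norm_nonneg _) hV0

/-- On `(0,b)` a negative mode is an exponential tail starting at `b`. At distance at least `b - c`
it is bounded through `exp y ≥ y²/2`; the constant blows up as `c → b`, so this argument gives only
locally uniform convergence on `(0,b)`. -/
theorem exists_eigenTerm_neg_bound (hb : b ∈ Ioo (0 : ℝ) 1) (hu : PiecewiseLipschitz u) {c : ℝ}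
    (hc : c < b) : ∃ K : ℝ, ∀ (t : ℝ) (n : ℕ), ∀ x ∈ Ioo 0 c,
      ‖eigenTerm b u t (negEig hb n) x‖ ≤ K / ((n : ℝ) + 1) ^ 2 := by
  obtain ⟨U, hU⟩ := hu.exists_bound
  have hA := one_sub_pos hb
  have hU0 : 0 ≤ U := (norm_nonneg _).trans (hU 0 (by simp))
  have hb' : 1 - b ∈ Ioo (0 : ℝ) 1 := ⟨hA, by linarith [hb.1]⟩
  have hδ : 0 < b - c := sub_pos.2 hc
  refine ⟨4 / (1 - b) * U * (2 / (b - c) ^ 2), fun t n x hx => ?_⟩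
  set m := freq b hA n with hm
  have hn : (n : ℝ) + 1 ≤ m := add_one_le_freq hb.1 hA hb'.2.le n
  have hn1 : (1 : ℝ) ≤ (n : ℝ) + 1 := by simp
  have hm0 : 0 < m := by linarith
  have hmb : 1 ≤ m * (1 - b) := by
    have := pi_le_freq_mul hb.1 hA n
    nlinarith [Real.pi_gt_three]
  have h1 : |mode (1 - b) m (1 - x)| ≤ 2 / (b - c) ^ 2 / ((n : ℝ) + 1) ^ 2 := by
    refine (abs_mode_le_exp hb' hm0 (by linarith [hx.2]) (by linarith [hx.1])).trans ?_
    have h2 : m * (b - c) ≤ m * (1 - x - (1 - b)) :=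
      mul_le_mul_of_nonneg_left (by linarith [hx.2]) hm0.le
    have h3 : (m * (b - c)) ^ 2 / 2 ≤ Real.exp (m * (1 - x - (1 - b))) := by
      have h4 := Real.quadratic_le_exp_of_nonneg (mul_pos hm0 hδ).le
      have h5 := Real.exp_le_exp.2 h2
      have h6 := mul_pos hm0 hδ
      linarith
    rw [Real.exp_neg]
    calc _ ≤ ((m * (b - c)) ^ 2 / 2)⁻¹ := inv_anti₀ (by positivity) h3
      _ = 2 / (b - c) ^ 2 / m ^ 2 := by field_simp
      _ ≤ _ := div_le_div_of_nonneg_left (by positivity) (by positivity)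
        (pow_le_pow_left₀ (by positivity) hn 2)
  rw [show ((negEig hb n : {l : ℝ // IsEigen b l}) : ℝ) = -m ^ 2 from rfl, eigenTerm_neg_sq hb hm0,
    norm_mul, norm_rot, one_mul, norm_mul, Complex.norm_real, mul_div_assoc]
  have h7 : ‖genCoeff (mode (1 - b) m) fun y => u (1 - y)‖ ≤ 4 / (1 - b) * U :=
    norm_genCoeff_mode_le hb' (fun y hy => hU _ ⟨sub_nonneg.2 hy.2, by linarith [hy.1]⟩) hm0 hmb
  exact mul_le_mul h7 h1 (norm_nonneg _) (by positivity)

end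

section

/-! ### Decomposition of the solution -/

variable {b : ℝ} {u : ℝ → ℂ}

theorem restrict_Ioo_le (hb : b ∈ Ioo (0 : ℝ) 1) :
    (volume.restrict (Ioo 0 b) : Measure ℝ) ≤ unitMeasure :=
  Measure.restrict_mono (Ioo_subset_Ioo_right hb.2.le) le_rfl

/-- The pointwise limit of a subsequence of an `L²`-convergent sequence is its `L²`-limit. -/
theorem exists_subseq_tendsto_ae {μ : Measure ℝ} {f : ℕ → ℝ → ℂ} {g : ℝ → ℂ}
    (hf : ∀ n, AEStronglyMeasurable (f n) μ) (hg : AEStronglyMeasurable g μ)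
    (h : Tendsto (fun n => eLpNorm (fun x => f n x - g x) 2 μ) atTop (𝓝 0)) :
    ∃ ns : ℕ → ℕ, StrictMono ns ∧ ∀ᵐ x ∂μ, Tendsto (fun i => f (ns i) x) atTop (𝓝 (g x)) :=
  (tendstoInMeasure_of_tendsto_eLpNorm (by norm_num) hf hg h).exists_seq_tendsto_ae

theorem ae_eq_of_tendsto {μ : Measure ℝ} {f : ℕ → ℝ → ℂ} {g h : ℝ → ℂ}
    (hf : ∀ n, AEStronglyMeasurable (f n) μ) (hg : AEStronglyMeasurable g μ)
    (hfg : Tendsto (fun n => eLpNorm (fun x => f n x - g x) 2 μ) atTop (𝓝 0))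
    (hfh : ∀ᵐ x ∂μ, Tendsto (fun n => f n x) atTop (𝓝 (h x))) : g =ᵐ[μ] h := by
  obtain ⟨ns, hns, hlim⟩ := exists_subseq_tendsto_ae hf hg hfg
  filter_upwards [hlim, hfh] with x h1 h2
  exact tendsto_nhds_unique h1 (h2.comp hns.tendsto_atTop)

theorem tendsto_eLpNorm_of_tendstoUniformlyOn {μ : Measure ℝ} [IsFiniteMeasure μ]
    {f : ℕ → ℝ → ℂ} {g : ℝ → ℂ} {s : Set ℝ} (hs : ∀ᵐ x ∂μ, x ∈ s)
    (h : TendstoUniformlyOn f g atTop s) :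
    Tendsto (fun n => eLpNorm (fun x => f n x - g x) 2 μ) atTop (𝓝 0) := by
  set c : ℝ≥0∞ := μ univ ^ (2 : ℝ≥0∞).toReal⁻¹ with hc
  have hc' : c ≠ ∞ := ENNReal.rpow_ne_top_of_nonneg (by norm_num) (measure_ne_top _ _)
  rw [ENNReal.tendsto_nhds_zero]
  intro ε hε
  have h0 : Tendsto (fun r : ℝ => c * ENNReal.ofReal r) (𝓝[>] 0) (𝓝 0) := by
    have h1 : Tendsto (fun r : ℝ => ENNReal.ofReal r) (𝓝[>] 0) (𝓝 0) := by
      have := (ENNReal.continuous_ofReal.tendsto 0).mono_left (nhdsWithin_le_nhds (s := Ioi 0))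
      simpa using this
    simpa using ENNReal.Tendsto.const_mul h1 (Or.inr hc')
  obtain ⟨r, hr, hr0⟩ := ((ENNReal.tendsto_nhds_zero.1 h0 ε hε).and self_mem_nhdsWithin).exists
  filter_upwards [Metric.tendstoUniformlyOn_iff.1 h r hr0] with n hn
  refine (eLpNorm_le_of_ae_bound (C := r) ?_).trans hr
  filter_upwards [hs] with x hx
  rw [← dist_eq_norm, dist_comm]
  exact (hn x hx).le

theorem tendsto_eLpNorm_coe {f : ℕ → UnitL2} {g : UnitL2} (h : Tendsto f atTop (𝓝 g))
    {f' : ℕ → ℝ → ℂ} (hf' : ∀ n, ∀ᵐ x ∂unitMeasure, (f n : ℝ → ℂ) x = f' n x) :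
    Tendsto (fun n => eLpNorm (fun x => f' n x - (g : ℝ → ℂ) x) 2 unitMeasure) atTop (𝓝 0) := by
  refine ((Lp.tendsto_Lp_iff_tendsto_eLpNorm' f g).1 h).congr fun n => eLpNorm_congr_ae ?_
  filter_upwards [hf' n] with x hx
  rw [Pi.sub_apply, hx]

theorem ae_sum_eigenTerm (hb : b ∈ Ioo (0 : ℝ) 1) (hu : MemLp u 2 unitMeasure) (t : ℝ)
    {ι : Type*} (s : Finset ι) (e : ι → {l : ℝ // IsEigen b l}) :
    ∀ᵐ x ∂unitMeasure, ((∑ i ∈ s, (rot (e i) t * (inner ℂ (eigvec b hb (e i)) (hu.toLp u) /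
      (‖eigvec b hb (e i)‖ : ℂ) ^ 2)) • eigvec b hb (e i) : UnitL2) : ℝ → ℂ) x =
      ∑ i ∈ s, eigenTerm b u t (e i) x := by
  refine (Lp.coeFn_fun_finsetSum s _).trans ?_
  have h : ∀ᵐ x ∂unitMeasure, ∀ i ∈ s, (((rot (e i) t * (inner ℂ (eigvec b hb (e i)) (hu.toLp u) /
      (‖eigvec b hb (e i)‖ : ℂ) ^ 2)) • eigvec b hb (e i) : UnitL2) : ℝ → ℂ) x =
      eigenTerm b u t (e i) x := by
    refine (ae_ball_iff (Finset.countable_toSet s)).2 fun i _ => ?_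
    filter_upwards [Lp.coeFn_smul (rot (e i) t * (inner ℂ (eigvec b hb (e i)) (hu.toLp u) /
      (‖eigvec b hb (e i)‖ : ℂ) ^ 2)) (eigvec b hb (e i)), eigvec_coeFn hb (e i)] with x h1 h2
    rw [h1, Pi.smul_apply, h2, inner_eigvec_div_eq hb hu, eigenTerm, smul_eq_mul, mul_assoc]
  filter_upwards [h] with x hx
  exact Finset.sum_congr rfl hx

/-- The positive eigenvalues sum to `p` in `L²`. Subtracting the uniformly convergent sum `E` of
their differences from the revival terms leaves the revival sum, and `E` moves to the continuous
part together with the negative and the finitely many remaining terms. -/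
theorem exists_decomposition (hb : b ∈ Ioo (0 : ℝ) 1) (hu : PiecewiseLipschitz u) (t : ℝ) :
    ∃ R C : ℝ → ℂ, MemLp R 2 (volume.restrict (Ioo 0 b)) ∧
      Tendsto (fun N : ℕ => eLpNorm (fun x => revivalPartialSum b u N x t - R x) 2
        (volume.restrict (Ioo 0 b))) atTop (𝓝 0) ∧
      ContinuousOn C (Ioo 0 b) ∧
      ∀ᵐ x ∂(volume.restrict (Ioo (0 : ℝ) b)),
        ((diagEvolution (eigbasis hb) (fun l => l) (hu.memLp.toLp u) t : UnitL2) : ℝ → ℂ) x = R x + C x := by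
  obtain ⟨K, hK⟩ := exists_eigenTerm_sub_bound hb hu t
  obtain ⟨p, q, hp, hq, hv⟩ := hasSum_split hb (hasSum_evolution hb (hu.memLp.toLp u) t)
  set ν : Measure ℝ := volume.restrict (Ioo 0 b) with hν
  have hle : ν ≤ unitMeasure := restrict_Ioo_le hb
  have hac : ν ≪ unitMeasure := hle.absolutelyContinuous
  have hmem : ∀ᵐ x ∂ν, x ∈ Ioo 0 b := ae_restrict_mem measurableSet_Ioo
  have hmeas : ∀ w : UnitL2, AEStronglyMeasurable (w : ℝ → ℂ) ν := fun w =>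
    (Lp.aestronglyMeasurable w).mono_ac hac
  have restrict : ∀ {f : ℕ → ℝ → ℂ}, Tendsto (fun n => eLpNorm (f n) 2 unitMeasure) atTop (𝓝 0) →
      Tendsto (fun n => eLpNorm (f n) 2 ν) atTop (𝓝 0) := fun h =>
    tendsto_of_tendsto_of_tendsto_of_le_of_le tendsto_const_nhds h (fun _ => zero_le)
      fun _ => eLpNorm_mono_measure _ hle
  have hp' := restrict (tendsto_eLpNorm_coe hp fun N =>
    ae_sum_eigenTerm hb hu.memLp t (Finset.range N) (posEig hb))
  have hq' := restrict (tendsto_eLpNorm_coe hq fun N =>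
    ae_sum_eigenTerm hb hu.memLp t (Finset.range N) (negEig hb))
  set D : ℕ → ℝ → ℂ := fun n x => eigenTerm b u t (posEig hb n) x - revivalTerm b u t n x with hD
  have hDc : ∀ n, Continuous (D n) := fun n =>
    (continuous_eigenTerm (posEig hb n).2 t).sub (continuous_revivalTerm t n)
  set E : ℝ → ℂ := fun x => ∑' n, D n x with hE
  have hEc : ContinuousOn E (Ioo 0 b) :=
    continuousOn_tsum (fun n => (hDc n).continuousOn) (summable_div_succ_sq K) hK
  have hEu := tendstoUniformlyOn_tsum_nat (summable_div_succ_sq K) hK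
  have hE' := tendsto_eLpNorm_of_tendstoUniformlyOn hmem hEu
  have hEm : AEStronglyMeasurable E ν := hEc.aestronglyMeasurable measurableSet_Ioo
  -- Continuity is local, so each point is placed in some `(0,c)` with `c < b`, where the series
  -- converges uniformly.
  have hQc : ContinuousOn (fun x => ∑' n, eigenTerm b u t (negEig hb n) x) (Ioo 0 b) := by
    intro x hx
    obtain ⟨c, hxc, hcb⟩ := exists_between hx.2
    obtain ⟨K', hK'⟩ := exists_eigenTerm_neg_bound hb hu hcb
    refine ContinuousAt.continuousWithinAt ?_
    exact (continuousOn_tsum (fun n => (continuous_eigenTerm (negEig hb n).2 t).continuousOn)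
      (summable_div_succ_sq K') (hK' t)).continuousAt (Ioo_mem_nhds hx.1 hxc)
  -- The `L²` limit agrees almost everywhere with the pointwise sum, because a subsequence of the
  -- partial sums converges to it almost everywhere.
  have hQ : (q : ℝ → ℂ) =ᵐ[ν] fun x => ∑' n, eigenTerm b u t (negEig hb n) x := by
    refine ae_eq_of_tendsto (fun N => Continuous.aestronglyMeasurable ?_) (hmeas q) hq' ?_
    · exact continuous_finsetSum _ fun n _ => continuous_eigenTerm (negEig hb n).2 t
    · filter_upwards [hmem] with x hx
      obtain ⟨c, hxc, hcb⟩ := exists_between hx.2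
      obtain ⟨K', hK'⟩ := exists_eigenTerm_neg_bound hb hu hcb
      exact (Summable.of_norm_bounded (summable_div_succ_sq K')
        fun n => hK' t n x ⟨hx.1, hxc⟩).hasSum.tendsto_sum_nat
  have hEb : MemLp E 2 ν := by
    refine MemLp.of_bound hEm (∑' n : ℕ, K / ((n : ℝ) + 1) ^ 2) ?_
    filter_upwards [hmem] with x hx
    exact tsum_of_norm_bounded (summable_div_succ_sq K).hasSum fun n => hK n x hx
  refine ⟨fun x => (p : ℝ → ℂ) x - E x, fun x =>
    ∑ l ∈ (finite_rest hb).toFinset, eigenTerm b u t l x +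
      ∑' n, eigenTerm b u t (negEig hb n) x + E x, ((Lp.memLp p).mono_measure hle).sub hEb, ?_,
    ?_, ?_⟩
  · have h0 : Tendsto (fun N : ℕ =>
        eLpNorm (fun x => ∑ n ∈ Finset.range N, eigenTerm b u t (posEig hb n) x - (p : ℝ → ℂ) x) 2 ν
        + eLpNorm (fun x => ∑ n ∈ Finset.range N, D n x - E x) 2 ν) atTop (𝓝 0) := by
      simpa only [add_zero] using hp'.add hE'
    refine tendsto_of_tendsto_of_tendsto_of_le_of_le tendsto_const_nhds h0 (fun _ => zero_le)
      fun N => ?_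
    have e : (fun x => revivalPartialSum b u N x t - ((p : ℝ → ℂ) x - E x)) =
        (fun x => ∑ n ∈ Finset.range N, eigenTerm b u t (posEig hb n) x - (p : ℝ → ℂ) x) -
          fun x => ∑ n ∈ Finset.range N, D n x - E x := by
      funext x
      rw [revivalPartialSum_eq, Pi.sub_apply, hD, Finset.sum_sub_distrib]
      ring
    simp only [e]
    refine eLpNorm_sub_le ?_ ?_ (by norm_num)
    · exact (continuous_finsetSum _ fun n _ =>
        continuous_eigenTerm (posEig hb n).2 t).aestronglyMeasurable.sub (hmeas p)
    · exact (continuous_finsetSum _ fun n _ => hDc n).aestronglyMeasurable.sub hEm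
  · refine (ContinuousOn.add ?_ hQc).add hEc
    exact (continuous_finsetSum _ fun l _ => continuous_eigenTerm l.2 t).continuousOn
  · rw [hv]
    filter_upwards [hac (Lp.coeFn_add (_ + p) q), hac (Lp.coeFn_add _ p), hQ,
      hac (ae_sum_eigenTerm hb hu.memLp t (finite_rest hb).toFinset id)] with x h1 h2 h3 h4
    rw [h1, Pi.add_apply, h2, Pi.add_apply, h3]
    simp only [id_eq] at h4
    rw [h4]
    ring

/-- The sum of the revival series: the pointwise sum where it converges, else the value of a
representative of the `L²`-sum. -/
theorem exists_revivalSum {ν : Measure ℝ} {f : ℕ → ℝ → ℂ} {R : ℝ → ℂ} (hf : ∀ N, Continuous (f N))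
    (hR : MemLp R 2 ν) (h : Tendsto (fun N => eLpNorm (fun x => f N x - R x) 2 ν) atTop (𝓝 0)) :
    ∃ S : ℝ → ℂ, S =ᵐ[ν] R ∧ ∀ x s, Tendsto (fun N => f N x) atTop (𝓝 s) → S x = s := by
  classical
  refine ⟨fun x => if hx : ∃ s, Tendsto (fun N => f N x) atTop (𝓝 s) then hx.choose else R x,
    ?_, fun x s hs => ?_⟩
  · obtain ⟨ns, hns, hlim⟩ := exists_subseq_tendsto_ae (fun N => (hf N).aestronglyMeasurable) hR.1 h
    filter_upwards [hlim] with x h1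
    split_ifs with hx
    · exact tendsto_nhds_unique (hx.choose_spec.comp hns.tendsto_atTop) h1
    · rfl
  · have hx : ∃ s, Tendsto (fun N => f N x) atTop (𝓝 s) := ⟨s, hs⟩
    simp only [dif_pos hx]
    exact tendsto_nhds_unique hx.choose_spec hs

theorem continuous_revivalPartialSum (N : ℕ) (t : ℝ) :
    Continuous fun x => revivalPartialSum b u N x t := by
  unfold revivalPartialSum
  fun_prop

end

end DislocatedSchrodinger

theorem theorem2p2 (b : ℝ) (hb : b ∈ Ioo (0 : ℝ) 1) (u₀ : ℝ → ℂ) (hu₀ : PiecewiseLipschitz u₀) :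
    -- the problem has exactly one solution
    (∃! u : ℝ → Lp ℂ 2 unitMeasure, IsSolution b u₀ u) ∧
    ∃ UR : ℝ → ℝ → ℂ,
      -- `UR(·,t)` is the sum of the revival series, in `L²(0,b)` for each `t`, and also pointwise
      -- wherever the series converges
      (∀ t : ℝ, MemLp (fun x => UR x t) 2 (volume.restrict (Ioo 0 b)) ∧
        Tendsto (fun N : ℕ => eLpNorm (fun x => revivalPartialSum b u₀ N x t - UR x t) 2
          (volume.restrict (Ioo 0 b))) atTop (𝓝 0)) ∧
      (∀ t : ℝ, ∀ x ∈ Ioo (0 : ℝ) b, ∀ s : ℂ,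
        Tendsto (fun N : ℕ => revivalPartialSum b u₀ N x t) atTop (𝓝 s) → UR x t = s) ∧
      -- the solution is `UR` plus a function continuous in `x ∈ (0,b)`
      (∀ u : ℝ → Lp ℂ 2 unitMeasure, IsSolution b u₀ u →
        ∃ UC : ℝ → ℝ → ℂ, ∀ t : ℝ, ContinuousOn (fun x => UC x t) (Ioo 0 b) ∧
          ∀ᵐ x ∂(volume.restrict (Ioo (0 : ℝ) b)), (u t : ℝ → ℂ) x = UR x t + UC x t) ∧
      -- rational times
      ∀ p q : ℕ, 0 < q → Nat.Coprime p q →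
        Continuous (L₃ b u₀ p q) ∧
        (exceptionalSet b u₀ q).Finite ∧
        ∀ x ∈ Ioo (0 : ℝ) b, x ∉ exceptionalSet b u₀ q →
          (∀ k < 2 * q,
            Tendsto (fun N : ℕ => hilbertPartialSum 2 (profile b u₀) N (x / b - (k : ℝ) / (q : ℝ)))
              atTop (𝓝 (hilbertTransform 2 (profile b u₀) (x / b - (k : ℝ) / (q : ℝ)))) ∧
            Tendsto
              (fun N : ℕ => hilbertPartialSum 2 (profile b u₀) N (-(x / b) - (k : ℝ) / (q : ℝ)))
              atTop (𝓝 (hilbertTransform 2 (profile b u₀) (-(x / b) - (k : ℝ) / (q : ℝ))))) ∧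
          Tendsto (fun N : ℕ => revivalPartialSum b u₀ N x
              (2 * b ^ 2 / Real.pi * ((p : ℝ) / (q : ℝ))))
            atTop (𝓝 (L₁ b u₀ p q x + L₂ b u₀ p q x + L₃ b u₀ p q x)) ∧
          UR x (2 * b ^ 2 / Real.pi * ((p : ℝ) / (q : ℝ)))
            = L₁ b u₀ p q x + L₂ b u₀ p q x + L₃ b u₀ p q x := by
  refine ⟨existsUnique_isSolution hb hu₀.memLp, ?_⟩
  choose R C hR hRs hC hRC using exists_decomposition hb hu₀
  -- The representative is chosen to take the pointwise sum wherever there is one, so that a single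
  -- function serves both the `L²` and the pointwise assertions.
  choose S hSR hS using fun t =>
    exists_revivalSum (fun N => continuous_revivalPartialSum (b := b) (u := u₀) N t) (hR t) (hRs t)
  refine ⟨fun x t => S t x, fun t => ⟨(memLp_congr_ae (hSR t)).2 (hR t), ?_⟩,
    fun t x _ s hs => hS t x s hs, fun u hu => ⟨fun x t => C t x, fun t => ⟨hC t, ?_⟩⟩,
    fun p q hq _ => ⟨continuous_L₃ p q, exceptionalSet_finite hb hu₀ q, fun x hx hxe => ?_⟩⟩
  · refine (hRs t).congr fun N => eLpNorm_congr_ae ?_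
    filter_upwards [hSR t] with x h
    rw [h]
  · rw [hu.eq_diagEvolution hb hu₀.memLp]
    filter_upwards [hRC t, hSR t] with x h1 h2
    rw [h1, h2]
  · have hcont : ∀ k < 2 * q, ContinuousAt (profile b u₀) (x / b - (k : ℝ) / (q : ℝ)) ∧
        ContinuousAt (profile b u₀) (-(x / b) - (k : ℝ) / (q : ℝ)) := fun k hk => by
      by_contra h
      exact hxe ⟨hx, k, hk, not_and_or.1 h⟩
    obtain ⟨h1, h2⟩ := tendsto_revivalPartialSum_rational (p := p) hb hu₀ hq hcont
    exact ⟨h1, h2, hS _ x _ h2⟩
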